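/- Let $E$ be an elliptic curve over $\mathbb{Q}$ given by a global minimal Weierstrass equation $y^2+a_1xy+a_3y=x^3+a_2x^2+a_4x+a_6$ with $a_i\in\mathbb{Z}$, with the usual invariants $c_4,c_6,\Delta$, and let $\omega=dx/(2y+a_1x+a_3)$ be its minimal invariant differential. Let $d<0$ be a squarefree integer, and let $E^d$ be the quadratic twist $$y^2+a_1xy+a_3y=x^3+\Bigl(a_2d+\tfrac{a_1^2(d-1)}{4}\Bigr)x^2+\Bigl(a_4d^2+\tfrac{a_1a_3(d^2-1)}{2}\Bigr)x+a_6d^3+\tfrac{a_3^2(d^3-1)}{4}.$$ Put $\Omega(E)=\int_{E(\mathbb{R})}|\omega|$, and $\Omega(E^d)=\int_{E'(\mathbb{R})}|\omega'|$, where $E'$ is any global minimal Weierstrass equation of $E^d$ over $\mathbb{Q}$ and $\omega'$ is its invariant differential. Put $\|\omega\|^2=i\int_{E(\mathbb{C})}\omega\wedge\overline{\omega}$ (complex orientation), that is, twice the area of $E(\mathbb{C})$ in the metric $|\omega|^2$, which is twice the covolume of the period lattice of $\omega$. Let $E^0(\mathbb{R})$ be the identity component of $E(\mathbb{R})$. Let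 $\mathrm{sig}(E)=(\mathrm{ord}_2(c_4),\mathrm{ord}_2(c_6),\mathrm{ord}_2(\Delta))$ and $\lambda_p=\min\{3\,\mathrm{ord}_p(c_4),2\,\mathrm{ord}_p(c_6),\mathrm{ord}_p(\Delta)\}$, with $\mathrm{ord}_p(0)=\infty$. Let $\delta=\delta(E,d)=\prod_{p\mid 2d}p^{\delta_p}$, where a dot stands for an arbitrary entry and - for odd $p$: $\delta_p=1$ if $\lambda_p<6$, or if $p=3$ and $\mathrm{ord}_3(c_6)=5$; otherwise $\delta_p=-1$; - if $d\equiv1\pmod 4$: $\delta_2=0$; - if $d\equiv3\pmod 4$: $\delta_2=2$ if $\mathrm{sig}(E)=(0,0,\cdot)$ or $(\cdot,3,0)$; $\delta_2=-2$ if $\mathrm{sig}(E)=(4,6,c)$ with $c\ge12$ and $2^{-6}c_6d\equiv-1\pmod 4$, or if $\mathrm{sig}(E)=(a,9,12)$ with $a\ge8$ and $2^{-9}c_6d\equiv1\pmod 4$; otherwise $\delta_2=0$; - if $d\equiv2\pmod 4$: $\delta_2=3$ if $\mathrm{sig}(E)=(0,0,\cdot)$; $\delta_2=-3$ if $\mathrm{sig}(E)=(6,9,c)$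 with $c\ge18$ and $2^{-10}c_6d\equiv-1\pmod 4$; $\delta_2=1$ if $\mathrm{ord}_2(c_4)\in\{4,5\}$, or if $\mathrm{ord}_2(c_6)\in\{3,5,7\}$, or if $\mathrm{sig}(E)=(a,6,6)$ with $a\ge6$ and $2^{-7}c_6d\equiv-1\pmod 4$; otherwise $\delta_2=-1$ (the conditions are tested in this order). Then $$\Omega(E)\cdot\Omega(E^d)\cdot\delta^{1/2}=[E(\mathbb{R}):E^0(\mathbb{R})]\cdot\|\omega\|^2.$$ -/

import Mathlib

namespace WeierstrassCurve

/-- A Weierstrass equation with integer coefficients of an elliptic curve over `ℚ` is globally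
minimal if it is minimal over `ℚ_[p]` for every prime number `p`. -/
structure IsGlobalMinimal (W : WeierstrassCurve ℤ) : Prop where
  isElliptic : (W.baseChange ℚ).IsElliptic
  isMinimal : ∀ (p : ℕ) [Fact p.Prime], IsMinimal ℤ_[p] (W.baseChange ℚ_[p])

/-- The quadratic twist by `d` of a Weierstrass curve over `ℚ`, in the form
`y² + a₁xy + a₃y = x³ + (a₂d + a₁²(d-1)/4)x² + (a₄d² + a₁a₃(d²-1)/2)x + a₆d³ + a₃²(d³-1)/4`. -/
def quadraticTwist (E : WeierstrassCurve ℚ) (d : ℚ) : WeierstrassCurve ℚ where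
  a₁ := E.a₁
  a₂ := E.a₂ * d + E.a₁ ^ 2 * (d - 1) / 4
  a₃ := E.a₃
  a₄ := E.a₄ * d ^ 2 + E.a₁ * E.a₃ * (d ^ 2 - 1) / 2
  a₆ := E.a₆ * d ^ 3 + E.a₃ ^ 2 * (d ^ 3 - 1) / 4

/-- The `p`-adic order of an integer, with value `⊤` at `0`. -/
noncomputable def intOrd (p : ℕ) (n : ℤ) : ℕ∞ := emultiplicity (p : ℤ) n

/-- `λ_p = min {3 ord_p(c₄), 2 ord_p(c₆), ord_p(Δ)}`. -/
noncomputable def twistLambda (W : WeierstrassCurve ℤ) (p : ℕ) : ℕ∞ :=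
  min (3 * intOrd p W.c₄) (min (2 * intOrd p W.c₆) (intOrd p W.Δ))

open Classical in
/-- The exponent `δ_p` for an odd prime `p` dividing `d`. -/
noncomputable def twistExponentOdd (W : WeierstrassCurve ℤ) (p : ℕ) : ℤ :=
  if W.twistLambda p < 6 ∨ (p = 3 ∧ intOrd 3 W.c₆ = 5) then 1 else -1

open Classical in
/-- The exponent `δ_2`, for `d` not divisible by `4`. In each congruence below the power of `2`
divides the numerator, so that the integer division is exact. -/
noncomputable def twistExponentTwo (W : WeierstrassCurve ℤ) (d : ℤ) : ℤ :=
  let o₄ := intOrd 2 W.c₄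
  let o₆ := intOrd 2 W.c₆
  let oΔ := intOrd 2 W.Δ
  if d ≡ 1 [ZMOD 4] then 0
  else if d ≡ 3 [ZMOD 4] then
    if (o₄ = 0 ∧ o₆ = 0) ∨ (o₆ = 3 ∧ oΔ = 0) then 2
    else if (o₄ = 4 ∧ o₆ = 6 ∧ 12 ≤ oΔ ∧ W.c₆ * d / 2 ^ 6 ≡ -1 [ZMOD 4]) ∨
        (8 ≤ o₄ ∧ o₆ = 9 ∧ oΔ = 12 ∧ W.c₆ * d / 2 ^ 9 ≡ 1 [ZMOD 4]) then -2
    else 0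
  else
    if o₄ = 0 ∧ o₆ = 0 then 3
    else if o₄ = 6 ∧ o₆ = 9 ∧ 18 ≤ oΔ ∧ W.c₆ * d / 2 ^ 10 ≡ -1 [ZMOD 4] then -3
    else if (o₄ = 4 ∨ o₄ = 5) ∨ (o₆ = 3 ∨ o₆ = 5 ∨ o₆ = 7) ∨
        (6 ≤ o₄ ∧ o₆ = 6 ∧ oΔ = 6 ∧ W.c₆ * d / 2 ^ 7 ≡ -1 [ZMOD 4]) then 1
    else -1

/-- `δ(E, d) = ∏_{p ∣ 2d} p ^ δ_p`. -/
noncomputable def twistDelta (W : WeierstrassCurve ℤ) (d : ℤ) : ℝ :=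
  ∏ p ∈ (2 * d).natAbs.primeFactors,
    (p : ℝ) ^ (if p = 2 then W.twistExponentTwo d else W.twistExponentOdd p)

/-- `∫_{E(ℝ)} |ω|` for `ω = dx / (2y + a₁x + a₃)`. The integral over `E(ℝ)` is written in the
coordinate `x`, which is a local coordinate outside the finitely many points of order at most two:
one integrates over `x` the sum over the points of `E(ℝ)` above `x`. -/
noncomputable def realPeriod (W : WeierstrassCurve ℝ) : ℝ :=
  ∫ x : ℝ, ∑ᶠ y ∈ {y : ℝ | W.toAffine.Equation x y}, |2 * y + W.a₁ * x + W.a₃|⁻¹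

/-- `‖ω‖² = i ∫_{E(ℂ)} ω ∧ ω̄` for `ω = dx / (2y + a₁x + a₃)`, which is twice the area of `E(ℂ)`
for the area form of the metric `|ω|²`, that is, twice the covolume of the period lattice of `ω`.
As `i dx ∧ dx̄` is twice the Lebesgue measure of the `x`-plane, this is twice the integral over
`x : ℂ` of the sum of `|2y + a₁x + a₃|⁻²` over the points `(x, y)` of `E(ℂ)` above `x`. -/
noncomputable def periodNormSq (W : WeierstrassCurve ℂ) : ℝ :=
  2 * ∫ x : ℂ, ∑ᶠ y ∈ {y : ℂ | W.toAffine.Equation x y}, (‖2 * y + W.a₁ * x + W.a₃‖ ^ 2)⁻¹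

/-- The points of a real Weierstrass curve in the one-point compactification of the plane. -/
def pointToOnePoint (W : WeierstrassCurve ℝ) : W.toAffine.Point → OnePoint (ℝ × ℝ)
  | .zero => OnePoint.infty
  | .some x y _ => ((x, y) : ℝ × ℝ)

/-- The topology of `E(ℝ)`. As `E(ℝ)` is closed in the compact space `ℙ²(ℝ)` and the origin is its
only point at infinity, `E(ℝ)` is the one-point compactification of its affine part. -/
@[reducible]
def realPointTopology (W : WeierstrassCurve ℝ) : TopologicalSpace W.toAffine.Point :=
  TopologicalSpace.induced W.pointToOnePoint inferInstance

/-- The identity component `E⁰(ℝ)` as a subgroup of `E(ℝ)`. The connected component of the origin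
is already closed under the group law, so the closure adds no points. -/
noncomputable def realIdentityComponent (W : WeierstrassCurve ℝ) :
    AddSubgroup W.toAffine.Point :=
  AddSubgroup.closure (@connectedComponent _ W.realPointTopology 0)

end WeierstrassCurve

/-!
Multiplicativity of periods under an imaginary quadratic twist.

Completing the square turns the equation of a Weierstrass curve into `Y² = g(x)` with the monic
cubic `g = squareCubic`. The twist by `d < 0` turns `g` into `α⁻³ g(αx + τ)` with `α = u² / d < 0`,
where `u` is the scaling factor of the change of variables from `E^d` to its minimal model. Hence
`Ω(E)` is the integral `J⁺` of `|g|^(-1/2)` over the set `g > 0`, and `Ω(E^d)` is `√|α|` times the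
integral `J⁻` over the set `g < 0`. The theorem splits into three independent statements.

* `|α| δ = 1` (`abs_scaling_mul_twistDelta`). A pair `(c₄, c₆)` of invariants comes from a
  Weierstrass equation over `ℤ_p` exactly under Kraus's conditions (`krausCondition_int`,
  `exists_curve_of_krausCondition`), so minimality of both equations at `p` determines the order
  of `α` at `p`: it is the largest admissible one of its parity (`isKrausLevel_iff`). A case
  distinction identifies it with `-δ_p` (`padicValRat_scaling`).

* `J⁺ J⁻ = n ‖ω‖²`, where `‖ω‖²` is the integral of `|g|⁻¹` over the complex plane and `n` is `2`
  or `1` as `g` has three real roots or one. With three real roots, adding a real point with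
  abscissa `p` beyond the last root to a point with abscissa `q` before the first root and
  imaginary ordinate maps the quadrant of all `(p, q)` bijectively to the upper half plane and turns
  the product of the invariant differentials into the area form (`lintegral_upper_cubic`). This is
  the decomposition of a rectangular period lattice, carried out by an algebraic substitution.
  With one real root, the 2-isogeny `x ↦ (x - e) + β / (x - e)` onto a curve with three real roots
  reduces the claim to the previous case (`realIntegral_mul_of_one_root`).

* `n` is the index of the identity component (`index_realIdentityComponent_of_three_roots`,
  `index_realIdentityComponent_of_one_root`). The unbounded branch, closed up by the origin, is
  connected, open and closed. If `g` has three real roots, it is a subgroup of index two: for `c`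
  between the last two roots, an even number of three collinear points lies to the left of `c`,
  since the equation of the curve has a definite sign on the vertical line over `c`
  (`mul_addX_sub_pos`).
-/

namespace WeierstrassCurve

/-! ### Kraus's local conditions on `c₄` and `c₆` -/

/-- Kraus's conditions at the prime `p` on a pair `(x, y)`: over `ℤ_[p]` they say that `x` and `y`
are the invariants `c₄` and `c₆` of a Weierstrass equation with coefficients in `ℤ_[p]`. There is no
condition at `p > 3`. -/
def KrausCondition (p : ℕ) {R : Type*} [CommRing R] (x y : R) : Prop :=
  (p = 2 → 64 ∣ x ^ 3 - y ^ 2 ∧ (4 ∣ y + 1 ∨ 16 ∣ x ∧ (32 ∣ y ∨ 32 ∣ y - 8))) ∧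
    (p = 3 → 27 ∣ x ^ 3 - y ^ 2 ∧ (9 ∣ y → 27 ∣ y))

section Field

variable {K : Type*} [Field K] [CharZero K]

/-- In characteristic zero every Weierstrass curve has a short form with the same `c₄` and `c₆`. -/
lemma exists_variableChange_short (W : WeierstrassCurve K) :
    ∃ C : VariableChange K, C.u = 1 ∧ C • W = ⟨0, 0, 0, -W.c₄ / 48, -W.c₆ / 864⟩ := by
  refine ⟨⟨1, -W.b₂ / 12, -W.a₁ / 2, -W.a₃ / 2 + W.a₁ * W.b₂ / 24⟩, rfl, ?_⟩
  rw [variableChange_def]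
  ext <;> simp [c₄, c₆, b₂, b₄, b₆] <;> ring

/-- In characteristic zero the pair `(c₄, c₆)` determines a Weierstrass curve up to a change of
variables. -/
lemma exists_variableChange_of_c₄_c₆ {W V : WeierstrassCurve K} (w : Kˣ)
    (h₄ : W.c₄ = w ^ 4 * V.c₄) (h₆ : W.c₆ = w ^ 6 * V.c₆) :
    ∃ C : VariableChange K, C.u = w ∧ C • W = V := by
  obtain ⟨C, hC, hCW⟩ := exists_variableChange_short W
  obtain ⟨D, hD, hDV⟩ := exists_variableChange_short V
  refine ⟨D⁻¹ * (⟨w, 0, 0, 0⟩ * C), ?_, ?_⟩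
  · simp [VariableChange.mul_def, VariableChange.inv_def, hC, hD]
  · rw [mul_smul, mul_smul, inv_smul_eq_iff, hDV, hCW, variableChange_def, h₄, h₆]
    have hw : (w : K) ≠ 0 := w.ne_zero
    ext <;> simp <;> field_simp

end Field

section Padic

variable {p : ℕ} [hp : Fact p.Prime]

lemma isUnit_natCast_padicInt {n : ℕ} (hn : ¬ p ∣ n) : IsUnit (n : ℤ_[p]) := by
  by_contra h
  have h1 : ‖((n : ℤ) : ℤ_[p])‖ < 1 := by
    rw [Int.cast_natCast]; exact PadicInt.mem_nonunits.1 h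
  rw [PadicInt.norm_int_lt_one_iff_dvd] at h1
  exact hn (by exact_mod_cast h1)

lemma exists_mul_eq_one_padicInt {n : ℕ} (hn : ¬ p ∣ n) : ∃ i : ℤ_[p], i * n = 1 :=
  (isUnit_natCast_padicInt hn).exists_left_inv

lemma dvd_or_isUnit_padicInt (x : ℤ_[p]) : (p : ℤ_[p]) ∣ x ∨ IsUnit x := by
  by_cases h : IsUnit x
  · exact Or.inr h
  · left
    have := PadicInt.mem_nonunits.1 h
    rwa [PadicInt.norm_lt_one_iff_dvd] at this

lemma two_dvd_sub_one_of_isUnit {x : ℤ_[2]} (hx : IsUnit x) : 2 ∣ x - 1 := by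
  have h := PadicInt.zmodRepr_spec x
  have h2 : x.zmodRepr < 2 := h.1
  have h3 : x - (x.zmodRepr : ℤ_[2]) ∈ IsLocalRing.maximalIdeal ℤ_[2] := h.2
  rw [PadicInt.maximalIdeal_eq_span_p, Ideal.mem_span_singleton] at h3
  interval_cases h4 : x.zmodRepr
  · exfalso
    rw [Nat.cast_zero, sub_zero] at h3
    exact PadicInt.p_nonunit (isUnit_of_dvd_unit h3 hx)
  · simpa using h3

end Padic

/-- Integral Weierstrass curves satisfy Kraus's conditions. -/
lemma krausCondition_int (p : ℕ) (W : WeierstrassCurve ℤ) : KrausCondition p W.c₄ W.c₆ := by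
  have hrel := W.c_relation
  refine ⟨fun _ => ⟨⟨27 * W.Δ, by linarith⟩, ?_⟩, fun _ => ⟨⟨64 * W.Δ, by linarith⟩, ?_⟩⟩
  -- for odd `a₁` the first alternative at `2` holds, and otherwise the parity of `a₃` decides
  · obtain ⟨k, hk | hk⟩ := Int.even_or_odd' W.a₁
    · right
      obtain ⟨l, hl | hl⟩ := Int.even_or_odd' W.a₃
      · refine ⟨⟨(k ^ 2 + W.a₂) ^ 2 - 3 * (2 * k * l + W.a₄), ?_⟩, Or.inl
          ⟨-2 * (k ^ 2 + W.a₂) ^ 3 + 9 * (k ^ 2 + W.a₂) * (2 * k * l + W.a₄)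
            - 27 * (l ^ 2 + W.a₆), ?_⟩⟩
        · simp only [c₄, b₂, b₄, hk, hl]; ring
        · simp only [c₆, b₂, b₄, b₆, hk, hl]; ring
      · refine ⟨⟨(k ^ 2 + W.a₂) ^ 2 - 3 * (2 * k * l + k + W.a₄), ?_⟩, Or.inr
          ⟨-2 * (k ^ 2 + W.a₂) ^ 3 + 9 * (k ^ 2 + W.a₂) * (2 * k * l + k + W.a₄)
            - 27 * (l ^ 2 + l + W.a₆) - 7, ?_⟩⟩
        · simp only [c₄, b₂, b₄, hk, hl]; ring
        · simp only [c₆, b₂, b₄, b₆, hk, hl]; ring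
    · left
      obtain ⟨m, hm⟩ : ∃ m, W.b₂ = 1 + 4 * m := ⟨k ^ 2 + k + W.a₂, by simp only [b₂, hk]; ring⟩
      refine ⟨-(3 * m + 12 * m ^ 2 + 16 * m ^ 3) + 9 * W.b₂ * W.b₄ - 54 * W.b₆, ?_⟩
      simp only [c₆, hm]; ring
  · intro h
    have h3 : (3 : ℤ) ∣ W.b₂ ^ 3 := by
      obtain ⟨m, hm⟩ := h
      refine ⟨-3 * m + 12 * W.b₂ * W.b₄ - 72 * W.b₆, ?_⟩
      simp only [c₆] at hm; linarith
    obtain ⟨m, hm⟩ := Int.prime_three.dvd_of_dvd_pow h3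
    refine ⟨-m ^ 3 + 4 * m * W.b₄ - 8 * W.b₆, ?_⟩
    simp only [c₆, hm]; ring

section Padic

variable {p : ℕ} [hp : Fact p.Prime]

/-- The model `y² + xy = x³ + a₂x² + a₄x + a₆` with given invariants `x = c₄` and `y = c₆`, for a
unit `c₄`. -/
lemma exists_curve_of_unit {R : Type*} [CommRing R] {x y D i m : R} (hi : i * x = 1)
    (hD : 1728 * D = x ^ 3 - y ^ 2) (hm : 4 * m = -(y * i) - 1) :
    ∃ V : WeierstrassCurve R, V.c₄ = x ∧ V.c₆ = y := by
  refine ⟨⟨1, m, 0, -36 * D * i ^ 2, y * D * i ^ 3⟩, ?_, ?_⟩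
  · have h2 : 1 + 4 * m = -(y * i) := by rw [hm]; ring
    simp only [c₄, b₂, b₄, one_pow, h2]
    linear_combination i ^ 2 * hD + (1 + i * x) * x * hi
  · have h2 : 1 + 4 * m = -(y * i) := by rw [hm]; ring
    simp only [c₆, b₂, b₄, b₆, one_pow, h2]
    linear_combination i ^ 3 * y * hD + (1 + i * x + i ^ 2 * x ^ 2) * y * hi

/-- The model `y² + a₃y = x³ + a₄x + a₆` with given invariants `x = c₄` and `y = c₆`. -/
lemma exists_curve_short {R : Type*} [CommRing R] {x y e a b : R} (ha : 48 * a = -x)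
    (hb : 864 * b = -y - 216 * e ^ 2) :
    ∃ V : WeierstrassCurve R, V.c₄ = x ∧ V.c₆ = y := by
  refine ⟨⟨0, 0, e, a, b⟩, ?_, ?_⟩
  · simp only [c₄, b₂, b₄]; linear_combination -ha
  · simp only [c₆, b₂, b₄, b₆]; linear_combination -hb

/-- Kraus's conditions suffice for the existence of an integral equation: one with `a₁ = 1` and
`a₃ = 0` if `c₄` is a unit at `2` or `3`, and otherwise one with `a₁ = a₂ = 0`. -/
lemma exists_curve_of_krausCondition {x y : ℤ_[p]} (h : KrausCondition p x y) :
    ∃ V : WeierstrassCurve ℤ_[p], V.c₄ = x ∧ V.c₆ = y := by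
  by_cases h2 : p = 2
  · subst h2
    obtain ⟨⟨D, hD⟩, hy | ⟨⟨a, ha⟩, hy⟩⟩ := h.1 rfl
    · obtain ⟨j, hj⟩ := exists_mul_eq_one_padicInt (p := 2) (n := 27) (by norm_num)
      push_cast at hj
      obtain ⟨c, hc⟩ := hy
      -- for odd `y` also `x` is odd, and the relation between `x`, `y` and `D` gives `4 ∣ x - 1`
      have hx : IsUnit x := by
        rcases dvd_or_isUnit_padicInt x with ⟨w, hw⟩ | hx
        · exfalso
          push_cast at hw
          refine PadicInt.p_nonunit (p := 2) (isUnit_iff_dvd_one.2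
            ⟨4 * w ^ 3 - 32 * D - 8 * c ^ 2 + 4 * c, ?_⟩)
          push_cast
          have hy' : y = 4 * c - 1 := by rw [← hc]; ring
          rw [hw, hy'] at hD
          linear_combination -hD
        · exact hx
      obtain ⟨w, hw⟩ := two_dvd_sub_one_of_isUnit hx
      obtain ⟨i, hi⟩ := hx.exists_left_inv
      have hx1 : x - 1 = 4 * (16 * D + 4 * c ^ 2 - 2 * c - x * (w * (w + 1))) := by
        have hy' : y = 4 * c - 1 := by rw [← hc]; ring
        have hw' : x = 1 + 2 * w := by rw [← hw]; ring
        rw [hy'] at hD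
        rw [hw'] at hD ⊢
        linear_combination hD
      refine exists_curve_of_unit (i := i) (D := D * j)
        (m := -i * (c + (16 * D + 4 * c ^ 2 - 2 * c - x * (w * (w + 1))))) hi ?_ ?_
      · linear_combination -hD + 64 * D * hj
      · linear_combination i * hc + i * hx1 - hi
    · obtain ⟨j, hj⟩ := exists_mul_eq_one_padicInt (p := 2) (n := 27) (by norm_num)
      push_cast at hj
      rcases hy with ⟨c, hc⟩ | ⟨c, hc⟩
      · refine exists_curve_short (e := 0) (a := -(9 * a * j)) (b := -(c * j)) ?_ ?_
        · linear_combination ha - 16 * a * hj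
        · linear_combination hc - 32 * c * hj
      · refine exists_curve_short (e := 1) (a := -(9 * a * j)) (b := -((7 + c) * j)) ?_ ?_
        · linear_combination ha - 16 * a * hj
        · linear_combination hc - 32 * (7 + c) * hj
  by_cases h3 : p = 3
  · subst h3
    obtain ⟨⟨D, hD⟩, hy⟩ := h.2 rfl
    obtain ⟨j, hj⟩ := exists_mul_eq_one_padicInt (p := 3) (n := 2) (by norm_num)
    push_cast at hj
    rcases dvd_or_isUnit_padicInt x with ⟨w, hw⟩ | hx
    · push_cast at hw
      have hp3 : Prime (3 : ℤ_[3]) := by simpa using PadicInt.prime_p (p := 3)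
      -- for `3 ∣ x` the relation gives `9 ∣ y`, whence `27 ∣ y`
      have h1 : (3 : ℤ_[3]) ∣ y := by
        refine hp3.dvd_of_dvd_pow (n := 2) ⟨9 * w ^ 3 - 9 * D, ?_⟩
        rw [hw] at hD
        linear_combination -hD
      obtain ⟨y1, hy1⟩ := h1
      have h1 : (3 : ℤ_[3]) ∣ y1 := by
        refine hp3.dvd_of_dvd_pow (n := 2) ⟨w ^ 3 - D, ?_⟩
        rw [hw, hy1] at hD
        have h9 : (9 : ℤ_[3]) ≠ 0 := by norm_num
        apply mul_left_cancel₀ h9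
        linear_combination -hD
      obtain ⟨y2, hy2⟩ := h1
      obtain ⟨c, hc⟩ := hy ⟨y2, by rw [hy1, hy2]; ring⟩
      have h32 : j ^ 5 * 32 = 1 := by
        calc j ^ 5 * 32 = (j * 2) ^ 5 := by ring
          _ = 1 := by rw [hj, one_pow]
      have h16 : j ^ 4 * 16 = 1 := by
        calc j ^ 4 * 16 = (j * 2) ^ 4 := by ring
          _ = 1 := by rw [hj, one_pow]
      refine exists_curve_short (e := 0) (a := -(w * j ^ 4)) (b := -(c * j ^ 5)) ?_ ?_
      · linear_combination hw - 3 * w * h16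
      · linear_combination hc - 27 * c * h32
    · obtain ⟨i, hi⟩ := hx.exists_left_inv
      have h64 : j ^ 6 * 64 = 1 := by
        calc j ^ 6 * 64 = (j * 2) ^ 6 := by ring
          _ = 1 := by rw [hj, one_pow]
      have h4 : j ^ 2 * 4 = 1 := by
        calc j ^ 2 * 4 = (j * 2) ^ 2 := by ring
          _ = 1 := by rw [hj, one_pow]
      refine exists_curve_of_unit (i := i) (D := D * j ^ 6) (m := (-(y * i) - 1) * j ^ 2) hi ?_ ?_
      · linear_combination -hD + 27 * D * h64
      · linear_combination (-(y * i) - 1) * h4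
  · have h864 : ¬ p ∣ 864 := by
      intro hd
      have : p ∣ 2 ^ 5 * 3 ^ 3 := by simpa using hd
      rcases hp.out.dvd_mul.1 this with h | h
      · exact h2 ((Nat.prime_dvd_prime_iff_eq hp.out Nat.prime_two).1 (hp.out.dvd_of_dvd_pow h))
      · exact h3 ((Nat.prime_dvd_prime_iff_eq hp.out Nat.prime_three).1 (hp.out.dvd_of_dvd_pow h))
    obtain ⟨j, hj⟩ := exists_mul_eq_one_padicInt h864
    push_cast at hj
    refine exists_curve_short (e := 0) (a := -(18 * x * j)) (b := -(y * j)) ?_ ?_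
    · linear_combination -x * hj
    · linear_combination -y * hj

open IsDiscreteValuationRing IsDedekindDomain.HeightOneSpectrum in
/-- The invariants of a curve that is minimal at `p` cannot be divided by `p⁴` and `p⁶`. -/
lemma not_krausCondition_of_isMinimal {W : WeierstrassCurve ℤ} (hΔ : W.Δ ≠ 0)
    (hW : IsMinimal ℤ_[p] (W.baseChange ℚ_[p])) {x y : ℤ_[p]} (h₄ : (W.c₄ : ℤ_[p]) = p ^ 4 * x)
    (h₆ : (W.c₆ : ℤ_[p]) = p ^ 6 * y) : ¬ KrausCondition p x y := by
  intro h
  obtain ⟨V, hV₄, hV₆⟩ := exists_curve_of_krausCondition h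
  have hp0 : (p : ℚ_[p]) ≠ 0 := by exact_mod_cast hp.out.ne_zero
  obtain ⟨C, hC, hCW⟩ := exists_variableChange_of_c₄_c₆ (W := W.baseChange ℚ_[p])
    (V := V.baseChange ℚ_[p]) (Units.mk0 _ hp0) (by
      have := congrArg (algebraMap ℤ_[p] ℚ_[p]) h₄
      simp only [baseChange, map_c₄, hV₄]
      simpa using this) (by
      have := congrArg (algebraMap ℤ_[p] ℚ_[p]) h₆
      simp only [baseChange, map_c₆, hV₆]
      simpa using this)
  -- `C • W` is integral, with discriminant `p ^ (-12)` times that of `W`, against minimality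
  have hint : IsIntegral ℤ_[p] (C • W.baseChange ℚ_[p]) := ⟨V, hCW⟩
  have hmax := hW.val_Δ_maximal.2 hint
  have hint1 : IsIntegral ℤ_[p] ((1 : VariableChange ℚ_[p]) • W.baseChange ℚ_[p]) :=
    hW.val_Δ_maximal.1
  have hval : valuation ℚ_[p] (maximalIdeal ℤ_[p]) (W.baseChange ℚ_[p]).Δ =
      valuation ℚ_[p] (maximalIdeal ℤ_[p]) (p : ℚ_[p]) ^ 12 *
        valuation ℚ_[p] (maximalIdeal ℤ_[p]) (C • W.baseChange ℚ_[p]).Δ := by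
    rw [variableChange_Δ, hC, ← map_pow, ← map_mul]
    congr 1
    simp only [Units.val_inv_eq_inv_val, Units.val_mk0]
    field_simp
  have hlt : valuation ℚ_[p] (maximalIdeal ℤ_[p]) (p : ℚ_[p]) < 1 := by
    have := (valuation_lt_one_iff_mem (K := ℚ_[p]) (maximalIdeal ℤ_[p]) (p : ℤ_[p])).2 (by
      change (p : ℤ_[p]) ∈ IsLocalRing.maximalIdeal ℤ_[p]
      rw [PadicInt.maximalIdeal_eq_span_p]
      exact Ideal.mem_span_singleton_self _)
    simpa using this
  have hΔ' : (C • W.baseChange ℚ_[p]).Δ ≠ 0 := by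
    rw [variableChange_Δ]
    refine mul_ne_zero (pow_ne_zero _ (Units.ne_zero _)) ?_
    simp only [baseChange, map_Δ]
    simpa using hΔ
  have hle : valuation ℚ_[p] (maximalIdeal ℤ_[p]) (W.baseChange ℚ_[p]).Δ <
      valuation ℚ_[p] (maximalIdeal ℤ_[p]) (C • W.baseChange ℚ_[p]).Δ := by
    rw [hval]
    have hpos : 0 < valuation ℚ_[p] (maximalIdeal ℤ_[p]) (C • W.baseChange ℚ_[p]).Δ := by
      rwa [zero_lt_iff, Valuation.ne_zero_iff]
    calc _ < 1 * valuation ℚ_[p] (maximalIdeal ℤ_[p]) (C • W.baseChange ℚ_[p]).Δ :=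
          mul_lt_mul_of_pos_right (pow_lt_one₀ zero_le hlt (by norm_num)) hpos
      _ = _ := one_mul _
  rw [← one_smul (VariableChange ℚ_[p]) (W.baseChange ℚ_[p]), smul_smul, mul_one,
    ← valuation_Δ_aux_eq_of_isIntegral, ← valuation_Δ_aux_eq_of_isIntegral] at hle
  exact absurd (hmax (le_of_lt hle)) (not_le_of_gt hle)

end Padic

/-! ### Scaling the invariants at a prime -/

section Scaling

variable {p : ℕ}

/-- Kraus's conditions are stable under `(x, y) ↦ (t²x, t³y)` for a unit `t` that is `1` modulo `4`
if `p = 2`. -/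
lemma KrausCondition.unit_mul {R : Type*} [CommRing R] {x y t s : R} (hts : s * t = 1)
    (ht : p = 2 → 4 ∣ t - 1) (h : KrausCondition p x y) :
    KrausCondition p (t ^ 2 * x) (t ^ 3 * y) := by
  refine ⟨fun h2 => ?_, fun h3 => ?_⟩
  · obtain ⟨⟨D, hD⟩, hy⟩ := h.1 h2
    obtain ⟨c, hc⟩ := ht h2
    refine ⟨⟨t ^ 6 * D, by linear_combination t ^ 6 * hD⟩, ?_⟩
    rcases hy with ⟨a, ha⟩ | ⟨⟨a, ha⟩, ⟨b, hb⟩ | ⟨b, hb⟩⟩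
    · left
      exact ⟨t ^ 3 * a - c * (t ^ 2 + t + 1), by
          linear_combination t ^ 3 * ha - (t ^ 2 + t + 1) * hc⟩
    · right
      exact ⟨⟨t ^ 2 * a, by rw [ha]; ring⟩, Or.inl ⟨t ^ 3 * b, by rw [hb]; ring⟩⟩
    · right
      refine ⟨⟨t ^ 2 * a, by rw [ha]; ring⟩, Or.inr ⟨t ^ 3 * b + c * (t ^ 2 + t + 1), ?_⟩⟩
      linear_combination t ^ 3 * hb + 8 * (t ^ 2 + t + 1) * hc
  · obtain ⟨⟨D, hD⟩, hy⟩ := h.2 h3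
    refine ⟨⟨t ^ 6 * D, by linear_combination t ^ 6 * hD⟩, fun ⟨a, ha⟩ => ?_⟩
    obtain ⟨b, hb⟩ := hy ⟨s ^ 3 * a, by
      linear_combination s ^ 3 * ha - (s ^ 2 * t ^ 2 + s * t + 1) * y * hts⟩
    exact ⟨t ^ 3 * b, by rw [hb]; ring⟩

/-- Kraus's conditions are stable under `(x, y) ↦ (p⁴x, p⁶y)`. -/
lemma KrausCondition.prime_mul {R : Type*} [CommRing R] {x y : R} (h : KrausCondition p x y) :
    KrausCondition p ((p : R) ^ 4 * x) ((p : R) ^ 6 * y) := by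
  refine ⟨fun h2 => ?_, fun h3 => ?_⟩
  · obtain ⟨⟨D, hD⟩, -⟩ := h.1 h2
    subst h2
    push_cast
    refine ⟨⟨2 ^ 12 * D, by linear_combination 2 ^ 12 * hD⟩,
      Or.inr ⟨⟨x, by ring⟩, Or.inl ⟨2 * y, by ring⟩⟩⟩
  · obtain ⟨⟨D, hD⟩, -⟩ := h.2 h3
    subst h3
    push_cast
    exact ⟨⟨3 ^ 12 * D, by linear_combination 3 ^ 12 * hD⟩, fun _ => ⟨27 * y, by ring⟩⟩

lemma KrausCondition.prime_pow_mul {R : Type*} [CommRing R] {x y : R} (h : KrausCondition p x y)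
    (k : ℕ) : KrausCondition p ((p : R) ^ (4 * k) * x) ((p : R) ^ (6 * k) * y) := by
  induction k with
  | zero => simpa using h
  | succ k ih =>
    have := ih.prime_mul
    convert this using 1 <;> ring

variable [hp : Fact p.Prime]

lemma krausCondition_intCast_iff {x y : ℤ} :
    KrausCondition p (x : ℤ_[p]) (y : ℤ_[p]) ↔ KrausCondition p x y := by
  have key : ∀ (q n : ℕ) (z : ℤ), p = q →
      (((q ^ n : ℕ) : ℤ_[p]) ∣ (z : ℤ_[p]) ↔ (q ^ n : ℤ) ∣ z) := by
    intro q n z hq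
    subst hq
    rw [Nat.cast_pow, PadicInt.pow_p_dvd_int_iff]
  unfold KrausCondition
  refine and_congr (imp_congr_right fun h => ?_) (imp_congr_right fun h => ?_)
  · have h1 := key 2 6 (x ^ 3 - y ^ 2) h
    have h2 := key 2 2 (y + 1) h
    have h3 := key 2 4 x h
    have h4 := key 2 5 y h
    have h5 := key 2 5 (y - 8) h
    norm_num at h1 h2 h3 h4 h5
    rw [h1, h2, h3, h4, h5]
  · have h1 := key 3 3 (x ^ 3 - y ^ 2) h
    have h2 := key 3 2 y h
    have h3 := key 3 3 y h
    norm_num at h1 h2 h3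
    rw [h1, h2, h3]

/-- The pair `(p ^ (-2N) x, ε p ^ (-3N) y)`, where `N = n - l`, is integral and satisfies Kraus's
conditions at `p`. -/
def IsKrausLevel (p : ℕ) (ε x y : ℤ) (n l : ℕ) : Prop :=
  ∃ X Y : ℤ, KrausCondition p X Y ∧ (p : ℤ) ^ (2 * n) * X = p ^ (2 * l) * x ∧
    (p : ℤ) ^ (3 * n) * Y = p ^ (3 * l) * (ε * y)

lemma exists_int_of_padicInt {X : ℤ_[p]} {n : ℕ} {z : ℤ} (h : (p : ℤ_[p]) ^ n * X = z) :
    ∃ X₀ : ℤ, X = X₀ ∧ (p : ℤ) ^ n * X₀ = z := by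
  obtain ⟨X₀, hX₀⟩ := (PadicInt.pow_p_dvd_int_iff n z).1 ⟨X, h.symm⟩
  refine ⟨X₀, ?_, hX₀.symm⟩
  have hp0 : (p : ℤ_[p]) ^ n ≠ 0 := pow_ne_zero _ (by exact_mod_cast hp.out.ne_zero)
  apply mul_left_cancel₀ hp0
  rw [h, hX₀]
  push_cast
  rfl

/-- If the invariants of two curves that are minimal at `p` satisfy `c₄ = α²c₄'` and `c₆ = α³c₆'`
with `α = p ^ m v`, then `m` is the largest integer of its parity at which the invariants of the
first curve, with `c₆` multiplied by the sign `ε ≡ v`, satisfy Kraus's conditions. -/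
lemma isKrausLevel_iff {W W' : WeierstrassCurve ℤ} (hΔ' : W'.Δ ≠ 0)
    (hW' : IsMinimal ℤ_[p] (W'.baseChange ℚ_[p])) {m : ℤ} {v : ℤ_[p]ˣ} {ε : ℤ}
    (hε : ε * ε = 1) (hεv : p = 2 → (4 : ℤ_[p]) ∣ ε * v - 1)
    (h₄ : (W.c₄ : ℚ_[p]) = (p : ℚ_[p]) ^ (2 * m) * (v : ℤ_[p]) ^ 2 * W'.c₄)
    (h₆ : (W.c₆ : ℚ_[p]) = (p : ℚ_[p]) ^ (3 * m) * (v : ℤ_[p]) ^ 3 * W'.c₆)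
    {n l : ℕ} (hpar : Even (m - (n - l))) :
    IsKrausLevel p ε W.c₄ W.c₆ n l ↔ (n : ℤ) - l ≤ m := by
  have hp0 : (p : ℚ_[p]) ≠ 0 := by exact_mod_cast hp.out.ne_zero
  have hp1 : (p : ℤ_[p]) ≠ 0 := by exact_mod_cast hp.out.ne_zero
  have hεp : (ε : ℤ_[p]) * ε = 1 := by exact_mod_cast hε
  have hεq : (ε : ℚ_[p]) * ε = 1 := by exact_mod_cast hε
  have hvi : ((v⁻¹ : ℤ_[p]ˣ) : ℤ_[p]) * v = 1 := v.inv_mul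
  have hvq : (((v⁻¹ : ℤ_[p]ˣ) : ℤ_[p]) : ℚ_[p]) * ((v : ℤ_[p]) : ℚ_[p]) = 1 := by
    exact_mod_cast congrArg (fun z : ℤ_[p] => (z : ℚ_[p])) hvi
  constructor
  · rintro ⟨X, Y, hK, hX, hY⟩
    -- otherwise `n - l ≥ m + 2`, and `(p⁴, p⁶)` divides the invariants of `W'`
    by_contra hlt
    obtain ⟨k, hk⟩ : ∃ k : ℕ, (n : ℤ) - l = m + 2 + 2 * k := by
      obtain ⟨j, hj⟩ := hpar
      refine ⟨(-j - 1).toNat, ?_⟩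
      omega
    have hXq : (p : ℚ_[p]) ^ (2 * n) * X = p ^ (2 * l) * W.c₄ := by exact_mod_cast hX
    have hYq : (p : ℚ_[p]) ^ (3 * n) * Y = p ^ (3 * l) * (ε * W.c₆) := by exact_mod_cast hY
    refine not_krausCondition_of_isMinimal hΔ' hW' (x := p ^ (4 * k) * ((ε * ↑v⁻¹) ^ 2 * X))
      (y := p ^ (6 * k) * ((ε * ↑v⁻¹) ^ 3 * Y)) ?_ ?_ ?_
    · have h1 : (W'.c₄ : ℚ_[p]) =
          p ^ 4 * (p ^ (4 * k) * ((ε * (((v⁻¹ : ℤ_[p]ˣ) : ℤ_[p]) : ℚ_[p])) ^ 2 * X)) := by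
        have hl : (p : ℚ_[p]) ^ (2 * l) * p ^ (2 * m) ≠ 0 :=
          mul_ne_zero (pow_ne_zero _ hp0) (zpow_ne_zero _ hp0)
        apply mul_left_cancel₀ hl
        have e1 : (p : ℚ_[p]) ^ (2 * l) * p ^ (2 * m) * p ^ 4 * p ^ (4 * k) = p ^ (2 * n) := by
          simp only [← zpow_natCast, ← zpow_add₀ hp0]
          congr 1; push_cast; linarith
        calc (p : ℚ_[p]) ^ (2 * l) * p ^ (2 * m) * W'.c₄
            = (((v⁻¹ : ℤ_[p]ˣ) : ℤ_[p]) : ℚ_[p]) ^ 2 * (p ^ (2 * l) * W.c₄) := by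
              rw [h₄]
              linear_combination (-(p : ℚ_[p]) ^ (2 * l) * p ^ (2 * m) * W'.c₄ *
                ((((v⁻¹ : ℤ_[p]ˣ) : ℤ_[p]) : ℚ_[p]) * ((v : ℤ_[p]) : ℚ_[p]) + 1)) * hvq
          _ = _ := by
              rw [← hXq, ← e1]
              linear_combination (-(p : ℚ_[p]) ^ (2 * l) * p ^ (2 * m) * p ^ 4 * p ^ (4 * k) *
                (((v⁻¹ : ℤ_[p]ˣ) : ℤ_[p]) : ℚ_[p]) ^ 2 * X) * hεq
      refine PadicInt.ext ?_
      push_cast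
      exact h1
    · have h1 : (W'.c₆ : ℚ_[p]) =
          p ^ 6 * (p ^ (6 * k) * ((ε * (((v⁻¹ : ℤ_[p]ˣ) : ℤ_[p]) : ℚ_[p])) ^ 3 * Y)) := by
        have hl : (p : ℚ_[p]) ^ (3 * l) * p ^ (3 * m) ≠ 0 :=
          mul_ne_zero (pow_ne_zero _ hp0) (zpow_ne_zero _ hp0)
        apply mul_left_cancel₀ hl
        have e1 : (p : ℚ_[p]) ^ (3 * l) * p ^ (3 * m) * p ^ 6 * p ^ (6 * k) = p ^ (3 * n) := by
          simp only [← zpow_natCast, ← zpow_add₀ hp0]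
          congr 1; push_cast; linarith
        calc (p : ℚ_[p]) ^ (3 * l) * p ^ (3 * m) * W'.c₆
            = (((v⁻¹ : ℤ_[p]ˣ) : ℤ_[p]) : ℚ_[p]) ^ 3 * (p ^ (3 * l) * W.c₆) := by
              rw [h₆]
              linear_combination (-(p : ℚ_[p]) ^ (3 * l) * p ^ (3 * m) * W'.c₆ *
                (((((v⁻¹ : ℤ_[p]ˣ) : ℤ_[p]) : ℚ_[p]) * ((v : ℤ_[p]) : ℚ_[p])) ^ 2 +
                (((v⁻¹ : ℤ_[p]ˣ) : ℤ_[p]) : ℚ_[p]) * ((v : ℤ_[p]) : ℚ_[p]) + 1)) * hvq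
          _ = (((v⁻¹ : ℤ_[p]ˣ) : ℤ_[p]) : ℚ_[p]) ^ 3 * (ε * (p ^ (3 * l) * (ε * W.c₆))) := by
              linear_combination (-(((v⁻¹ : ℤ_[p]ˣ) : ℤ_[p]) : ℚ_[p]) ^ 3 * p ^ (3 * l) * W.c₆) *
                hεq
          _ = _ := by
              rw [← hYq, ← e1]
              linear_combination (-(p : ℚ_[p]) ^ (3 * l) * p ^ (3 * m) * p ^ 6 * p ^ (6 * k) *
                (((v⁻¹ : ℤ_[p]ˣ) : ℤ_[p]) : ℚ_[p]) ^ 3 * Y * ε) * hεq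
      refine PadicInt.ext ?_
      push_cast
      exact h1
    · refine KrausCondition.prime_pow_mul (KrausCondition.unit_mul (s := (ε : ℤ_[p]) * v) ?_ ?_
        (krausCondition_intCast_iff.2 hK)) k
      · linear_combination (v : ℤ_[p]) * ((v⁻¹ : ℤ_[p]ˣ) : ℤ_[p]) * hεp + hvi
      · intro h2
        obtain ⟨c, hc⟩ := hεv h2
        exact ⟨-(ε * ((v⁻¹ : ℤ_[p]ˣ) : ℤ_[p]) * c), by
          linear_combination (-(ε : ℤ_[p]) * ((v⁻¹ : ℤ_[p]ˣ) : ℤ_[p])) * hc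
            + (v : ℤ_[p]) * ((v⁻¹ : ℤ_[p]ˣ) : ℤ_[p]) * hεp + hvi⟩
  · intro hle
    -- the pair in question is the pair of invariants of `W'` scaled by `p ^ (2 * k)` and a unit
    obtain ⟨k, hk⟩ : ∃ k : ℕ, m = (n : ℤ) - l + 2 * k := by
      obtain ⟨j, hj⟩ := hpar
      exact ⟨j.toNat, by omega⟩
    have hK : KrausCondition p (p ^ (4 * k) * ((ε * v : ℤ_[p]) ^ 2 * (W'.c₄ : ℤ_[p])))
        (p ^ (6 * k) * ((ε * v : ℤ_[p]) ^ 3 * (W'.c₆ : ℤ_[p]))) := by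
      refine KrausCondition.prime_pow_mul (KrausCondition.unit_mul
        (s := ε * ((v⁻¹ : ℤ_[p]ˣ) : ℤ_[p])) ?_ hεv
        (krausCondition_intCast_iff.2 (krausCondition_int p W'))) k
      linear_combination (v : ℤ_[p]) * ((v⁻¹ : ℤ_[p]ˣ) : ℤ_[p]) * hεp + hvi
    have hX : (p : ℤ_[p]) ^ (2 * n) * (p ^ (4 * k) * ((ε * v : ℤ_[p]) ^ 2 * (W'.c₄ : ℤ_[p]))) =
        ((p ^ (2 * l) * W.c₄ : ℤ) : ℤ_[p]) := by
      have h1 : (p : ℚ_[p]) ^ (2 * n) *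
          (p ^ (4 * k) * ((ε * ((v : ℤ_[p]) : ℚ_[p])) ^ 2 * (W'.c₄ : ℚ_[p]))) =
          p ^ (2 * l) * W.c₄ := by
        have e1 : (p : ℚ_[p]) ^ (2 * n) * p ^ (4 * k) = p ^ (2 * l) * p ^ (2 * m) := by
          simp only [← zpow_natCast, ← zpow_add₀ hp0]
          congr 1; push_cast; linarith
        rw [h₄]
        linear_combination (ε * ((v : ℤ_[p]) : ℚ_[p])) ^ 2 * (W'.c₄ : ℚ_[p]) * e1 +
          (p : ℚ_[p]) ^ (2 * l) * p ^ (2 * m) * ((v : ℤ_[p]) : ℚ_[p]) ^ 2 * W'.c₄ * hεq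
      refine PadicInt.ext ?_
      push_cast
      exact h1
    have hY : (p : ℤ_[p]) ^ (3 * n) * (p ^ (6 * k) * ((ε * v : ℤ_[p]) ^ 3 * (W'.c₆ : ℤ_[p]))) =
        ((p ^ (3 * l) * (ε * W.c₆) : ℤ) : ℤ_[p]) := by
      have h1 : (p : ℚ_[p]) ^ (3 * n) *
          (p ^ (6 * k) * ((ε * ((v : ℤ_[p]) : ℚ_[p])) ^ 3 * (W'.c₆ : ℚ_[p]))) =
          p ^ (3 * l) * (ε * W.c₆) := by
        have e1 : (p : ℚ_[p]) ^ (3 * n) * p ^ (6 * k) = p ^ (3 * l) * p ^ (3 * m) := by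
          simp only [← zpow_natCast, ← zpow_add₀ hp0]
          congr 1; push_cast; linarith
        rw [h₆]
        linear_combination (ε * ((v : ℤ_[p]) : ℚ_[p])) ^ 3 * (W'.c₆ : ℚ_[p]) * e1 +
          (p : ℚ_[p]) ^ (3 * l) * p ^ (3 * m) * ((v : ℤ_[p]) : ℚ_[p]) ^ 3 * W'.c₆ * ε * hεq
      refine PadicInt.ext ?_
      push_cast
      exact h1
    obtain ⟨X₀, hX₀, hX₁⟩ := exists_int_of_padicInt hX
    obtain ⟨Y₀, hY₀, hY₁⟩ := exists_int_of_padicInt hY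
    rw [hX₀, hY₀] at hK
    exact ⟨X₀, Y₀, krausCondition_intCast_iff.1 hK, hX₁, hY₁⟩

end Scaling

/-! ### The exponents of the twist discrepancy -/

lemma le_intOrd_iff {p : ℕ} {n : ℤ} {k : ℕ} : (k : ℕ∞) ≤ intOrd p n ↔ (p : ℤ) ^ k ∣ n :=
  pow_dvd_iff_le_emultiplicity.symm

lemma intOrd_eq_iff {p : ℕ} {n : ℤ} {k : ℕ} :
    intOrd p n = k ↔ (p : ℤ) ^ k ∣ n ∧ ¬ (p : ℤ) ^ (k + 1) ∣ n :=
  emultiplicity_eq_coe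

lemma le_mul_enat_iff {a b c : ℕ} (h : b * c = a) (hb : 0 < b) (n : ℕ∞) :
    (a : ℕ∞) ≤ b * n ↔ (c : ℕ∞) ≤ n := by
  cases n with
  | top => simp [ENat.mul_top, hb.ne']
  | coe n =>
    norm_cast
    subst h
    exact Nat.mul_le_mul_left_iff hb

lemma twistLambda_lt_iff {W : WeierstrassCurve ℤ} {p : ℕ} :
    W.twistLambda p < 6 ↔
      ¬ ((p : ℤ) ^ 2 ∣ W.c₄ ∧ (p : ℤ) ^ 3 ∣ W.c₆ ∧ (p : ℤ) ^ 6 ∣ W.Δ) := by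
  rw [← not_le, twistLambda, le_min_iff, le_min_iff, ← le_intOrd_iff, ← le_intOrd_iff,
    ← le_intOrd_iff]
  have h1 := le_mul_enat_iff (a := 6) (b := 3) (c := 2) rfl (by norm_num) (intOrd p W.c₄)
  have h2 := le_mul_enat_iff (a := 6) (b := 2) (c := 3) rfl (by norm_num) (intOrd p W.c₆)
  push_cast at h1 h2 ⊢
  rw [h1, h2]

/-- No quotient of `(x, y)` by `(p⁴, p⁶)` satisfies Kraus's conditions. -/
def IsKrausMinimal (p : ℕ) (x y : ℤ) : Prop :=
  ∀ X Y : ℤ, x = p ^ 4 * X → y = p ^ 6 * Y → ¬ KrausCondition p X Y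

lemma isKrausMinimal {p : ℕ} [hp : Fact p.Prime] {W : WeierstrassCurve ℤ} (hΔ : W.Δ ≠ 0)
    (hW : IsMinimal ℤ_[p] (W.baseChange ℚ_[p])) : IsKrausMinimal p W.c₄ W.c₆ := by
  intro X Y hX hY h
  refine not_krausCondition_of_isMinimal hΔ hW (x := X) (y := Y) ?_ ?_
    (krausCondition_intCast_iff.2 h)
  · rw [hX]; push_cast; rfl
  · rw [hY]; push_cast; rfl

/-! ### Levels at an odd prime -/

section Levels

variable {p : ℕ} {x y : ℤ}

lemma isKrausLevel_zero (h : KrausCondition p x y) : IsKrausLevel p 1 x y 0 0 :=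
  ⟨x, y, h, by simp, by simp⟩

lemma not_isKrausLevel_two (h : IsKrausMinimal p x y) : ¬ IsKrausLevel p 1 x y 2 0 := by
  rintro ⟨X, Y, hK, hX, hY⟩
  exact h X Y (by linear_combination -hX) (by linear_combination -hY) hK

lemma isKrausLevel_neg_one_of_ne_two (hp2 : p ≠ 2) : IsKrausLevel p 1 x y 0 1 := by
  refine ⟨p ^ 2 * x, p ^ 3 * y, ⟨fun h => absurd h hp2, fun h => ?_⟩, by simp, by simp⟩
  subst h
  push_cast
  exact ⟨⟨27 * x ^ 3 - 27 * y ^ 2, by ring⟩, fun _ => ⟨y, by ring⟩⟩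

/-- At an odd prime, `(p², p³)` turns any pair into one satisfying Kraus's conditions, so that level
`3` is already excluded by minimality. -/
lemma not_isKrausLevel_three_of_ne_two (hp2 : p ≠ 2) (h : IsKrausMinimal p x y) :
    ¬ IsKrausLevel p 1 x y 3 0 := by
  rintro ⟨X, Y, hK, hX, hY⟩
  refine h (p ^ 2 * X) (p ^ 3 * Y) (by linear_combination -hX) (by linear_combination -hY)
    ⟨fun h => absurd h hp2, fun h => ?_⟩
  subst h
  push_cast
  exact ⟨⟨27 * X ^ 3 - 27 * Y ^ 2, by ring⟩, fun _ => ⟨Y, by ring⟩⟩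

/-- Level `1` is where the condition at `3` on `c₆` enters: it fails if `c₆` has order `5`. -/
lemma isKrausLevel_one_iff_of_ne_two {W : WeierstrassCurve ℤ} (hp : p.Prime) (hp2 : p ≠ 2) :
    IsKrausLevel p 1 W.c₄ W.c₆ 1 0 ↔ W.twistExponentOdd p = -1 := by
  have hp0 : (p : ℤ) ≠ 0 := by exact_mod_cast hp.ne_zero
  have hrel := W.c_relation
  have hexp : W.twistExponentOdd p = -1 ↔
      ((p : ℤ) ^ 2 ∣ W.c₄ ∧ (p : ℤ) ^ 3 ∣ W.c₆ ∧ (p : ℤ) ^ 6 ∣ W.Δ) ∧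
        ¬ (p = 3 ∧ (3 : ℤ) ^ 5 ∣ W.c₆ ∧ ¬ (3 : ℤ) ^ 6 ∣ W.c₆) := by
    have h5 := intOrd_eq_iff (p := 3) (n := W.c₆) (k := 5)
    push_cast at h5
    have h7 := twistLambda_lt_iff (W := W) (p := p)
    rw [twistExponentOdd]
    split_ifs with h
    · rw [h7, h5] at h
      norm_num
      tauto
    · rw [h7, h5] at h
      norm_num
      tauto
  rw [hexp]
  constructor
  · rintro ⟨X, Y, hK, hX, hY⟩
    simp only [mul_one, mul_zero, pow_zero, one_mul] at hX hY
    refine ⟨⟨⟨X, hX.symm⟩, ⟨Y, hY.symm⟩, ?_⟩, ?_⟩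
    · have h1 : 1728 * W.Δ = (p : ℤ) ^ 6 * (X ^ 3 - Y ^ 2) := by
        rw [hrel, ← hX, ← hY]; ring
      by_cases h3 : p = 3
      · obtain ⟨⟨D, hD⟩, -⟩ := hK.2 h3
        subst h3
        push_cast at h1 ⊢
        rw [hD] at h1
        omega
      · have hc : IsCoprime ((p : ℤ) ^ 6) 1728 := by
          have h2 : IsCoprime (p : ℤ) ((2 ^ 6 * 3 ^ 3 : ℕ) : ℤ) := by
            rw [Nat.isCoprime_iff_coprime]
            exact Nat.Coprime.mul_right
              (((Nat.coprime_primes hp Nat.prime_two).2 hp2).pow_right _)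
              (((Nat.coprime_primes hp Nat.prime_three).2 h3).pow_right _)
          norm_num at h2
          exact h2.pow_left
        exact hc.dvd_of_dvd_mul_left ⟨_, h1⟩
    · rintro ⟨h3, h5, h6⟩
      obtain ⟨-, h9⟩ := hK.2 h3
      subst h3
      push_cast at hY
      omega
  · rintro ⟨⟨⟨X, hX⟩, ⟨Y, hY⟩, ⟨D, hD⟩⟩, h3⟩
    refine ⟨X, Y, ⟨fun h => absurd h hp2, fun h => ?_⟩, by simp [hX], by simp [hY]⟩
    subst h
    push_cast at hX hY hD h3
    refine ⟨⟨64 * D, ?_⟩, fun h9 => ?_⟩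
    · rw [hX, hY, hD] at hrel
      linarith
    · by_contra h27
      exact h3 ⟨trivial, by omega, by omega⟩

end Levels

/-! ### Levels at two -/

section Two

variable {x y D d : ℤ}

lemma pow_three_sub_sq_dvd_neg {ε : ℤ} (hε : ε = 1 ∨ ε = -1) {X Y n : ℤ} (h : n ∣ X ^ 3 - Y ^ 2) :
    n ∣ X ^ 3 - (ε * Y) ^ 2 := by
  rcases hε with rfl | rfl <;> simpa using h

/-- An odd `y` subject to the discriminant relation forces `x` to be odd. -/
lemma not_two_dvd_of_sixtyFour_dvd (h : 64 ∣ x ^ 3 - y ^ 2) (hy : y % 2 = 1) : x % 2 = 1 := by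
  by_contra hx
  obtain ⟨a, ha⟩ : ∃ a, x = 2 * a := ⟨x / 2, by omega⟩
  obtain ⟨b, hb⟩ : ∃ b, y = 2 * b + 1 := ⟨y / 2, by omega⟩
  have e : x ^ 3 - y ^ 2 = 2 * (4 * a ^ 3 - 2 * b ^ 2 - 2 * b) - 1 := by rw [ha, hb]; ring
  rw [e] at h
  omega

/-- The three shapes of the invariants of an integral model at `2`. -/
lemma krausCondition_two_cases (h : KrausCondition 2 x y) :
    (x % 2 = 1 ∧ y % 4 = 3) ∨ (16 ∣ x ∧ 32 ∣ y) ∨ (16 ∣ x ∧ y % 32 = 8) := by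
  obtain ⟨hD, hy⟩ := h.1 rfl
  rcases hy with h1 | ⟨h1, h2 | h2⟩
  · exact Or.inl ⟨not_two_dvd_of_sixtyFour_dvd hD (by omega), by omega⟩
  · exact Or.inr (Or.inl ⟨h1, h2⟩)
  · exact Or.inr (Or.inr ⟨h1, by omega⟩)

lemma krausCondition_two_of (h : 64 ∣ x ^ 3 - y ^ 2)
    (h' : y % 4 = 3 ∨ (16 ∣ x ∧ (32 ∣ y ∨ y % 32 = 8))) : KrausCondition 2 x y := by
  refine ⟨fun _ => ⟨h, ?_⟩, fun h => by norm_num at h⟩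
  rcases h' with h1 | ⟨h1, h2 | h2⟩
  · exact Or.inl (by omega)
  · exact Or.inr ⟨h1, Or.inl h2⟩
  · exact Or.inr ⟨h1, Or.inr (by omega)⟩

lemma isKrausLevel_two_neg_two : IsKrausLevel 2 (-1) x y 0 2 := by
  refine ⟨16 * x, -64 * y, krausCondition_two_of ⟨64 * x ^ 3 - 64 * y ^ 2, by ring⟩
    (Or.inr ⟨⟨x, rfl⟩, Or.inl ⟨-2 * y, by ring⟩⟩), by push_cast; ring, by push_cast; ring⟩

lemma not_isKrausLevel_two_four (h : IsKrausMinimal 2 x y) : ¬ IsKrausLevel 2 (-1) x y 4 0 := by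
  rintro ⟨X, Y, hK, hX, hY⟩
  push_cast at hX hY
  refine h (16 * X) (-64 * Y) (by push_cast; linarith) (by push_cast; linarith)
    (krausCondition_two_of ⟨64 * X ^ 3 - 64 * Y ^ 2, by ring⟩
      (Or.inr ⟨⟨X, rfl⟩, Or.inl ⟨-2 * Y, by ring⟩⟩))

/-- For `d` odd and `-1` modulo `4`: the sign change of `c₆` destroys Kraus's conditions for odd `y`
and for `y ≡ 8` modulo `32`; in the latter case the discriminant is odd. -/
lemma isKrausLevel_two_zero_iff (hrel : 1728 * D = x ^ 3 - y ^ 2) (hK : KrausCondition 2 x y) :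
    IsKrausLevel 2 (-1) x y 0 0 ↔
      ¬ ((x % 2 = 1 ∧ y % 2 = 1) ∨ ((8 ∣ y ∧ ¬ 16 ∣ y) ∧ D % 2 = 1)) := by
  constructor
  · rintro ⟨X, Y, hK', hX, hY⟩ h
    simp only [mul_zero, pow_zero, one_mul] at hX hY
    subst hX hY
    rcases krausCondition_two_cases hK with h1 | h1 | h1 <;>
      rcases krausCondition_two_cases hK' with h2 | h2 | h2 <;> omega
  · intro h
    refine ⟨x, -y, ?_, by simp, by simp⟩
    rcases krausCondition_two_cases hK with h1 | h1 | ⟨⟨a, ha⟩, h1⟩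
    · omega
    · exact krausCondition_two_of ⟨27 * D, by linarith⟩ (Or.inr ⟨h1.1, Or.inl (by omega)⟩)
    · exfalso
      obtain ⟨c, hc⟩ : ∃ c, y = 8 + 32 * c := ⟨y / 32, by omega⟩
      have e : 27 * D = 64 * a ^ 3 - 8 * c - 16 * c ^ 2 - 1 := by
        rw [ha, hc] at hrel; linarith
      omega

/-- Level `2` is reached if the divided pair has odd entries, or second entry `8` modulo `32`; the
remaining shape would contradict minimality. -/
lemma isKrausLevel_two_two_iff (hrel : 1728 * D = x ^ 3 - y ^ 2) (hmin : IsKrausMinimal 2 x y)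
    (hd : d % 4 = 3) :
    IsKrausLevel 2 (-1) x y 2 0 ↔
      ((16 ∣ x ∧ ¬ 32 ∣ x) ∧ (64 ∣ y ∧ ¬ 128 ∣ y) ∧ 4096 ∣ D ∧ (y * d / 64) % 4 = 3) ∨
      (256 ∣ x ∧ (512 ∣ y ∧ ¬ 1024 ∣ y) ∧ (4096 ∣ D ∧ ¬ 8192 ∣ D) ∧ (y * d / 512) % 4 = 1) := by
  obtain ⟨e, he⟩ : ∃ e, d = 4 * e + 3 := ⟨d / 4, by omega⟩
  constructor
  · rintro ⟨X, Y, hK, hX, hY⟩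
    norm_num at hX hY
    obtain ⟨⟨D₁, hD₁⟩, -⟩ := hK.1 rfl
    have hD : 27 * D = 4096 * D₁ := by
      have hy : y = -64 * Y := by linarith
      rw [← hX, hy] at hrel
      linarith
    have hyd : y * d = 64 * (-(4 * (Y * e)) - 3 * Y) := by
      have hy : y = -64 * Y := by linarith
      rw [hy, he]; ring
    rw [hyd]
    rcases krausCondition_two_cases hK with h1 | h1 | ⟨⟨a, ha⟩, h1⟩
    · left
      generalize Y * e = w
      omega
    · exfalso
      exact hmin X (-Y) (by push_cast; linarith) (by push_cast; linarith)
        (krausCondition_two_of ⟨D₁, by rw [← hD₁]; ring⟩ (Or.inr ⟨h1.1, Or.inl (by omega)⟩))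
    · right
      obtain ⟨c, hc⟩ : ∃ c, Y = 8 + 32 * c := ⟨Y / 32, by omega⟩
      have e2 : D₁ = 64 * a ^ 3 - 8 * c - 16 * c ^ 2 - 1 := by
        rw [ha, hc] at hD₁; linarith
      have e3 : Y * e = 8 * (e + 4 * (c * e)) := by rw [hc]; ring
      rw [e3]
      generalize c * e = w
      omega
  · rintro (⟨⟨⟨X, hX⟩, h1⟩, ⟨⟨Z, hZ⟩, h2⟩, ⟨E, hE⟩, h3⟩ |
      ⟨⟨a, hX⟩, ⟨⟨Z, hZ⟩, h2⟩, ⟨⟨E, hE⟩, -⟩, h3⟩)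
    · have hyd : y * d = 64 * (4 * (Z * e) + 3 * Z) := by rw [hZ, he]; ring
      rw [hyd] at h3
      refine ⟨X, -Z, krausCondition_two_of ⟨27 * E, ?_⟩ (Or.inl ?_), ?_, ?_⟩
      · rw [hX, hZ, hE] at hrel
        linarith
      · generalize Z * e = w at h3
        omega
      · push_cast; linarith
      · push_cast; linarith
    · have hyd : y * d = 512 * (4 * (Z * e) + 3 * Z) := by rw [hZ, he]; ring
      rw [hyd] at h3
      refine ⟨16 * a, -8 * Z, krausCondition_two_of ⟨64 * a ^ 3 - Z ^ 2, by ring⟩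
        (Or.inr ⟨⟨a, rfl⟩, Or.inr ?_⟩), ?_, ?_⟩
      · generalize Z * e = w at h3
        omega
      · push_cast; linarith
      · push_cast; linarith

variable {ε d' : ℤ}

lemma isKrausLevel_two_neg_three : IsKrausLevel 2 ε x y 0 3 := by
  refine ⟨64 * x, 512 * (ε * y), krausCondition_two_of
    ⟨4096 * x ^ 3 - 4096 * (ε * y) ^ 2, by ring⟩
    (Or.inr ⟨⟨4 * x, by ring⟩, Or.inl ⟨16 * (ε * y), by ring⟩⟩), by push_cast; ring,
    by push_cast; ring⟩

lemma not_isKrausLevel_two_five (hε : ε = 1 ∨ ε = -1) (h : IsKrausMinimal 2 x y) :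
    ¬ IsKrausLevel 2 ε x y 5 0 := by
  rintro ⟨X, Y, hK, hX, hY⟩
  norm_num at hX hY
  refine h (64 * X) (512 * (ε * Y)) (by push_cast; linarith) ?_
    (krausCondition_two_of ⟨4096 * X ^ 3 - 4096 * (ε * Y) ^ 2, by ring⟩
      (Or.inr ⟨⟨4 * X, by ring⟩, Or.inl ⟨16 * (ε * Y), by ring⟩⟩))
  rcases hε with rfl | rfl <;> push_cast <;> linarith

lemma isKrausLevel_two_neg_one_iff (hε : ε = 1 ∨ ε = -1) (hK : KrausCondition 2 x y) :
    IsKrausLevel 2 ε x y 0 1 ↔ ¬ (x % 2 = 1 ∧ y % 2 = 1) := by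
  constructor
  · rintro ⟨X, Y, hK', hX, hY⟩ h
    norm_num at hX hY
    rcases hε with rfl | rfl <;> rcases krausCondition_two_cases hK' with h2 | h2 | h2 <;> omega
  · intro h
    refine ⟨4 * x, 8 * (ε * y), krausCondition_two_of ?_ (Or.inr ?_), by push_cast; ring,
      by push_cast; ring⟩
    · exact ⟨x ^ 3 - (ε * y) ^ 2, by ring⟩
    · rcases hε with rfl | rfl <;> rcases krausCondition_two_cases hK with h2 | h2 | h2 <;> omega

/-- Level `3` is reached only if the divided pair has odd entries; the other shapes would contradict
minimality. -/
lemma isKrausLevel_two_three_iff (hrel : 1728 * D = x ^ 3 - y ^ 2) (hmin : IsKrausMinimal 2 x y)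
    (hε : ε = 1 ∨ ε = -1) (hd : 4 ∣ d' - ε) :
    IsKrausLevel 2 ε x y 3 0 ↔
      (64 ∣ x ∧ ¬ 128 ∣ x) ∧ (512 ∣ y ∧ ¬ 1024 ∣ y) ∧ 262144 ∣ D ∧
        (y * (2 * d') / 1024) % 4 = 3 := by
  obtain ⟨e, he⟩ := hd
  obtain rfl : d' = 4 * e + ε := by linarith
  constructor
  · rintro ⟨X, Y, hK, hX, hY⟩
    norm_num at hX hY
    obtain ⟨⟨D₁, hD₁⟩, -⟩ := hK.1 rfl
    have hy : y = 512 * (ε * Y) := by rcases hε with rfl | rfl <;> linarith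
    have hD : 27 * D = 262144 * D₁ := by
      have : y ^ 2 = 262144 * Y ^ 2 := by rw [hy]; rcases hε with rfl | rfl <;> ring
      rw [← hX, this] at hrel
      linarith
    have hyd : y * (2 * (4 * e + ε)) = 1024 * (4 * (ε * (Y * e)) + Y) := by
      rw [hy]; rcases hε with rfl | rfl <;> ring
    rw [hyd]
    generalize Y * e = w
    rcases krausCondition_two_cases hK with h1 | h1 | h1
    · rcases hε with rfl | rfl <;> omega
    all_goals
      exfalso
      refine hmin (4 * X) (8 * (ε * Y)) (by push_cast; linarith) (by push_cast; linarith)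
        (krausCondition_two_of ⟨X ^ 3 - (ε * Y) ^ 2, by ring⟩ (Or.inr ⟨by omega, Or.inl ?_⟩))
      rcases hε with rfl | rfl <;> omega
  · rintro ⟨⟨⟨X, hX⟩, h1⟩, ⟨⟨Z, hZ⟩, h2⟩, ⟨E, hE⟩, h3⟩
    have hyd : y * (2 * (4 * e + ε)) = 1024 * (4 * (Z * e) + ε * Z) := by rw [hZ]; ring
    rw [hyd] at h3
    generalize Z * e = w at h3
    refine ⟨X, ε * Z, krausCondition_two_of (pow_three_sub_sq_dvd_neg hε ⟨27 * E, ?_⟩)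
      (Or.inl ?_), ?_, ?_⟩
    · rw [hX, hZ, hE] at hrel
      linarith
    · rcases hε with rfl | rfl <;> omega
    · push_cast; linarith
    · push_cast; rw [hZ]; ring

/-- Level `1` is reached if the pair `(x / 4, ε y / 8)` has one of the two even shapes. -/
lemma isKrausLevel_two_one_iff (hrel : 1728 * D = x ^ 3 - y ^ 2) (hK : KrausCondition 2 x y)
    (hodd : ¬ (x % 2 = 1 ∧ y % 2 = 1)) (hε : ε = 1 ∨ ε = -1) (hd : 4 ∣ d' - ε) :
    IsKrausLevel 2 ε x y 1 0 ↔
      ¬ (((16 ∣ x ∧ ¬ 32 ∣ x) ∨ (32 ∣ x ∧ ¬ 64 ∣ x)) ∨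
        ((8 ∣ y ∧ ¬ 16 ∣ y) ∨ (32 ∣ y ∧ ¬ 64 ∣ y) ∨ (128 ∣ y ∧ ¬ 256 ∣ y)) ∨
        (64 ∣ x ∧ (64 ∣ y ∧ ¬ 128 ∣ y) ∧ (64 ∣ D ∧ ¬ 128 ∣ D) ∧
          (y * (2 * d') / 128) % 4 = 3)) := by
  obtain ⟨e, he⟩ := hd
  obtain rfl : d' = 4 * e + ε := by linarith
  have h16 : 16 ∣ x ∧ (32 ∣ y ∨ y % 32 = 8) := by
    rcases krausCondition_two_cases hK with h1 | h1 | h1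
    · omega
    · exact ⟨h1.1, Or.inl h1.2⟩
    · exact ⟨h1.1, Or.inr h1.2⟩
  obtain ⟨⟨a, ha⟩, hy⟩ := h16
  constructor
  · rintro ⟨X, Y, hK', hX, hY⟩
    norm_num at hX hY
    have hXa : X = 4 * a := by linarith
    have hy' : y = 8 * (ε * Y) := by rcases hε with rfl | rfl <;> linarith
    rcases krausCondition_two_cases hK' with h1 | h1 | h1
    · omega
    · rcases hε with rfl | rfl <;> omega
    · have hyd : y * (2 * (4 * e + ε)) = 16 * (4 * (ε * (Y * e)) + Y) := by
        rw [hy']; rcases hε with rfl | rfl <;> ring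
      rw [hyd]
      obtain ⟨c, hc⟩ : ∃ c, Y = 8 + 32 * c := ⟨Y / 32, by omega⟩
      have e3 : Y * e = 8 * (e + 4 * (c * e)) := by rw [hc]; ring
      rw [e3]
      generalize c * e = w
      rcases hε with rfl | rfl <;> omega
  · intro h
    obtain ⟨b, hb⟩ : ∃ b, x = 64 * b := ⟨x / 64, by omega⟩
    obtain ⟨z, hz⟩ : ∃ z, y = 64 * z := ⟨y / 64, by omega⟩
    refine ⟨16 * b, 8 * (ε * z), krausCondition_two_of ⟨64 * b ^ 3 - (ε * z) ^ 2, by ring⟩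
      (Or.inr ⟨⟨b, rfl⟩, ?_⟩), by push_cast; linarith, by push_cast; rw [hz]; ring⟩
    have hyd : y * (2 * (4 * e + ε)) = 128 * (4 * (z * e) + ε * z) := by rw [hz]; ring
    rw [hyd] at h
    obtain ⟨q, hq⟩ : ∃ q, q = z ^ 2 := ⟨_, rfl⟩
    have hD : 27 * D = 64 * (64 * b ^ 3 - z ^ 2) := by
      rw [hb, hz] at hrel
      linarith
    by_cases hz2 : z % 2 = 0
    · left
      rcases hε with rfl | rfl <;> omega
    · right
      obtain ⟨k, hk⟩ : ∃ k, z = 2 * k + 1 := ⟨z / 2, by omega⟩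
      have hzz : z ^ 2 = 2 * (2 * k ^ 2 + 2 * k) + 1 := by rw [hk]; ring
      rw [hzz] at hD
      generalize z * e = w at h
      generalize 2 * k ^ 2 + 2 * k = k2 at hD
      generalize b ^ 3 = b3 at hD
      have h64 : 64 ∣ D ∧ ¬ 128 ∣ D := by omega
      rcases hε with rfl | rfl <;> omega

end Two

/-! ### The discrepancy between the twist and its minimal model -/

section Local

variable {p : ℕ} [hp : Fact p.Prime]

lemma exists_unit_of_rat {u : ℚ} (hu : u ≠ 0) :
    ∃ w : ℤ_[p]ˣ, (u : ℚ_[p]) = (p : ℚ_[p]) ^ padicValRat p u * (w : ℤ_[p]) := by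
  have hp0 : (p : ℚ_[p]) ≠ 0 := by exact_mod_cast hp.out.ne_zero
  have hu' : (u : ℚ_[p]) ≠ 0 := by exact_mod_cast hu
  have hn : ‖(p : ℚ_[p]) ^ (-padicValRat p u) * u‖ = 1 := by
    have hpr : (p : ℝ) ≠ 0 := by exact_mod_cast hp.out.ne_zero
    rw [norm_mul, norm_zpow, Padic.norm_p, Padic.norm_eq_zpow_neg_valuation hu',
      Padic.valuation_ratCast, inv_zpow', neg_neg, ← zpow_add₀ hpr, add_neg_cancel, zpow_zero]
  refine ⟨PadicInt.mkUnits hn, ?_⟩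
  rw [PadicInt.mkUnits_eq, ← mul_assoc, ← zpow_add₀ hp0, add_neg_cancel, zpow_zero, one_mul]

/-- The `p`-adic shape of `u² / d` for `d = p ^ k d'` with `d'` prime to `p`. -/
lemma exists_unit_sq_div {u : ℚ} (hu : u ≠ 0) {d d' : ℤ} {k : ℕ} (hd : d = p ^ k * d')
    (hd' : ¬ (p : ℤ) ∣ d') :
    ∃ v w : ℤ_[p]ˣ, ((u ^ 2 / d : ℚ) : ℚ_[p]) =
        (p : ℚ_[p]) ^ padicValRat p (u ^ 2 / d) * (v : ℤ_[p]) ∧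
      (v : ℤ_[p]) * d' = (w : ℤ_[p]) ^ 2 ∧ Even (padicValRat p (u ^ 2 / d) + k) := by
  have hp0 : (p : ℚ_[p]) ≠ 0 := by exact_mod_cast hp.out.ne_zero
  have hpq : (p : ℚ) ≠ 0 := by exact_mod_cast hp.out.ne_zero
  have hd0 : d' ≠ 0 := by rintro rfl; exact hd' (dvd_zero _)
  have hdq : (d' : ℚ) ≠ 0 := by exact_mod_cast hd0
  have hval : padicValRat p (u ^ 2 / d) = 2 * padicValRat p u - k := by
    have h1 : padicValRat p (d : ℚ) = k := by
      rw [hd]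
      push_cast
      rw [padicValRat.mul (pow_ne_zero _ hpq) hdq, padicValRat.pow, padicValRat.self hp.out.one_lt,
        padicValRat.of_int, padicValInt.eq_zero_of_not_dvd hd']
      simp
    have h2 : (d : ℚ) ≠ 0 := by
      rw [hd]; push_cast; exact mul_ne_zero (pow_ne_zero _ hpq) hdq
    rw [padicValRat.div (pow_ne_zero _ hu) h2, h1, padicValRat.pow]
    push_cast; ring
  obtain ⟨w, hw⟩ := exists_unit_of_rat (p := p) hu
  have hdu : IsUnit (d' : ℤ_[p]) := by
    by_contra h
    exact hd' ((PadicInt.norm_int_lt_one_iff_dvd d').1 (PadicInt.mem_nonunits.1 h))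
  obtain ⟨δ, hδ⟩ := hdu
  have hδi : ((δ⁻¹ : ℤ_[p]ˣ) : ℤ_[p]) * d' = 1 := by rw [← hδ]; exact δ.inv_mul
  have hδq : (((δ⁻¹ : ℤ_[p]ˣ) : ℤ_[p]) : ℚ_[p]) * d' = 1 := by
    have := congrArg (fun z : ℤ_[p] => (z : ℚ_[p])) hδi
    push_cast at this
    exact this
  refine ⟨w ^ 2 * δ⁻¹, w, ?_, ?_, ?_⟩
  · have hdp : (d' : ℚ_[p]) ≠ 0 := by exact_mod_cast hd0
    have hpk : (p : ℚ_[p]) ^ k ≠ 0 := pow_ne_zero _ hp0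
    have hsplit : (p : ℚ_[p]) ^ (2 * padicValRat p u - (k : ℤ)) * p ^ k =
        (p ^ padicValRat p u) ^ 2 := by
      rw [← zpow_natCast, ← zpow_add₀ hp0, ← zpow_natCast, ← zpow_mul]
      congr 1; push_cast; ring
    rw [hval, hd]
    push_cast
    rw [hw, div_eq_iff (mul_ne_zero hpk hdp)]
    linear_combination (-((w : ℤ_[p]) : ℚ_[p]) ^ 2 *
      ((((δ⁻¹ : ℤ_[p]ˣ) : ℤ_[p]) : ℚ_[p]) * d')) * hsplit -
      (p ^ padicValRat p u * ((w : ℤ_[p]) : ℚ_[p])) ^ 2 * hδq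
  · push_cast
    linear_combination (w : ℤ_[p]) ^ 2 * hδi
  · rw [hval]
    exact ⟨padicValRat p u, by ring⟩

/-- The exponent of `p` in the twist discrepancy, with value `0` at the primes not dividing `2d`. -/
noncomputable def twistExponent (W : WeierstrassCurve ℤ) (d : ℤ) (p : ℕ) : ℤ :=
  if (p : ℤ) ∣ 2 * d then (if p = 2 then W.twistExponentTwo d else W.twistExponentOdd p) else 0

end Local

open Classical in
/-- For `d = 3` modulo `4`, the exponent at `2` in terms of divisibility. -/
lemma twistExponentTwo_of_three_mod_four (W : WeierstrassCurve ℤ) {d : ℤ} (hd : d % 4 = 3) :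
    W.twistExponentTwo d =
      if (W.c₄ % 2 = 1 ∧ W.c₆ % 2 = 1) ∨ ((8 ∣ W.c₆ ∧ ¬ 16 ∣ W.c₆) ∧ W.Δ % 2 = 1) then 2
      else if ((16 ∣ W.c₄ ∧ ¬ 32 ∣ W.c₄) ∧ (64 ∣ W.c₆ ∧ ¬ 128 ∣ W.c₆) ∧ 4096 ∣ W.Δ ∧
          (W.c₆ * d / 64) % 4 = 3) ∨
        (256 ∣ W.c₄ ∧ (512 ∣ W.c₆ ∧ ¬ 1024 ∣ W.c₆) ∧ (4096 ∣ W.Δ ∧ ¬ 8192 ∣ W.Δ) ∧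
          (W.c₆ * d / 512) % 4 = 1) then -2
      else 0 := by
  have e4 := fun k => intOrd_eq_iff (p := 2) (n := W.c₄) (k := k)
  have e6 := fun k => intOrd_eq_iff (p := 2) (n := W.c₆) (k := k)
  have eD := fun k => intOrd_eq_iff (p := 2) (n := W.Δ) (k := k)
  have l4 := le_intOrd_iff (p := 2) (n := W.c₄) (k := 8)
  have lD := le_intOrd_iff (p := 2) (n := W.Δ) (k := 12)
  have a40 := e4 0
  have a44 := e4 4
  have a60 := e6 0
  have a63 := e6 3
  have a66 := e6 6
  have a69 := e6 9
  have aD0 := eD 0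
  have aD12 := eD 12
  norm_num at a40 a44 a60 a63 a66 a69 aD0 aD12 l4 lD
  have h1 : ¬ (d ≡ 1 [ZMOD 4]) := by unfold Int.ModEq; omega
  have h3 : d ≡ 3 [ZMOD 4] := by unfold Int.ModEq; omega
  have m1 : ∀ z : ℤ, z ≡ -1 [ZMOD 4] ↔ z % 4 = 3 := by intro z; unfold Int.ModEq; omega
  have m2 : ∀ z : ℤ, z ≡ 1 [ZMOD 4] ↔ z % 4 = 1 := by intro z; unfold Int.ModEq; omega
  have p6 : (2 : ℤ) ^ 6 = 64 := by norm_num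
  have p9 : (2 : ℤ) ^ 9 = 512 := by norm_num
  unfold twistExponentTwo
  dsimp only
  rw [if_neg h1, if_pos h3, p6, p9]
  exact if_congr (by rw [a40, a60, a63, aD0]) rfl
    (if_congr (by rw [a44, a66, lD, m1, l4, a69, aD12, m2]) rfl rfl)

open Classical in
/-- For even `d`, the exponent at `2` in terms of divisibility. -/
lemma twistExponentTwo_of_even (W : WeierstrassCurve ℤ) {d : ℤ} (hd : d % 2 = 0) :
    W.twistExponentTwo d =
      if W.c₄ % 2 = 1 ∧ W.c₆ % 2 = 1 then 3
      else if (64 ∣ W.c₄ ∧ ¬ 128 ∣ W.c₄) ∧ (512 ∣ W.c₆ ∧ ¬ 1024 ∣ W.c₆) ∧ 262144 ∣ W.Δ ∧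
        (W.c₆ * d / 1024) % 4 = 3 then -3
      else if ((16 ∣ W.c₄ ∧ ¬ 32 ∣ W.c₄) ∨ (32 ∣ W.c₄ ∧ ¬ 64 ∣ W.c₄)) ∨
        ((8 ∣ W.c₆ ∧ ¬ 16 ∣ W.c₆) ∨ (32 ∣ W.c₆ ∧ ¬ 64 ∣ W.c₆) ∨ (128 ∣ W.c₆ ∧ ¬ 256 ∣ W.c₆)) ∨
        (64 ∣ W.c₄ ∧ (64 ∣ W.c₆ ∧ ¬ 128 ∣ W.c₆) ∧ (64 ∣ W.Δ ∧ ¬ 128 ∣ W.Δ) ∧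
          (W.c₆ * d / 128) % 4 = 3) then 1
      else -1 := by
  have e4 := fun k => intOrd_eq_iff (p := 2) (n := W.c₄) (k := k)
  have e6 := fun k => intOrd_eq_iff (p := 2) (n := W.c₆) (k := k)
  have eD := fun k => intOrd_eq_iff (p := 2) (n := W.Δ) (k := k)
  have l4 := le_intOrd_iff (p := 2) (n := W.c₄) (k := 6)
  have lD := le_intOrd_iff (p := 2) (n := W.Δ) (k := 18)
  have a40 := e4 0
  have a44 := e4 4
  have a45 := e4 5
  have a46 := e4 6
  have a60 := e6 0
  have a63 := e6 3
  have a65 := e6 5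
  have a66 := e6 6
  have a67 := e6 7
  have a69 := e6 9
  have aD6 := eD 6
  norm_num at a40 a44 a45 a46 a60 a63 a65 a66 a67 a69 aD6 l4 lD
  have h1 : ¬ (d ≡ 1 [ZMOD 4]) := by unfold Int.ModEq; omega
  have h3 : ¬ (d ≡ 3 [ZMOD 4]) := by unfold Int.ModEq; omega
  have m1 : ∀ z : ℤ, z ≡ -1 [ZMOD 4] ↔ z % 4 = 3 := by intro z; unfold Int.ModEq; omega
  have p10 : (2 : ℤ) ^ 10 = 1024 := by norm_num
  have p7 : (2 : ℤ) ^ 7 = 128 := by norm_num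
  unfold twistExponentTwo
  dsimp only
  rw [if_neg h1, if_neg h3, p10, p7]
  exact if_congr (by rw [a40, a60]) rfl (if_congr (by rw [a46, a69, lD, m1]) rfl
    (if_congr (by rw [a44, a45, a63, a65, a67, l4, a66, aD6, m1]) rfl rfl))

section Local

variable {W W' : WeierstrassCurve ℤ} {d : ℤ} {u : ℚ}

/-- The order of the scaling factor `u² / d` between the invariants of `W` and of the minimal model
`W'` of its twist. Its parity is that of the order of `d`, and levels that are always reached or
always missed bound it to at most three values, between which the intermediate levels decide. -/
lemma padicValRat_scaling {p : ℕ} [hp : Fact p.Prime] (hΔ : W.Δ ≠ 0) (hΔ' : W'.Δ ≠ 0)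
    (hW : IsMinimal ℤ_[p] (W.baseChange ℚ_[p])) (hW' : IsMinimal ℤ_[p] (W'.baseChange ℚ_[p]))
    (hsq : Squarefree d) (hu : u ≠ 0)
    (h₄ : (W.c₄ : ℚ) = (u ^ 2 / d) ^ 2 * W'.c₄) (h₆ : (W.c₆ : ℚ) = (u ^ 2 / d) ^ 3 * W'.c₆) :
    padicValRat p (u ^ 2 / d) = -W.twistExponent d p := by
  have hpp : Prime (p : ℤ) := Nat.prime_iff_prime_int.1 hp.out
  have hK := krausCondition_int p W
  have hmin := isKrausMinimal hΔ hW
  have hrel := W.c_relation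
  obtain ⟨k, d', hk, hd, hd', hkd⟩ : ∃ (k : ℕ) (d' : ℤ), k ≤ 1 ∧ d = p ^ k * d' ∧
      ¬ (p : ℤ) ∣ d' ∧ ((p : ℤ) ∣ d ↔ k = 1) := by
    by_cases h : (p : ℤ) ∣ d
    · obtain ⟨d', rfl⟩ := h
      refine ⟨1, d', le_rfl, by simp, fun ⟨e, he⟩ => ?_, by simp⟩
      exact hpp.not_isUnit (hsq p ⟨e, by rw [he]; ring⟩)
    · exact ⟨0, d, by norm_num, by simp, h, by simpa using h⟩
  obtain ⟨v, w, hα, hvw, hpar⟩ := exists_unit_sq_div hu hd hd'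
  set m := padicValRat p (u ^ 2 / d) with hm
  have hp0 : (p : ℚ_[p]) ≠ 0 := by exact_mod_cast hp.out.ne_zero
  have h₄p : (W.c₄ : ℚ_[p]) = (p : ℚ_[p]) ^ (2 * m) * (v : ℤ_[p]) ^ 2 * W'.c₄ := by
    have := congrArg (fun z : ℚ => (z : ℚ_[p])) h₄
    simp only [Rat.cast_mul, Rat.cast_pow, Rat.cast_intCast] at this
    rw [this, hα, mul_pow, ← zpow_natCast, ← zpow_mul, mul_comm m]
    push_cast; rfl
  have h₆p : (W.c₆ : ℚ_[p]) = (p : ℚ_[p]) ^ (3 * m) * (v : ℤ_[p]) ^ 3 * W'.c₆ := by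
    have := congrArg (fun z : ℚ => (z : ℚ_[p])) h₆
    simp only [Rat.cast_mul, Rat.cast_pow, Rat.cast_intCast] at this
    rw [this, hα, mul_pow, ← zpow_natCast, ← zpow_mul, mul_comm m]
    push_cast; rfl
  have key : ∀ (ε : ℤ) (n l : ℕ), ε * ε = 1 → (p = 2 → 4 ∣ d' - ε) → Even (m - ((n : ℤ) - l)) →
      (IsKrausLevel p ε W.c₄ W.c₆ n l ↔ (n : ℤ) - l ≤ m) := by
    intro ε n l hε hεd hpar'
    -- `v d'` is the square of a unit, so that `v ≡ d' ≡ ε` modulo `4` for `p = 2`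
    refine isKrausLevel_iff hΔ' hW' hε (fun h2 => ?_) h₄p h₆p hpar'
    obtain ⟨e, he⟩ := hεd h2
    subst h2
    obtain ⟨c, hc⟩ := two_dvd_sub_one_of_isUnit w.isUnit
    have he' : (d' : ℤ_[2]) - ε = 4 * e := by exact_mod_cast he
    rcases dvd_or_isUnit_padicInt c with ⟨b, hb⟩ | hcu
    · push_cast at hb
      exact ⟨b * (w + 1) - e * v, by
        linear_combination hvw - (v : ℤ_[2]) * he' + ((w : ℤ_[2]) + 1) * hc
          + 2 * ((w : ℤ_[2]) + 1) * hb⟩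
    · obtain ⟨b, hb⟩ := two_dvd_sub_one_of_isUnit hcu
      exact ⟨(w - 1) * (b + 1) - e * v, by
        linear_combination hvw - (v : ℤ_[2]) * he' + ((w : ℤ_[2]) - 1) * hc
          + 2 * ((w : ℤ_[2]) - 1) * hb⟩
  by_cases hp2 : p = 2
  · have h2d : (p : ℤ) ∣ 2 * d := by rw [hp2]; exact ⟨d, by push_cast; ring⟩
    rw [twistExponent, if_pos h2d, if_pos hp2]
    subst hp2
    rw [Nat.cast_ofNat] at hd hd' hkd
    by_cases hk1 : k = 1
    · subst hk1
      rw [pow_one] at hd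
      rw [Int.even_iff] at hpar
      push_cast at hpar
      obtain ⟨ε, hε, hεd⟩ : ∃ ε : ℤ, (ε = 1 ∨ ε = -1) ∧ 4 ∣ d' - ε := by
        rcases (by omega : d' % 4 = 1 ∨ d' % 4 = 3) with h | h
        · exact ⟨1, Or.inl rfl, by omega⟩
        · exact ⟨-1, Or.inr rfl, by omega⟩
      have hε2 : ε * ε = 1 := by rcases hε with rfl | rfl <;> norm_num
      have k03 := (key ε 0 3 hε2 (fun _ => hεd) (by rw [Int.even_iff]; push_cast; omega)).1
        isKrausLevel_two_neg_three
      have k50 := mt (key ε 5 0 hε2 (fun _ => hεd) (by rw [Int.even_iff]; push_cast; omega)).2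
        (not_isKrausLevel_two_five hε hmin)
      have k01 := (key ε 0 1 hε2 (fun _ => hεd) (by rw [Int.even_iff]; push_cast; omega)).symm.trans
        (isKrausLevel_two_neg_one_iff hε hK)
      have k30 := (key ε 3 0 hε2 (fun _ => hεd) (by rw [Int.even_iff]; push_cast; omega)).symm.trans
        (isKrausLevel_two_three_iff hrel hmin hε hεd)
      have k10 := fun h => (key ε 1 0 hε2 (fun _ => hεd)
        (by rw [Int.even_iff]; push_cast; omega)).symm.trans
        (isKrausLevel_two_one_iff hrel hK h hε hεd)
      rw [twistExponentTwo_of_even W (by omega : d % 2 = 0)]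
      rw [← hd] at k30 k10
      push_cast at k03 k50 k01 k30 k10
      split_ifs with c1 c2 c3
      · have := mt k01.1 (not_not.2 c1)
        omega
      · have := k30.2 c2
        omega
      · have := mt k30.1 c2
        have := k01.2 c1
        have := mt (k10 c1).1 (not_not.2 c3)
        omega
      · have := mt k30.1 c2
        have := (k10 c1).2 c3
        omega
    · have hk0 : k = 0 := by omega
      subst hk0
      rw [pow_zero, one_mul] at hd
      subst hd
      rw [Int.even_iff] at hpar
      push_cast at hpar
      rcases (by omega : d % 4 = 1 ∨ d % 4 = 3) with h | h
      · have k00 := (key 1 0 0 rfl (fun _ => by omega) (by rw [Int.even_iff]; push_cast; omega)).1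
          (isKrausLevel_zero hK)
        have k20 := mt (key 1 2 0 rfl (fun _ => by omega)
          (by rw [Int.even_iff]; push_cast; omega)).2 (not_isKrausLevel_two hmin)
        have h1 : d ≡ 1 [ZMOD 4] := h
        rw [twistExponentTwo, if_pos h1]
        push_cast at k00 k20
        omega
      · have k02 := (key (-1) 0 2 rfl (fun _ => by omega)
          (by rw [Int.even_iff]; push_cast; omega)).1 isKrausLevel_two_neg_two
        have k40 := mt (key (-1) 4 0 rfl (fun _ => by omega)
          (by rw [Int.even_iff]; push_cast; omega)).2 (not_isKrausLevel_two_four hmin)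
        have k00 := (key (-1) 0 0 rfl (fun _ => by omega)
          (by rw [Int.even_iff]; push_cast; omega)).symm.trans (isKrausLevel_two_zero_iff hrel hK)
        have k20 := (key (-1) 2 0 rfl (fun _ => by omega)
          (by rw [Int.even_iff]; push_cast; omega)).symm.trans
          (isKrausLevel_two_two_iff hrel hmin h)
        rw [twistExponentTwo_of_three_mod_four W h]
        push_cast at k02 k40 k00 k20
        split_ifs with c1 c2
        · have := mt k00.1 (not_not.2 c1)
          omega
        · have := k20.2 c2
          omega
        · have := k00.2 c1
          have := mt k20.1 c2
          omega
  · have hdvd : (p : ℤ) ∣ 2 * d ↔ (p : ℤ) ∣ d := by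
      refine ⟨fun h => (hpp.dvd_or_dvd h).resolve_left fun h2 => hp2 ?_, fun h => h.mul_left 2⟩
      have : p ∣ 2 := by exact_mod_cast h2
      exact (Nat.prime_dvd_prime_iff_eq hp.out Nat.prime_two).1 this
    rw [twistExponent, if_neg hp2]
    by_cases hk1 : k = 1
    · rw [if_pos (hdvd.2 (hkd.2 hk1))]
      subst hk1
      rw [Int.even_iff] at hpar
      push_cast at hpar
      have k01 := (key 1 0 1 rfl (fun h => absurd h hp2)
        (by rw [Int.even_iff]; push_cast; omega)).1 (isKrausLevel_neg_one_of_ne_two hp2)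
      have k30 := mt (key 1 3 0 rfl (fun h => absurd h hp2)
        (by rw [Int.even_iff]; push_cast; omega)).2 (not_isKrausLevel_three_of_ne_two hp2 hmin)
      have k10 := (key 1 1 0 rfl (fun h => absurd h hp2)
        (by rw [Int.even_iff]; push_cast; omega)).symm.trans
        (isKrausLevel_one_iff_of_ne_two hp.out hp2)
      push_cast at k01 k30 k10
      have hval : W.twistExponentOdd p = 1 ∨ W.twistExponentOdd p = -1 := by
        unfold twistExponentOdd; split_ifs <;> simp
      rcases hval with h | h <;> rw [h] at k10 ⊢ <;> norm_num at k10 <;> omega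
    · have hk0 : k = 0 := by omega
      rw [if_neg (fun h => hk1 (hkd.1 (hdvd.1 h)))]
      subst hk0
      rw [Int.even_iff] at hpar
      push_cast at hpar
      have k00 := (key 1 0 0 rfl (fun h => absurd h hp2)
        (by rw [Int.even_iff]; push_cast; omega)).1 (isKrausLevel_zero hK)
      have k20 := mt (key 1 2 0 rfl (fun h => absurd h hp2)
        (by rw [Int.even_iff]; push_cast; omega)).2 (not_isKrausLevel_two hmin)
      push_cast at k00 k20
      omega

end Local

section Global

lemma abs_eq_one_of_padicValRat {q : ℚ} (hq : q ≠ 0)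
    (h : ∀ p : ℕ, p.Prime → padicValRat p q = 0) : |q| = 1 := by
  have hnum : q.num.natAbs ≠ 0 := by simpa using hq
  have key : ∀ p : ℕ, p.Prime → ¬ p ∣ q.num.natAbs ∧ ¬ p ∣ q.den := by
    intro p hp
    have : Fact p.Prime := ⟨hp⟩
    have h1 := h p hp
    rw [padicValRat, padicValInt] at h1
    have h2 : padicValNat p q.num.natAbs = padicValNat p q.den := by omega
    have h3 := dvd_iff_padicValNat_ne_zero (p := p) hnum
    have h4 := dvd_iff_padicValNat_ne_zero (p := p) q.den_ne_zero
    rw [h2, ← h4] at h3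
    have h5 : ¬ (p ∣ q.num.natAbs ∧ p ∣ q.den) := fun ⟨a, b⟩ => by
      have := Nat.dvd_gcd a b
      rw [q.reduced.gcd_eq_one] at this
      exact hp.one_lt.ne' (Nat.dvd_one.1 this)
    tauto
  have h1 : q.num.natAbs = 1 := Nat.eq_one_iff_not_exists_prime_dvd.2 fun p hp => (key p hp).1
  have h2 : q.den = 1 := Nat.eq_one_iff_not_exists_prime_dvd.2 fun p hp => (key p hp).2
  rw [Rat.abs_def, h1, h2]
  simp

lemma padicValRat_prod_zpow (s : Finset ℕ) (hs : ∀ p ∈ s, p.Prime) (e : ℕ → ℤ) {q : ℕ}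
    (hq : q.Prime) :
    padicValRat q (∏ p ∈ s, (p : ℚ) ^ e p) = if q ∈ s then e q else 0 := by
  have : Fact q.Prime := ⟨hq⟩
  induction s using Finset.induction_on with
  | empty => simp
  | insert a s ha ih =>
    have ha' : a.Prime := hs a (Finset.mem_insert_self _ _)
    have h0 : ∏ p ∈ s, (p : ℚ) ^ e p ≠ 0 := Finset.prod_ne_zero_iff.2 fun p hp =>
      zpow_ne_zero _ (by exact_mod_cast (hs p (Finset.mem_insert_of_mem hp)).ne_zero)
    have ha0 : (a : ℚ) ≠ 0 := by exact_mod_cast ha'.ne_zero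
    rw [Finset.prod_insert ha, padicValRat.mul (zpow_ne_zero _ ha0) h0,
      ih fun p hp => hs p (Finset.mem_insert_of_mem hp), padicValRat.zpow]
    by_cases hqa : q = a
    · subst hqa
      rw [padicValRat.self hq.one_lt]
      simp [ha]
    · have : Fact a.Prime := ⟨ha'⟩
      have h1 : padicValRat q (a : ℚ) = 0 := by
        rw [padicValRat.of_nat, Nat.cast_eq_zero]
        exact padicValNat_primes hqa
      rw [h1]
      simp [hqa]

/-- The scaling factor between the invariants of a minimal model and of a minimal model of its
twist is the inverse of the twist discrepancy. -/
theorem abs_scaling_mul_twistDelta {W W' : WeierstrassCurve ℤ} {d : ℤ} {u : ℚ}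
    (hW : W.IsGlobalMinimal) (hW' : W'.IsGlobalMinimal) (hsq : Squarefree d) (hu : u ≠ 0)
    (h₄ : (W.c₄ : ℚ) = (u ^ 2 / d) ^ 2 * W'.c₄) (h₆ : (W.c₆ : ℚ) = (u ^ 2 / d) ^ 3 * W'.c₆) :
    ((|u ^ 2 / d| : ℚ) : ℝ) * W.twistDelta d = 1 := by
  have hΔ : ∀ V : WeierstrassCurve ℤ, V.IsGlobalMinimal → V.Δ ≠ 0 := by
    intro V hV h0
    have := (V.baseChange ℚ).isElliptic_iff.1 hV.isElliptic
    simp [baseChange, map_Δ, h0] at this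
  have hd0 : d ≠ 0 := hsq.ne_zero
  have hdq : (d : ℚ) ≠ 0 := by exact_mod_cast hd0
  have hα : u ^ 2 / d ≠ 0 := div_ne_zero (pow_ne_zero _ hu) hdq
  set P : ℚ := ∏ p ∈ (2 * d).natAbs.primeFactors, (p : ℚ) ^ W.twistExponent d p with hP
  have hP0 : 0 < P := Finset.prod_pos fun p hp =>
    zpow_pos (by exact_mod_cast (Nat.prime_of_mem_primeFactors hp).pos) _
  have hPd : (P : ℝ) = W.twistDelta d := by
    rw [hP, twistDelta]
    push_cast
    refine Finset.prod_congr rfl fun p hp => ?_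
    rw [twistExponent, if_pos]
    exact Int.natCast_dvd.2 (Nat.dvd_of_mem_primeFactors hp)
  have h1 : |u ^ 2 / d * P| = 1 := by
    refine abs_eq_one_of_padicValRat (mul_ne_zero hα hP0.ne') fun p hp => ?_
    have : Fact p.Prime := ⟨hp⟩
    rw [padicValRat.mul hα hP0.ne', padicValRat_scaling (hΔ W hW) (hΔ W' hW') (hW.isMinimal p)
      (hW'.isMinimal p) hsq hu h₄ h₆, hP,
      padicValRat_prod_zpow _ (fun p => Nat.prime_of_mem_primeFactors) _ hp]
    split_ifs with h
    · ring
    · rw [twistExponent, if_neg]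
      · rfl
      · intro hdvd
        exact h (Nat.mem_primeFactors.2 ⟨hp, Int.natCast_dvd.1 hdvd, by simpa using hd0⟩)
  rw [abs_mul, abs_of_pos hP0] at h1
  rw [← hPd]
  exact_mod_cast h1

end Global

section Periods

open MeasureTheory Set Real

/-! ### Two-dimensional substitutions -/

/-- A differentiable function of two real variables has the total derivative given by its partial
derivatives. -/
lemma hasFDerivAt_of_partial {X : ℝ × ℝ → ℝ} {z : ℝ × ℝ} {α β : ℝ} (hX : DifferentiableAt ℝ X z)
    (h₁ : HasDerivAt (fun t => X (t, z.2)) α z.1) (h₂ : HasDerivAt (fun t => X (z.1, t)) β z.2) :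
    HasFDerivAt X (α • ContinuousLinearMap.fst ℝ ℝ ℝ + β • ContinuousLinearMap.snd ℝ ℝ ℝ) z := by
  have hL := hX.hasFDerivAt
  have e1 : fderiv ℝ X z (1, 0) = α := by
    have hc : HasDerivAt (fun t : ℝ => (t, z.2)) ((1 : ℝ), (0 : ℝ)) z.1 :=
      (hasDerivAt_id z.1).prodMk (hasDerivAt_const _ _)
    exact (hL.comp_hasDerivAt z.1 hc).unique h₁
  have e2 : fderiv ℝ X z (0, 1) = β := by
    have hc : HasDerivAt (fun t : ℝ => (z.1, t)) ((0 : ℝ), (1 : ℝ)) z.2 :=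
      (hasDerivAt_const _ _).prodMk (hasDerivAt_id z.2)
    exact (hL.comp_hasDerivAt z.2 hc).unique h₂
  convert hL using 1
  ext <;> simp [e1, e2]

/-- The Jacobian determinant of a map of the plane in terms of its partial derivatives. -/
lemma det_prod_partial (α β γ δ : ℝ) :
    ((α • ContinuousLinearMap.fst ℝ ℝ ℝ + β • ContinuousLinearMap.snd ℝ ℝ ℝ).prod
      (γ • ContinuousLinearMap.fst ℝ ℝ ℝ + δ • ContinuousLinearMap.snd ℝ ℝ ℝ)).det =
      α * δ - β * γ := by
  rw [ContinuousLinearMap.det, ← LinearMap.det_toMatrix (Module.Basis.finTwoProd ℝ),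
    Matrix.det_fin_two]
  simp [LinearMap.toMatrix_apply]

section ParabolicCoordinates

/-- Parabolic coordinates: `(X, Y) ↦ (√X + i√Y)²`. -/
noncomputable def parabolic (w : ℝ × ℝ) : ℝ × ℝ := (w.1 - w.2, 2 * √(w.1 * w.2))

lemma hasFDerivAt_parabolic {w : ℝ × ℝ} (h1 : 0 < w.1) (h2 : 0 < w.2) :
    HasFDerivAt parabolic
      (((1 : ℝ) • ContinuousLinearMap.fst ℝ ℝ ℝ + (-1 : ℝ) • ContinuousLinearMap.snd ℝ ℝ ℝ).prod
      ((w.2 / √(w.1 * w.2)) • ContinuousLinearMap.fst ℝ ℝ ℝ +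
        (w.1 / √(w.1 * w.2)) • ContinuousLinearMap.snd ℝ ℝ ℝ)) w := by
  have h12 : w.1 * w.2 ≠ 0 := (mul_pos h1 h2).ne'
  refine HasFDerivAt.prodMk (hasFDerivAt_of_partial (by fun_prop) ?_ ?_)
    (hasFDerivAt_of_partial ?_ ?_ ?_)
  · simpa using (hasDerivAt_id w.1).sub_const w.2
  · simpa using (hasDerivAt_id w.2).const_sub w.1
  · have hd : DifferentiableAt ℝ (fun w : ℝ × ℝ => w.1 * w.2) w := by fun_prop
    exact (hd.sqrt h12).const_mul 2
  · have := (((hasDerivAt_id' w.1).mul_const w.2).sqrt h12).const_mul 2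
    exact this.congr_deriv (by ring)
  · have := (((hasDerivAt_id' w.2).const_mul w.1).sqrt h12).const_mul 2
    exact this.congr_deriv (by ring)

lemma injOn_parabolic : InjOn parabolic (Ioi 0 ×ˢ Ioi 0) := by
  rintro ⟨x, y⟩ ⟨hx, hy⟩ ⟨x', y'⟩ ⟨hx', hy'⟩ h
  simp only [mem_Ioi] at hx hy hx' hy'
  simp only [parabolic, Prod.mk.injEq] at h
  obtain ⟨h1, h2⟩ := h
  have h3 : x * y = x' * y' := by
    have := congrArg (fun t => t ^ 2) (mul_left_cancel₀ two_ne_zero h2)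
    simpa [sq_sqrt (mul_pos hx hy).le, sq_sqrt (mul_pos hx' hy').le] using this
  have h4 : (x + y) ^ 2 = (x' + y') ^ 2 := by nlinarith
  have h5 : x + y = x' + y' := (pow_left_inj₀ (by positivity) (by positivity) two_ne_zero).1 h4
  rw [Prod.mk.injEq]
  constructor <;> linarith

lemma image_parabolic : parabolic '' (Ioi 0 ×ˢ Ioi 0) = univ ×ˢ Ioi 0 := by
  ext ⟨x, y⟩
  constructor
  · rintro ⟨w, ⟨h1, h2⟩, hw⟩
    simp only [mem_Ioi] at h1 h2
    rw [← hw]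
    exact ⟨mem_univ _, mul_pos two_pos (sqrt_pos.2 (mul_pos h1 h2))⟩
  · rintro ⟨-, hy⟩
    simp only [mem_Ioi] at hy
    have hr : √(x ^ 2 + y ^ 2) ^ 2 = x ^ 2 + y ^ 2 := sq_sqrt (by positivity)
    have habs : |x| < √(x ^ 2 + y ^ 2) := by
      rw [← sqrt_sq_eq_abs]
      exact sqrt_lt_sqrt (sq_nonneg x) (by nlinarith)
    obtain ⟨h1, h2⟩ := abs_lt.1 habs
    refine ⟨((√(x ^ 2 + y ^ 2) + x) / 2, (√(x ^ 2 + y ^ 2) - x) / 2), ⟨?_, ?_⟩, ?_⟩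
    · simp only [mem_Ioi]; linarith
    · simp only [mem_Ioi]; linarith
    · have e : (√(x ^ 2 + y ^ 2) + x) / 2 * ((√(x ^ 2 + y ^ 2) - x) / 2) = (y / 2) ^ 2 := by
        linear_combination hr / 4
      simp only [parabolic, Prod.mk.injEq]
      refine ⟨by ring, ?_⟩
      rw [e, sqrt_sq (by positivity)]
      ring

/-- Integration over the upper half plane in parabolic coordinates. -/
lemma lintegral_upper_eq_parabolic (F : ℝ × ℝ → ENNReal) :
    ∫⁻ z in univ ×ˢ Ioi 0, F z =
      ∫⁻ w in Ioi 0 ×ˢ Ioi 0, ENNReal.ofReal ((w.1 + w.2) / √(w.1 * w.2)) * F (parabolic w) := by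
  rw [← image_parabolic, lintegral_image_eq_lintegral_abs_det_fderiv_mul volume
    (measurableSet_Ioi.prod measurableSet_Ioi)
    (fun w hw => (hasFDerivAt_parabolic hw.1 hw.2).hasFDerivWithinAt) injOn_parabolic]
  refine setLIntegral_congr_fun (measurableSet_Ioi.prod measurableSet_Ioi) fun w hw => ?_
  obtain ⟨h1, h2⟩ := hw
  simp only [mem_Ioi] at h1 h2
  rw [det_prod_partial, one_mul, neg_one_mul, sub_neg_eq_add, ← add_div,
    abs_of_nonneg (div_nonneg (add_pos h1 h2).le (sqrt_nonneg _))]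

end ParabolicCoordinates

/-! ### Adding a real point and a point with imaginary ordinate -/

section SumMap

variable {a c : ℝ}

/-- For the curve `y² = x(x - a)(x - c)`, a real point with abscissa `p > c` and a point with
abscissa `q < 0` and imaginary ordinate have a sum with abscissa `(√X + i√Y)²`, where `(X, Y)` is
the value of this map at `(p, q)`. -/
noncomputable def sumMap (a c : ℝ) (w : ℝ × ℝ) : ℝ × ℝ :=
  (w.1 * (a - w.2) * (c - w.2) / (w.1 - w.2) ^ 2,
    -w.2 * (w.1 - a) * (w.1 - c) / (w.1 - w.2) ^ 2)

lemma hasFDerivAt_sumMap {w : ℝ × ℝ} (hw : w.1 - w.2 ≠ 0) :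
    HasFDerivAt (sumMap a c)
      (((-((a - w.2) * (c - w.2) * (w.1 + w.2)) / (w.1 - w.2) ^ 3) •
          ContinuousLinearMap.fst ℝ ℝ ℝ +
        (w.1 * ((-(c - w.2) - (a - w.2)) * (w.1 - w.2) + 2 * (a - w.2) * (c - w.2)) /
          (w.1 - w.2) ^ 3) • ContinuousLinearMap.snd ℝ ℝ ℝ).prod
      ((-w.2 * ((2 * w.1 - a - c) * (w.1 - w.2) - 2 * (w.1 - a) * (w.1 - c)) /
          (w.1 - w.2) ^ 3) • ContinuousLinearMap.fst ℝ ℝ ℝ +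
        (-((w.1 - a) * (w.1 - c) * (w.1 + w.2)) / (w.1 - w.2) ^ 3) •
          ContinuousLinearMap.snd ℝ ℝ ℝ)) w := by
  have hw2 : (w.1 - w.2) ^ 2 ≠ 0 := pow_ne_zero _ hw
  have d1 : HasDerivAt (fun t => (t - w.2) ^ 2) (2 * (w.1 - w.2)) w.1 := by
    simpa using ((hasDerivAt_id' w.1).sub_const w.2).fun_pow 2
  have d2 : HasDerivAt (fun t => (w.1 - t) ^ 2) (-(2 * (w.1 - w.2))) w.2 := by
    simpa using ((hasDerivAt_id' w.2).const_sub w.1).fun_pow 2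
  refine HasFDerivAt.prodMk (hasFDerivAt_of_partial ?_ ?_ ?_) (hasFDerivAt_of_partial ?_ ?_ ?_)
  · change DifferentiableAt ℝ
      (fun w : ℝ × ℝ => w.1 * (a - w.2) * (c - w.2) / (w.1 - w.2) ^ 2) w
    fun_prop (disch := assumption)
  · have h : HasDerivAt (fun t => t * (a - w.2) * (c - w.2)) (1 * (a - w.2) * (c - w.2)) w.1 :=
      ((hasDerivAt_id' w.1).mul_const _).mul_const _
    exact (h.div d1 hw2).congr_deriv (by field_simp; ring)
  · have h : HasDerivAt (fun t => w.1 * (a - t) * (c - t))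
        (w.1 * (-1) * (c - w.2) + w.1 * (a - w.2) * (-1)) w.2 :=
      (((hasDerivAt_id' w.2).const_sub a).const_mul w.1).mul ((hasDerivAt_id' w.2).const_sub c)
    exact (h.div d2 hw2).congr_deriv (by field_simp; ring)
  · change DifferentiableAt ℝ
      (fun w : ℝ × ℝ => -w.2 * (w.1 - a) * (w.1 - c) / (w.1 - w.2) ^ 2) w
    fun_prop (disch := assumption)
  · have h : HasDerivAt (fun t => -w.2 * (t - a) * (t - c))
        (-w.2 * 1 * (w.1 - c) + -w.2 * (w.1 - a) * 1) w.1 :=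
      (((hasDerivAt_id' w.1).sub_const a).const_mul (-w.2)).mul ((hasDerivAt_id' w.1).sub_const c)
    exact (h.div d1 hw2).congr_deriv (by field_simp; ring)
  · have h : HasDerivAt (fun t => -t * (w.1 - a) * (w.1 - c))
        (-1 * (w.1 - a) * (w.1 - c)) w.2 :=
      ((hasDerivAt_id' w.2).neg.mul_const _).mul_const _
    exact (h.div d2 hw2).congr_deriv (by field_simp; ring)

/-- The squared distance of the point with parabolic coordinates `(X, Y)` to the real point `e`. -/
def distSq (e : ℝ) (w : ℝ × ℝ) : ℝ := (w.1 - w.2 - e) ^ 2 + 4 * w.1 * w.2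

lemma sqrt_distSq_sumMap_zero {w : ℝ × ℝ} (ha : 0 < a) (hac : a < c) (h1 : c < w.1)
    (h2 : w.2 < 0) :
    √(distSq 0 (sumMap a c w)) = (a * c - w.1 * w.2) / (w.1 - w.2) := by
  have hD : 0 < w.1 - w.2 := by linarith
  have e : distSq 0 (sumMap a c w) = ((a * c - w.1 * w.2) / (w.1 - w.2)) ^ 2 := by
    simp only [distSq, sumMap]; field_simp; ring
  rw [e, sqrt_sq]
  refine div_nonneg ?_ hD.le
  nlinarith

lemma sqrt_distSq_sumMap_mid {w : ℝ × ℝ} (ha : 0 < a) (hac : a < c) (h1 : c < w.1)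
    (h2 : w.2 < 0) :
    √(distSq a (sumMap a c w)) = (a * (w.1 + w.2) - w.1 * w.2 - a * c) / (w.1 - w.2) := by
  have hD : 0 < w.1 - w.2 := by linarith
  have e : distSq a (sumMap a c w) =
      ((a * (w.1 + w.2) - w.1 * w.2 - a * c) / (w.1 - w.2)) ^ 2 := by
    simp only [distSq, sumMap]; field_simp; ring
  rw [e, sqrt_sq]
  refine div_nonneg ?_ hD.le
  nlinarith

lemma sqrt_distSq_sumMap_last {w : ℝ × ℝ} (ha : 0 < a) (hac : a < c) (h1 : c < w.1)
    (h2 : w.2 < 0) :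
    √(distSq c (sumMap a c w)) = (c * (w.1 + w.2) - w.1 * w.2 - a * c) / (w.1 - w.2) := by
  have hD : 0 < w.1 - w.2 := by linarith
  have e : distSq c (sumMap a c w) =
      ((c * (w.1 + w.2) - w.1 * w.2 - a * c) / (w.1 - w.2)) ^ 2 := by
    simp only [distSq, sumMap]; field_simp; ring
  rw [e, sqrt_sq]
  refine div_nonneg ?_ hD.le
  nlinarith

/-- The inverse of `sumMap`, in terms of the distances to the three roots. -/
noncomputable def sumMapInv (a c : ℝ) (w : ℝ × ℝ) : ℝ × ℝ :=
  (c + c * (√(distSq a w) + √(distSq c w) - c + a) / (c - √(distSq c w) + √(distSq 0 w)),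
    -(c * (√(distSq 0 w) + √(distSq a w) - a)) / (c + √(distSq c w) - √(distSq 0 w)))

lemma sumMapInv_sumMap {w : ℝ × ℝ} (ha : 0 < a) (hac : a < c) (h1 : c < w.1) (h2 : w.2 < 0) :
    sumMapInv a c (sumMap a c w) = w := by
  have hD : 0 < w.1 - w.2 := by linarith
  obtain ⟨p, q⟩ := w
  simp only at h1 h2 hD
  simp only [sumMapInv, sqrt_distSq_sumMap_zero (w := (p, q)) ha hac h1 h2,
    sqrt_distSq_sumMap_mid (w := (p, q)) ha hac h1 h2,
    sqrt_distSq_sumMap_last (w := (p, q)) ha hac h1 h2, Prod.mk.injEq]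
  have e1 : c - (c * (p + q) - p * q - a * c) / (p - q) + (a * c - p * q) / (p - q) =
      2 * c * (a - q) / (p - q) := by field_simp; ring
  have e2 : (a * (p + q) - p * q - a * c) / (p - q) + (c * (p + q) - p * q - a * c) / (p - q)
      - c + a = 2 * (a - q) * (p - c) / (p - q) := by field_simp; ring
  have e3 : c + (c * (p + q) - p * q - a * c) / (p - q) - (a * c - p * q) / (p - q) =
      2 * c * (p - a) / (p - q) := by field_simp; ring
  have e4 : (a * c - p * q) / (p - q) + (a * (p + q) - p * q - a * c) / (p - q) - a =
      -(2 * q * (p - a)) / (p - q) := by field_simp; ring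
  rw [e1, e2, e3, e4]
  have hc : c ≠ 0 := by linarith
  have haq : a - q ≠ 0 := by linarith
  have hpa : p - a ≠ 0 := by linarith
  constructor
  · field_simp; ring
  · field_simp

lemma sumMap_mem {w : ℝ × ℝ} (ha : 0 < a) (hac : a < c) (h1 : c < w.1) (h2 : w.2 < 0) :
    sumMap a c w ∈ Ioi (0 : ℝ) ×ˢ Ioi (0 : ℝ) := by
  have hD : 0 < w.1 - w.2 := by linarith
  have i1 : 0 < w.1 := by linarith
  have i2 : 0 < a - w.2 := by linarith
  have i3 : 0 < c - w.2 := by linarith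
  have i4 : 0 < w.1 - a := by linarith
  have i5 : 0 < w.1 - c := by linarith
  have i6 : 0 < -w.2 := by linarith
  exact ⟨by simp only [sumMap, mem_Ioi]; positivity, by simp only [sumMap, mem_Ioi]; positivity⟩

/-- `sumMap` takes the quadrant `p > c`, `q < 0` onto the positive quadrant. A point of the upper
half plane is determined by its distances to two points of the line, and Stewart's relation
between the distances to `0`, `a` and `c` shows that those of the image are the given ones. -/
lemma sumMapInv_spec {w : ℝ × ℝ} (ha : 0 < a) (hac : a < c) (h1 : 0 < w.1) (h2 : 0 < w.2) :
    (c < (sumMapInv a c w).1 ∧ (sumMapInv a c w).2 < 0) ∧ sumMap a c (sumMapInv a c w) = w := by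
  obtain ⟨x, y⟩ := w
  simp only at h1 h2
  have hxy : 0 < x * y := mul_pos h1 h2
  set r := √(distSq 0 (x, y)) with hr
  set s := √(distSq a (x, y)) with hs
  set t := √(distSq c (x, y)) with ht
  have hr0 : r = x + y := by
    rw [hr, show distSq 0 (x, y) = (x + y) ^ 2 by simp only [distSq]; ring,
      sqrt_sq (by positivity)]
  have hpos : ∀ e, 0 ≤ distSq e (x, y) := fun e => by
    simp only [distSq]; nlinarith [sq_nonneg (x - y - e)]
  have hs2 : s ^ 2 = r ^ 2 - 2 * a * (x - y) + a ^ 2 := by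
    rw [hs, sq_sqrt (hpos a), hr0]; simp only [distSq]; ring
  have ht2 : t ^ 2 = r ^ 2 - 2 * c * (x - y) + c ^ 2 := by
    rw [ht, sq_sqrt (hpos c), hr0]; simp only [distSq]; ring
  have hs0 : 0 ≤ s := sqrt_nonneg _
  have ht0 : 0 ≤ t := sqrt_nonneg _
  have hc : 0 < c := by linarith
  -- the denominators and numerators are positive by the triangle inequality
  have hB : 0 < c - t + r := by
    have : t < c + r := lt_of_pow_lt_pow_left₀ 2 (by rw [hr0]; positivity) (by
      rw [ht2, hr0]; nlinarith)
    linarith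
  have hE : 0 < c + t - r := by
    have : r - c < t := by
      apply lt_of_pow_lt_pow_left₀ 2 ht0
      rw [ht2, hr0]; nlinarith
    linarith
  have hC : 0 < r + s - a := by
    have : a - r < s := by
      apply lt_of_pow_lt_pow_left₀ 2 hs0
      rw [hs2, hr0]; nlinarith
    linarith
  have hA : 0 < s + t - c + a := by
    have h3 : x - y - a < s := by
      apply lt_of_pow_lt_pow_left₀ 2 hs0
      rw [hs2, hr0]; nlinarith
    have : c - a - s < t := by
      apply lt_of_pow_lt_pow_left₀ 2 ht0
      nlinarith
    linarith
  -- Stewart's theorem for the distances to three points of a line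
  have hrel : c * s ^ 2 = (c - a) * r ^ 2 + a * t ^ 2 - a * c * (c - a) := by
    rw [hs2, ht2]; ring
  have hp : c < c + c * (s + t - c + a) / (c - t + r) := by
    have : 0 < c * (s + t - c + a) / (c - t + r) := by positivity
    linarith
  have hq : -(c * (r + s - a)) / (c + t - r) < 0 := by
    rw [neg_div]
    have : 0 < c * (r + s - a) / (c + t - r) := by positivity
    linarith
  refine ⟨⟨hp, hq⟩, ?_⟩
  have hinv : sumMapInv a c (x, y) =
      (c + c * (s + t - c + a) / (c - t + r), -(c * (r + s - a)) / (c + t - r)) := rfl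
  rw [hinv]
  set p := c + c * (s + t - c + a) / (c - t + r) with hpdef
  set q := -(c * (r + s - a)) / (c + t - r) with hqdef
  have hD : 0 < p - q := by linarith
  have k1 : a * c - p * q = r * (p - q) := by
    rw [hpdef, hqdef]
    field_simp
    linear_combination hrel
  have k2 : c * (p + q) - p * q - a * c = t * (p - q) := by
    rw [hpdef, hqdef]
    field_simp
    linear_combination hrel
  have g1 := sqrt_distSq_sumMap_zero (w := (p, q)) ha hac hp hq
  have g2 := sqrt_distSq_sumMap_last (w := (p, q)) ha hac hp hq
  have m := sumMap_mem (w := (p, q)) ha hac hp hq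
  simp only at g1 g2
  rw [k1, mul_div_assoc, div_self hD.ne', mul_one] at g1
  rw [k2, mul_div_assoc, div_self hD.ne', mul_one] at g2
  obtain ⟨m1, m2⟩ := m
  rw [mem_Ioi] at m1 m2
  generalize sumMap a c (p, q) = v at *
  have g0 : √(distSq 0 v) = v.1 + v.2 := by
    rw [show distSq 0 v = (v.1 + v.2) ^ 2 by simp only [distSq]; ring, sqrt_sq (by positivity)]
  rw [g0, hr0] at g1
  have g3 : distSq c v = t ^ 2 := by
    rw [← g2, sq_sqrt]; simp only [distSq]; nlinarith [sq_nonneg (v.1 - v.2 - c), mul_pos m1 m2]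
  have g4 : distSq c v = (v.1 + v.2) ^ 2 - 2 * c * (v.1 - v.2) + c ^ 2 := by
    simp only [distSq]; ring
  rw [ht2, g4, g1, hr0] at g3
  have g5 : v.1 - v.2 = x - y := by
    apply mul_left_cancel₀ (mul_pos two_pos hc).ne'
    linarith
  ext <;> simp only <;> linarith

/-- The integral of `|z(z - a)(z - c)|⁻¹` over the upper half plane is a product of two real
integrals: in the coordinates `(p, q)` of `sumMap`, the Jacobian and the three distances cancel. -/
lemma lintegral_upper_cubic (ha : 0 < a) (hac : a < c) :
    ∫⁻ z in univ ×ˢ Ioi (0 : ℝ), ENNReal.ofReal (√(z.1 ^ 2 + z.2 ^ 2) *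
        √((z.1 - a) ^ 2 + z.2 ^ 2) * √((z.1 - c) ^ 2 + z.2 ^ 2))⁻¹ =
      (∫⁻ p in Ioi c, ENNReal.ofReal (√|p * (p - a) * (p - c)|)⁻¹) *
        ∫⁻ q in Iio 0, ENNReal.ofReal (√|q * (q - a) * (q - c)|)⁻¹ := by
  have himg : sumMap a c '' (Ioi c ×ˢ Iio 0) = Ioi 0 ×ˢ Ioi 0 := by
    ext w
    constructor
    · rintro ⟨v, ⟨h1, h2⟩, rfl⟩
      exact sumMap_mem ha hac h1 h2
    · rintro ⟨h1, h2⟩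
      obtain ⟨⟨h3, h4⟩, h5⟩ := sumMapInv_spec ha hac h1 h2
      exact ⟨_, ⟨h3, h4⟩, h5⟩
  have hinj : InjOn (sumMap a c) (Ioi c ×ˢ Iio 0) := by
    intro v hv w hw h
    rw [← sumMapInv_sumMap ha hac hv.1 hv.2, ← sumMapInv_sumMap ha hac hw.1 hw.2, h]
  have hmeas : MeasurableSet (Ioi c ×ˢ Iio (0 : ℝ)) := measurableSet_Ioi.prod measurableSet_Iio
  rw [lintegral_upper_eq_parabolic, ← himg,
    lintegral_image_eq_lintegral_abs_det_fderiv_mul volume hmeas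
      (fun w hw => (hasFDerivAt_sumMap (a := a) (c := c) (w := w) (by
        have h1 := hw.1; have h2 := hw.2; simp only [mem_Ioi, mem_Iio] at h1 h2
        linarith)).hasFDerivWithinAt) hinj,
    ← lintegral_prod_mul (by fun_prop) (by fun_prop), Measure.prod_restrict]
  refine setLIntegral_congr_fun hmeas fun w hw => ?_
  obtain ⟨h1, h2⟩ := hw
  simp only [mem_Ioi, mem_Iio] at h1 h2
  have hm := sumMap_mem ha hac h1 h2
  have hD : 0 < w.1 - w.2 := by linarith
  have i1 : 0 < w.1 := by linarith
  have i2 : 0 < a - w.2 := by linarith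
  have i3 : 0 < c - w.2 := by linarith
  have i4 : 0 < w.1 - a := by linarith
  have i5 : 0 < w.1 - c := by linarith
  have i6 : 0 < -w.2 := by linarith
  have hXY : 0 < (sumMap a c w).1 * (sumMap a c w).2 := mul_pos hm.1 hm.2
  have hdist : ∀ e, √(((parabolic (sumMap a c w)).1 - e) ^ 2 + (parabolic (sumMap a c w)).2 ^ 2) =
      √(distSq e (sumMap a c w)) := by
    intro e
    congr 1
    simp only [parabolic, distSq, mul_pow, sq_sqrt hXY.le]
    ring
  have hdist0 := hdist 0
  rw [sub_zero] at hdist0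
  have hr := sqrt_distSq_sumMap_zero ha hac h1 h2
  have hs := sqrt_distSq_sumMap_mid ha hac h1 h2
  have ht := sqrt_distSq_sumMap_last ha hac h1 h2
  have hr1 : 0 < a * c - w.1 * w.2 := by nlinarith
  have hs1 : 0 < a * (w.1 + w.2) - w.1 * w.2 - a * c := by nlinarith
  have ht1 : 0 < c * (w.1 + w.2) - w.1 * w.2 - a * c := by nlinarith
  have hsum : (sumMap a c w).1 + (sumMap a c w).2 = (a * c - w.1 * w.2) / (w.1 - w.2) := by
    simp only [sumMap]; field_simp; ring
  have hp : |w.1 * (w.1 - a) * (w.1 - c)| = w.1 * (w.1 - a) * (w.1 - c) :=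
    abs_of_pos (by positivity)
  have hq : |w.2 * (w.2 - a) * (w.2 - c)| = -w.2 * (a - w.2) * (c - w.2) := by
    rw [show w.2 * (w.2 - a) * (w.2 - c) = -(-w.2 * (a - w.2) * (c - w.2)) by ring, abs_neg,
      abs_of_pos (by positivity)]
  have hprod : √(w.1 * (w.1 - a) * (w.1 - c)) * √(-w.2 * (a - w.2) * (c - w.2)) =
      (w.1 - w.2) ^ 2 * √((sumMap a c w).1 * (sumMap a c w).2) := by
    rw [← sqrt_mul (by positivity), ← sqrt_sq (by positivity : 0 ≤ (w.1 - w.2) ^ 2),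
      ← sqrt_mul (by positivity)]
    congr 1
    simp only [sumMap]; field_simp
  rw [det_prod_partial, hdist0, hdist, hdist, hr, hs, ht, hsum, hp, hq,
    ← ENNReal.ofReal_mul (by positivity), ← ENNReal.ofReal_mul (by positivity),
    ← ENNReal.ofReal_mul (by positivity), ← mul_inv, hprod]
  congr 1
  -- the Jacobian of `sumMap` is the product of two of the distances divided by `(p - q) ^ 2`
  have hdet : ∀ x : ℝ, x = (a * (w.1 + w.2) - w.1 * w.2 - a * c) *
      (c * (w.1 + w.2) - w.1 * w.2 - a * c) / (w.1 - w.2) ^ 4 →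
      |x| = (a * (w.1 + w.2) - w.1 * w.2 - a * c) *
      (c * (w.1 + w.2) - w.1 * w.2 - a * c) / (w.1 - w.2) ^ 4 := fun x hx => by
    rw [hx]; exact abs_of_pos (by positivity)
  rw [hdet _ (by field_simp; ring)]
  have hsq : 0 < √((sumMap a c w).1 * (sumMap a c w).2) := sqrt_pos.2 hXY
  generalize √((sumMap a c w).1 * (sumMap a c w).2) = σ at *
  generalize a * (w.1 + w.2) - w.1 * w.2 - a * c = S at *
  generalize c * (w.1 + w.2) - w.1 * w.2 - a * c = T at *
  generalize a * c - w.1 * w.2 = R at *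
  field_simp

end SumMap

/-! ### Real and complex period integrals of a cubic -/

/-- The integral of `|g|^(-1/2)` over a set of real numbers. -/
noncomputable def realIntegral (g : ℝ → ℝ) (S : Set ℝ) : ENNReal :=
  ∫⁻ x in S, ENNReal.ofReal (√|g x|)⁻¹

/-- The integral of `|g|⁻¹` over the complex plane. -/
noncomputable def complexIntegral (g : ℂ → ℂ) : ENNReal := ∫⁻ z, ENNReal.ofReal ‖g z‖⁻¹

section HalfPlane

lemma volume_real_line : volume {z : ℂ | z.im = 0} = 0 := by
  have h : LinearMap.ker Complex.imLm ≠ ⊤ := by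
    intro h
    have : Complex.I ∈ LinearMap.ker Complex.imLm := by rw [h]; trivial
    simp at this
  have := Measure.addHaar_submodule (volume : Measure ℂ) (LinearMap.ker Complex.imLm) h
  convert this using 2
  ext z
  simp

/-- For a function that is invariant under conjugation, the integral over the plane is twice the
integral over the upper half plane. -/
lemma lintegral_eq_two_mul_upper (F : ℂ → ENNReal)
    (hF : ∀ z, F ((starRingEnd ℂ) z) = F z) :
    ∫⁻ z, F z = 2 * ∫⁻ w in univ ×ˢ Ioi (0 : ℝ), F ⟨w.1, w.2⟩ := by
  have hm : MeasurableSet {z : ℂ | 0 < z.im} :=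
    measurableSet_lt measurable_const Complex.measurable_im
  have hm' : MeasurableSet {z : ℂ | z.im < 0} :=
    measurableSet_lt Complex.measurable_im measurable_const
  have h1 : ∫⁻ z in {z : ℂ | z.im < 0}, F z = ∫⁻ z in {z : ℂ | 0 < z.im}, F z := by
    have := Complex.conjLIE.measurePreserving.setLIntegral_comp_preimage_emb
      Complex.conjLIE.toMeasurableEquiv.measurableEmbedding F {z : ℂ | z.im < 0}
    rw [← this]
    have e : Complex.conjLIE ⁻¹' {z : ℂ | z.im < 0} = {z : ℂ | 0 < z.im} := by ext z; simp
    rw [e]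
    exact lintegral_congr fun z => hF z
  have h2 : ∫⁻ z in {z : ℂ | 0 < z.im}ᶜ, F z = ∫⁻ z in {z : ℂ | z.im < 0}, F z := by
    refine setLIntegral_congr ?_
    rw [ae_eq_set]
    constructor
    · refine measure_mono_null ?_ volume_real_line
      rintro z ⟨h3, h4⟩
      simp only [mem_compl_iff, mem_ofPred_eq, not_lt] at h3 h4
      exact le_antisymm h3 h4
    · rw [sdiff_eq_empty.2]
      · exact measure_empty
      · intro z hz
        simp only [mem_compl_iff, mem_ofPred_eq, not_lt] at hz ⊢
        exact hz.le
  have h3 := Complex.volume_preserving_equiv_real_prod.setLIntegral_comp_preimage_emb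
    Complex.measurableEquivRealProd.measurableEmbedding (fun w => F ⟨w.1, w.2⟩)
    (univ ×ˢ Ioi (0 : ℝ))
  have e : Complex.measurableEquivRealProd ⁻¹' (univ ×ˢ Ioi (0 : ℝ)) = {z : ℂ | 0 < z.im} := by
    ext z; simp
  rw [e] at h3
  rw [← lintegral_add_compl F hm, h2, h1, ← two_mul, ← h3]
  rfl

end HalfPlane

section ThreeRealRoots

variable {e₁ e₂ e₃ : ℝ}

/-- For three real roots, the integral over the plane is twice the product of the integrals over
the two unbounded intervals. -/
lemma complexIntegral_eq_two_mul (h₁₂ : e₁ < e₂) (h₂₃ : e₂ < e₃) :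
    complexIntegral (fun z => (z - e₁) * (z - e₂) * (z - e₃)) =
      2 * (realIntegral (fun x => (x - e₁) * (x - e₂) * (x - e₃)) (Ioi e₃) *
        realIntegral (fun x => (x - e₁) * (x - e₂) * (x - e₃)) (Iio e₁)) := by
  have hreal : ∀ S, realIntegral (fun x => (x - e₁) * (x - e₂) * (x - e₃)) S =
      realIntegral (fun x => x * (x - (e₂ - e₁)) * (x - (e₃ - e₁))) ((fun x => x + e₁) ⁻¹' S) := by
    intro S
    have := (measurePreserving_add_right volume e₁).setLIntegral_comp_preimage_emb
      (MeasurableEquiv.addRight e₁).measurableEmbedding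
      (fun x => ENNReal.ofReal (√|(x - e₁) * (x - e₂) * (x - e₃)|)⁻¹) S
    rw [realIntegral, ← this, realIntegral]
    refine lintegral_congr fun x => ?_
    congr 4
    ring
  have hcomplex : complexIntegral (fun z => (z - e₁) * (z - e₂) * (z - e₃)) =
      complexIntegral (fun z => z * (z - (e₂ - e₁ : ℝ)) * (z - (e₃ - e₁ : ℝ))) := by
    rw [complexIntegral, complexIntegral, ← lintegral_sub_right_eq_self
      (fun z : ℂ => ENNReal.ofReal ‖(z - e₁) * (z - e₂) * (z - e₃)‖⁻¹) (-(e₁ : ℂ))]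
    refine lintegral_congr fun x => ?_
    congr 3
    push_cast
    ring
  rw [hreal, hreal, preimage_add_const_Ioi, preimage_add_const_Iio, sub_self, hcomplex,
    complexIntegral, lintegral_eq_two_mul_upper, realIntegral, realIntegral,
    ← lintegral_upper_cubic (sub_pos.2 h₁₂) (sub_lt_sub_right h₂₃ e₁)]
  · congr 2
    ext w
    have hn : ∀ e : ℝ, ‖(⟨w.1, w.2⟩ : ℂ) - e‖ = √((w.1 - e) ^ 2 + w.2 ^ 2) := by
      intro e
      rw [Complex.norm_eq_sqrt_sq_add_sq]
      simp
    have hn0 := hn 0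
    rw [Complex.ofReal_zero, sub_zero, sub_zero] at hn0
    rw [norm_mul, norm_mul, hn, hn, hn0]
  · intro z
    have hn : ∀ e : ℝ, ‖(starRingEnd ℂ) z - e‖ = ‖z - e‖ := by
      intro e
      rw [← Complex.norm_conj (z - e), map_sub, Complex.conj_ofReal]
    rw [norm_mul, norm_mul, norm_mul, norm_mul, hn, hn, Complex.norm_conj]

end ThreeRealRoots

section Translation

variable {e α β : ℝ}

/-- Translation by the point of order two with abscissa `e` preserves the invariant
differential. -/
lemma realIntegral_preimage_translation (hβ : 0 < β) {S : Set ℝ} (hS : MeasurableSet S)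
    (he : e ∉ S) :
    realIntegral (fun x => (x - e) * ((x - e) ^ 2 + α * (x - e) + β))
      ((fun x => e + β / (x - e)) ⁻¹' S) =
    realIntegral (fun x => (x - e) * ((x - e) ^ 2 + α * (x - e) + β)) S := by
  have hinv : Function.Involutive fun x : ℝ => e + β / (x - e) := fun x => by
    simp [div_div_cancel₀ hβ.ne']
  have hne : ∀ x ∈ S, x - e ≠ 0 := fun x hx h => he (by rwa [← sub_eq_zero.1 h])
  rw [← hinv.image_eq_preimage_symm, realIntegral,
    lintegral_image_eq_lintegral_abs_deriv_mul hS (f' := fun x => -β / (x - e) ^ 2)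
      (fun x hx => ?_) hinv.injective.injOn, realIntegral]
  · refine setLIntegral_congr_fun hS fun x hx => ?_
    have h0 := hne x hx
    have hpos : 0 < β / (x - e) ^ 2 := by positivity
    have e1 : e + β / (x - e) - e = β / (x - e) := by ring
    have e2 : β / (x - e) * ((β / (x - e)) ^ 2 + α * (β / (x - e)) + β) =
        (β / (x - e) ^ 2) ^ 2 * ((x - e) * ((x - e) ^ 2 + α * (x - e) + β)) := by
      field_simp; ring
    rw [e1, e2, abs_mul, abs_of_pos (pow_pos hpos 2), sqrt_mul (by positivity),
      sqrt_sq hpos.le, ← ENNReal.ofReal_mul (abs_nonneg _), neg_div, abs_neg, abs_of_pos hpos,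
      mul_inv, ← mul_assoc, mul_inv_cancel₀ hpos.ne', one_mul]
  · have h0 := hne x hx
    have h1 := ((hasDerivAt_const x β).fun_div ((hasDerivAt_id' x).sub_const e) h0).const_add e
    exact (h1.congr_deriv (by ring)).hasDerivWithinAt

end Translation

section ThreeRealRoots

variable {e₁ e₂ e₃ : ℝ}

/-- For three real roots, the product of the real integrals is twice the integral over the
plane. -/
theorem realIntegral_mul_of_three_roots (h₁₂ : e₁ < e₂) (h₂₃ : e₂ < e₃) {g : ℝ → ℝ}
    (hg : ∀ x, g x = (x - e₁) * (x - e₂) * (x - e₃)) :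
    realIntegral g {x | 0 < g x} * realIntegral g {x | g x < 0} =
      2 * complexIntegral (fun z => (z - e₁) * (z - e₂) * (z - e₃)) := by
  have hpos : {x | 0 < g x} = Ioo e₁ e₂ ∪ Ioi e₃ := by
    ext x
    simp only [mem_ofPred_eq, mem_union, mem_Ioo, mem_Ioi, hg]
    constructor
    · intro h
      by_contra hx
      rw [not_or, not_and_or] at hx
      obtain ⟨h1 | h1, h2⟩ := hx
      · nlinarith [mul_nonneg (sub_nonneg.2 (not_lt.1 h1))
          (sub_nonneg.2 ((not_lt.1 h1).trans h₁₂.le)),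
          mul_nonneg (mul_nonneg (sub_nonneg.2 (not_lt.1 h1))
          (sub_nonneg.2 ((not_lt.1 h1).trans h₁₂.le))) (sub_nonneg.2 (not_lt.1 h2))]
      · nlinarith [mul_nonneg (mul_nonneg (sub_nonneg.2 (h₁₂.le.trans (not_lt.1 h1)))
          (sub_nonneg.2 (not_lt.1 h1))) (sub_nonneg.2 (not_lt.1 h2))]
    · rintro (⟨h1, h2⟩ | h1)
      · have := mul_pos (mul_pos (sub_pos.2 h1) (sub_pos.2 h2)) (sub_pos.2 (h2.trans h₂₃))
        linarith
      · exact mul_pos (mul_pos (by linarith) (by linarith)) (by linarith)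
  have hneg : {x | g x < 0} = Iio e₁ ∪ Ioo e₂ e₃ := by
    ext x
    simp only [mem_ofPred_eq, mem_union, mem_Ioo, mem_Iio, hg]
    constructor
    · intro h
      by_contra hx
      rw [not_or, not_and_or] at hx
      obtain ⟨h1, h2 | h2⟩ := hx
      · nlinarith [mul_nonneg (mul_nonneg (sub_nonneg.2 (not_lt.1 h1))
          (sub_nonneg.2 (not_lt.1 h2))) (sub_nonneg.2 ((not_lt.1 h2).trans h₂₃.le))]
      · nlinarith [mul_nonneg (mul_nonneg (sub_nonneg.2 (not_lt.1 h1))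
          (sub_nonneg.2 (h₂₃.le.trans (not_lt.1 h2)))) (sub_nonneg.2 (not_lt.1 h2))]
    · rintro (h1 | ⟨h1, h2⟩)
      · have := mul_pos (mul_pos (sub_pos.2 h1) (sub_pos.2 (h1.trans h₁₂)))
          (sub_pos.2 ((h1.trans h₁₂).trans h₂₃))
        linarith
      · have := mul_pos (mul_pos (sub_pos.2 (h₁₂.trans h1)) (sub_pos.2 h1)) (sub_pos.2 h2)
        linarith
  -- translation by the point of order two above `e₁` exchanges the two components
  have hegg : realIntegral g (Ioo e₁ e₂) = realIntegral g (Ioi e₃) := by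
    have := realIntegral_preimage_translation (e := e₁) (α := -(e₂ - e₁) - (e₃ - e₁))
      (β := (e₂ - e₁) * (e₃ - e₁)) (S := Ioi e₃) (mul_pos (by linarith) (by linarith))
      measurableSet_Ioi (by simp only [mem_Ioi]; linarith)
    have hg' : (fun x => (x - e₁) * ((x - e₁) ^ 2 + (-(e₂ - e₁) - (e₃ - e₁)) * (x - e₁) +
        (e₂ - e₁) * (e₃ - e₁))) = g := by
      ext x; rw [hg]; ring
    rw [hg'] at this
    rw [← this]
    congr 1
    ext x
    simp only [mem_Ioo, mem_preimage, mem_Ioi]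
    constructor
    · rintro ⟨h1, h2⟩
      have : e₃ - e₁ < (e₂ - e₁) * (e₃ - e₁) / (x - e₁) := by
        rw [lt_div_iff₀ (by linarith)]; nlinarith
      linarith
    · intro h
      have h1 : 0 < (e₂ - e₁) * (e₃ - e₁) / (x - e₁) := by linarith
      have h2 : 0 < x - e₁ := by
        by_contra h2
        exact absurd h1 (not_lt.2 (div_nonpos_of_nonneg_of_nonpos
          (mul_nonneg (by linarith) (by linarith)) (not_lt.1 h2)))
      have h3 : e₃ - e₁ < (e₂ - e₁) * (e₃ - e₁) / (x - e₁) := by linarith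
      rw [lt_div_iff₀ h2] at h3
      exact ⟨by linarith, by nlinarith⟩
  -- likewise for the twisted curve `-Y² = g(x)`, with the point above `e₃`
  have hgap : realIntegral g (Ioo e₂ e₃) = realIntegral g (Iio e₁) := by
    have := realIntegral_preimage_translation (e := e₃) (α := (e₃ - e₁) + (e₃ - e₂))
      (β := (e₃ - e₁) * (e₃ - e₂)) (S := Iio e₁) (mul_pos (by linarith) (by linarith))
      measurableSet_Iio (by simp only [mem_Iio]; linarith)
    have hg' : (fun x => (x - e₃) * ((x - e₃) ^ 2 + ((e₃ - e₁) + (e₃ - e₂)) * (x - e₃) +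
        (e₃ - e₁) * (e₃ - e₂))) = g := by
      ext x; rw [hg]; ring
    rw [hg'] at this
    rw [← this]
    congr 1
    ext x
    simp only [mem_Ioo, mem_preimage, mem_Iio]
    have hsymm : (e₃ - e₁) * (e₃ - e₂) / (x - e₃) = -((e₃ - e₁) * (e₃ - e₂) / (e₃ - x)) := by
      rw [← neg_sub e₃ x, div_neg]
    rw [hsymm]
    constructor
    · rintro ⟨h1, h2⟩
      have : e₃ - e₁ < (e₃ - e₁) * (e₃ - e₂) / (e₃ - x) := by
        rw [lt_div_iff₀ (by linarith)]; nlinarith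
      linarith
    · intro h
      have h1 : 0 < (e₃ - e₁) * (e₃ - e₂) / (e₃ - x) := by linarith
      have h2 : 0 < e₃ - x := by
        by_contra h2
        exact absurd h1 (not_lt.2 (div_nonpos_of_nonneg_of_nonpos
          (mul_nonneg (by linarith) (by linarith)) (not_lt.1 h2)))
      have h3 : e₃ - e₁ < (e₃ - e₁) * (e₃ - e₂) / (e₃ - x) := by linarith
      rw [lt_div_iff₀ h2] at h3
      exact ⟨by nlinarith, by linarith⟩
  have hgf : (fun x => (x - e₁) * (x - e₂) * (x - e₃)) = g := by ext x; rw [hg]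
  have d1 : Disjoint (Ioo e₁ e₂) (Ioi e₃) := by
    rw [Set.disjoint_left]; rintro x ⟨-, h1⟩ h2; rw [mem_Ioi] at h2; linarith
  have d2 : Disjoint (Iio e₁) (Ioo e₂ e₃) := by
    rw [Set.disjoint_left]; rintro x h1 ⟨h2, -⟩; rw [mem_Iio] at h1; linarith
  have s1 : realIntegral g {x | 0 < g x} = 2 * realIntegral g (Ioi e₃) := by
    rw [hpos, two_mul]
    conv_rhs => enter [1]; rw [← hegg]
    exact lintegral_union measurableSet_Ioi d1
  have s2 : realIntegral g {x | g x < 0} = 2 * realIntegral g (Iio e₁) := by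
    rw [hneg, two_mul]
    conv_rhs => enter [2]; rw [← hgap]
    exact lintegral_union measurableSet_Ioo d2
  rw [s1, s2, complexIntegral_eq_two_mul h₁₂ h₂₃, hgf]
  ring

end ThreeRealRoots

/-! ### Cubics with one real root -/

section OneRealRoot

variable {e α β : ℝ}

lemma det_complex_smul_one (c : ℂ) : (c • (1 : ℂ →L[ℝ] ℂ)).det = ‖c‖ ^ 2 := by
  rw [← Complex.normSq_eq_norm_sq, ← Algebra.norm_complex_apply, Algebra.norm_apply,
    ContinuousLinearMap.det]
  congr 1

/-- The 2-isogeny `x ↦ (x - e) + β / (x - e)` with kernel generated by the point of order two with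
abscissa `e` sends the curve `y² = (x - e)((x - e)² + α(x - e) + β)` to
`y² = (w + 2√β)(w + α)(w - 2√β)`. -/
lemma realIntegral_image_isogeny (hβ : 0 < β) {S : Set ℝ} (hS : MeasurableSet S)
    (hS' : ∀ x ∈ S, β < (x - e) ^ 2) :
    realIntegral (fun w => (w - -(2 * √β)) * (w - -α) * (w - 2 * √β))
      ((fun x => (x - e) + β / (x - e)) '' S) =
    realIntegral (fun x => (x - e) * ((x - e) ^ 2 + α * (x - e) + β)) S := by
  have hne : ∀ x ∈ S, x - e ≠ 0 := fun x hx h => by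
    have := hS' x hx; rw [h] at this; norm_num at this; linarith
  have hinj : InjOn (fun x => (x - e) + β / (x - e)) S := by
    intro x hx y hy h
    have hx0 := hne x hx
    have hy0 := hne y hy
    simp only at h
    by_contra hxy
    have h1 : (x - e) * (y - e) = β := by
      field_simp at h
      have : (x - y) * ((x - e) * (y - e) - β) = 0 := by linear_combination h
      have := (mul_eq_zero.1 this).resolve_left (sub_ne_zero.2 hxy)
      linarith
    have := mul_lt_mul'' (hS' x hx) (hS' y hy) hβ.le hβ.le
    rw [← mul_pow, h1] at this
    linarith
  rw [realIntegral, lintegral_image_eq_lintegral_abs_deriv_mul hS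
      (f' := fun x => 1 - β / (x - e) ^ 2) (fun x hx => ?_) hinj, realIntegral]
  · refine setLIntegral_congr_fun hS fun x hx => ?_
    have h0 := hne x hx
    have hpos : 0 < 1 - β / (x - e) ^ 2 := by
      rw [sub_pos, div_lt_one (by positivity)]
      exact hS' x hx
    have e2 : (x - e + β / (x - e) - -(2 * √β)) * (x - e + β / (x - e) - -α) *
        (x - e + β / (x - e) - 2 * √β) =
        (1 - β / (x - e) ^ 2) ^ 2 * ((x - e) * ((x - e) ^ 2 + α * (x - e) + β)) := by
      have : (x - e + β / (x - e) - -(2 * √β)) * (x - e + β / (x - e) - 2 * √β) =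
          (x - e - β / (x - e)) ^ 2 := by
        have h4 := sq_sqrt hβ.le
        have h5 : (x - e) * (β / (x - e)) = β := by field_simp
        linear_combination -4 * h4 + 4 * h5
      calc _ = (x - e + β / (x - e) - -(2 * √β)) * (x - e + β / (x - e) - 2 * √β) *
            (x - e + β / (x - e) - -α) := by ring
        _ = _ := by rw [this]; field_simp; ring
    rw [e2, abs_mul, abs_of_pos (pow_pos hpos 2), sqrt_mul (by positivity),
      sqrt_sq hpos.le, ← ENNReal.ofReal_mul (abs_nonneg _), abs_of_pos hpos,
      mul_inv, ← mul_assoc, mul_inv_cancel₀ hpos.ne', one_mul]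
  · have h0 := hne x hx
    have hid := (hasDerivAt_id' x).sub_const e
    have h1 := hid.fun_add ((hasDerivAt_const x β).fun_div hid h0)
    exact (h1.congr_deriv (by ring)).hasDerivWithinAt

lemma image_isogeny_Ioi (hβ : 0 < β) :
    (fun x => (x - e) + β / (x - e)) '' Ioi (e + √β) = Ioi (2 * √β) := by
  have hs := sqrt_pos.2 hβ
  have hs2 := sq_sqrt hβ.le
  ext w
  simp only [mem_image, mem_Ioi]
  constructor
  · rintro ⟨x, hx, rfl⟩
    have ht : 0 < x - e := by linarith
    have h1 : x - e + β / (x - e) - 2 * √β = (x - e - √β) ^ 2 / (x - e) := by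
      field_simp; linear_combination -hs2
    have h2 : 0 < (x - e - √β) ^ 2 / (x - e) := by
      have : x - e - √β ≠ 0 := by intro h; linarith
      positivity
    linarith
  · intro hw
    have hd : 0 < w ^ 2 - 4 * β := by nlinarith
    have hr := sq_sqrt hd.le
    have hr0 := sqrt_pos.2 hd
    have ht : √β < (w + √(w ^ 2 - 4 * β)) / 2 := by linarith
    have heq : ((w + √(w ^ 2 - 4 * β)) / 2) ^ 2 - w * ((w + √(w ^ 2 - 4 * β)) / 2) + β = 0 := by
      linear_combination hr / 4
    generalize (w + √(w ^ 2 - 4 * β)) / 2 = t at ht heq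
    have ht0 : t ≠ 0 := (hs.trans ht).ne'
    refine ⟨e + t, by linarith, ?_⟩
    rw [add_sub_cancel_left]
    field_simp
    linear_combination heq

lemma image_isogeny_Iio (hβ : 0 < β) :
    (fun x => (x - e) + β / (x - e)) '' Iio (e - √β) = Iio (-(2 * √β)) := by
  have h := image_isogeny_Ioi (e := -e) hβ
  ext w
  have hw : w ∈ Iio (-(2 * √β)) ↔ -w ∈ Ioi (2 * √β) := by
    simp only [mem_Iio, mem_Ioi]; constructor <;> intro h <;> linarith
  rw [hw, ← h]
  simp only [mem_image, mem_Iio, mem_Ioi]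
  constructor
  · rintro ⟨x, hx, rfl⟩
    refine ⟨-x, by linarith, ?_⟩
    rw [show -x - -e = -(x - e) by ring, div_neg]; ring
  · rintro ⟨x, hx, hxw⟩
    refine ⟨-x, by linarith, ?_⟩
    rw [show -x - e = -(x - -e) by ring, div_neg]; linarith

/-- The translation `x ↦ e + β / (x - e)` exchanges the two halves of the branch, on each of which
the isogeny is injective. -/
lemma realIntegral_Ioi_eq (hβ : 0 < β) :
    realIntegral (fun x => (x - e) * ((x - e) ^ 2 + α * (x - e) + β)) (Ioi e) =
      2 * realIntegral (fun w => (w - -(2 * √β)) * (w - -α) * (w - 2 * √β)) (Ioi (2 * √β)) := by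
  have hs := sqrt_pos.2 hβ
  have hs2 := sq_sqrt hβ.le
  rw [← image_isogeny_Ioi (e := e) hβ, realIntegral_image_isogeny hβ measurableSet_Ioi
    (fun x hx => by rw [mem_Ioi] at hx; nlinarith)]
  have h1 := realIntegral_preimage_translation (e := e) (α := α) hβ (S := Ioi (e + √β))
    measurableSet_Ioi (by simp only [mem_Ioi]; linarith)
  have h2 : (fun x => e + β / (x - e)) ⁻¹' Ioi (e + √β) = Ioo e (e + √β) := by
    ext x
    simp only [mem_preimage, mem_Ioi, mem_Ioo, add_lt_add_iff_left]
    constructor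
    · intro h
      have h3 : 0 < x - e := by
        by_contra h3
        exact absurd (hs.trans h) (not_lt.2 (div_nonpos_of_nonneg_of_nonpos hβ.le (not_lt.1 h3)))
      rw [lt_div_iff₀ h3] at h
      exact ⟨by linarith, by nlinarith⟩
    · rintro ⟨h3, h4⟩
      rw [lt_div_iff₀ (by linarith)]
      nlinarith
  rw [h2] at h1
  have h3 : Ioi e = Ioc e (e + √β) ∪ Ioi (e + √β) := (Ioc_union_Ioi_eq_Ioi (by linarith)).symm
  rw [two_mul]
  conv_rhs => enter [1]; rw [← h1]
  rw [h3, realIntegral, lintegral_union measurableSet_Ioi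
    (by rw [Set.disjoint_left]; rintro x ⟨-, h4⟩ h5; rw [mem_Ioi] at h5; linarith)]
  congr 1
  exact setLIntegral_congr Ioo_ae_eq_Ioc.symm

lemma realIntegral_Iio_eq (hβ : 0 < β) :
    realIntegral (fun x => (x - e) * ((x - e) ^ 2 + α * (x - e) + β)) (Iio e) =
      2 * realIntegral (fun w => (w - -(2 * √β)) * (w - -α) * (w - 2 * √β)) (Iio (-(2 * √β))) := by
  have hs := sqrt_pos.2 hβ
  have hs2 := sq_sqrt hβ.le
  rw [← image_isogeny_Iio (e := e) hβ, realIntegral_image_isogeny hβ measurableSet_Iio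
    (fun x hx => by rw [mem_Iio] at hx; nlinarith)]
  have h1 := realIntegral_preimage_translation (e := e) (α := α) hβ (S := Iio (e - √β))
    measurableSet_Iio (by simp only [mem_Iio]; linarith)
  have h2 : (fun x => e + β / (x - e)) ⁻¹' Iio (e - √β) = Ioo (e - √β) e := by
    ext x
    have hsymm : β / (x - e) = -(β / (e - x)) := by rw [← neg_sub e x, div_neg]
    simp only [mem_preimage, mem_Iio, mem_Ioo, hsymm]
    constructor
    · intro h
      have h3 : 0 < e - x := by
        by_contra h3
        have := div_nonpos_of_nonneg_of_nonpos hβ.le (not_lt.1 h3)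
        linarith
      have h4 : √β < β / (e - x) := by linarith
      rw [lt_div_iff₀ h3] at h4
      exact ⟨by nlinarith, by linarith⟩
    · rintro ⟨h3, h4⟩
      have : √β < β / (e - x) := by
        rw [lt_div_iff₀ (by linarith)]
        nlinarith
      linarith
  rw [h2] at h1
  have h3 : Iio e = Iio (e - √β) ∪ Ico (e - √β) e := (Iio_union_Ico_eq_Iio (by linarith)).symm
  rw [two_mul]
  conv_rhs => enter [2]; rw [← h1]
  rw [h3, realIntegral, lintegral_union measurableSet_Ico
    (by rw [Set.disjoint_left]; rintro x h4 ⟨h5, -⟩; rw [mem_Iio] at h4; linarith)]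
  congr 1
  exact setLIntegral_congr Ioo_ae_eq_Ico.symm

/-- On a set `T` meeting almost every fibre `{e + s, e + t}`, `s t = β`, of the isogeny in one
point, the isogeny transforms the integral into that of the curve with three real roots. This applies
to each side of the circle `|z - e|² = β`. -/
lemma lintegral_isogeny (hβ : 0 < β) {T : Set ℂ} (hT : MeasurableSet T)
    (hT0 : ∀ z ∈ T, z - e ≠ 0) (hT1 : ∀ z ∈ T, ∀ w ∈ T, (z - e) * (w - e) ≠ β)
    (hT2 : ∀ s t : ℂ, s * t = β → ‖s‖ ≠ ‖t‖ → e + s ∈ T ∨ e + t ∈ T) :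
    ∫⁻ z in T, ENNReal.ofReal ‖(z - e) * ((z - e) ^ 2 + α * (z - e) + β)‖⁻¹ =
      complexIntegral
        (fun w => (w - (-(2 * √β) : ℝ)) * (w - (-α : ℝ)) * (w - (2 * √β : ℝ))) := by
  have hinj : InjOn (fun z : ℂ => (z - e) + β / (z - e)) T := by
    intro x hx y hy h
    have hx0 := hT0 x hx
    have hy0 := hT0 y hy
    simp only at h
    by_contra hxy
    field_simp at h
    have h1 : (x - y) * ((x - e) * (y - e) - β) = 0 := by linear_combination h
    exact hT1 x hx y hy (sub_eq_zero.1 ((mul_eq_zero.1 h1).resolve_left (sub_ne_zero.2 hxy)))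
  have himg : ((fun z : ℂ => (z - e) + β / (z - e)) '' T : Set ℂ) =ᵐ[volume] univ := by
    rw [ae_eq_univ]
    refine measure_mono_null ?_ volume_real_line
    intro w hw
    by_contra him
    simp only [mem_ofPred_eq] at him
    apply hw
    obtain ⟨δ, hδ⟩ := IsAlgClosed.exists_pow_nat_eq (w ^ 2 - 4 * β) two_pos
    have hst : (w + δ) / 2 * ((w - δ) / 2) = β := by linear_combination -hδ / 4
    have hβ0 : (β : ℂ) ≠ 0 := by exact_mod_cast hβ.ne'
    have hs0 : (w + δ) / 2 ≠ 0 := fun h => hβ0 (by rw [← hst, h, zero_mul])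
    have ht0 : (w - δ) / 2 ≠ 0 := fun h => hβ0 (by rw [← hst, h, mul_zero])
    -- roots of equal absolute value have product `β > 0` and thus are conjugate, so `w` is real
    have hn : ‖(w + δ) / 2‖ ≠ ‖(w - δ) / 2‖ := by
      intro hn
      apply him
      have h1 : ((w + δ) / 2) * (starRingEnd ℂ) ((w + δ) / 2) = β := by
        rw [Complex.mul_conj, Complex.normSq_eq_norm_sq, sq]
        nth_rw 2 [hn]
        rw [← norm_mul, hst, Complex.norm_real, norm_of_nonneg hβ.le]
      have h2 : (starRingEnd ℂ) ((w + δ) / 2) = (w - δ) / 2 :=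
        mul_left_cancel₀ hs0 (h1.trans hst.symm)
      have h3 : (starRingEnd ℂ) ((w - δ) / 2) = (w + δ) / 2 := by rw [← h2, Complex.conj_conj]
      rw [← Complex.conj_eq_iff_im]
      calc (starRingEnd ℂ) w = (starRingEnd ℂ) ((w + δ) / 2 + (w - δ) / 2) := by congr 1; ring
        _ = w := by rw [map_add, h2, h3]; ring
    rcases hT2 _ _ hst hn with h | h
    · refine ⟨_, h, ?_⟩
      simp only
      rw [add_sub_cancel_left, ← hst, mul_div_cancel_left₀ _ hs0]
      ring
    · refine ⟨_, h, ?_⟩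
      simp only
      rw [add_sub_cancel_left, ← hst, mul_div_cancel_right₀ _ ht0]
      ring
  rw [complexIntegral, ← setLIntegral_univ (fun w : ℂ => ENNReal.ofReal
      ‖(w - (-(2 * √β) : ℝ)) * (w - (-α : ℝ)) * (w - (2 * √β : ℝ))‖⁻¹), ← setLIntegral_congr himg,
    lintegral_image_eq_lintegral_abs_det_fderiv_mul volume hT
      (f' := fun z : ℂ => (1 - β / (z - e) ^ 2 : ℂ) • (1 : ℂ →L[ℝ] ℂ)) (fun z hz => ?_) hinj]
  · refine setLIntegral_congr_fun hT fun z hz => ?_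
    have h0 := hT0 z hz
    have e2 : (z - e + β / (z - e) - ((-(2 * √β) : ℝ) : ℂ)) * (z - e + β / (z - e) - (-α : ℝ)) *
        (z - e + β / (z - e) - (2 * √β : ℝ)) =
        (1 - β / (z - e) ^ 2) ^ 2 * ((z - e) * ((z - e) ^ 2 + α * (z - e) + β)) := by
      have : (z - e + β / (z - e) - ((-(2 * √β) : ℝ) : ℂ)) * (z - e + β / (z - e) - (2 * √β : ℝ)) =
          (z - e - β / (z - e)) ^ 2 := by
        have h4 : ((√β : ℝ) : ℂ) ^ 2 = β := by exact_mod_cast sq_sqrt hβ.le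
        have h5 : (z - e) * (β / (z - e)) = β := by field_simp
        push_cast
        linear_combination -4 * h4 + 4 * h5
      calc _ = (z - e + β / (z - e) - ((-(2 * √β) : ℝ) : ℂ)) *
            (z - e + β / (z - e) - (2 * √β : ℝ)) * (z - e + β / (z - e) - (-α : ℝ)) := by ring
        _ = _ := by rw [this]; push_cast; field_simp; ring
    have hne : (1 - β / (z - e) ^ 2 : ℂ) ≠ 0 := by
      intro h
      refine hT1 z hz z hz ?_
      have : (β : ℂ) / (z - e) ^ 2 = 1 := (sub_eq_zero.1 h).symm
      rw [div_eq_one_iff_eq (pow_ne_zero _ h0)] at this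
      rw [this]; ring
    have hnpos : 0 < ‖(1 - β / (z - e) ^ 2 : ℂ)‖ ^ 2 := by positivity
    rw [e2, det_complex_smul_one, norm_mul _ ((z - (e : ℂ)) * _), norm_pow,
      ← ENNReal.ofReal_mul (abs_nonneg _), abs_of_pos hnpos, mul_inv, ← mul_assoc,
      mul_inv_cancel₀ hnpos.ne', one_mul]
  · have h0 := hT0 z hz
    have hid := (hasDerivAt_id' z).sub_const (e : ℂ)
    have h1 := hid.fun_add ((hasDerivAt_const z (β : ℂ)).fun_div hid h0)
    exact ((h1.congr_deriv (by ring)).complexToReal_fderiv).hasFDerivWithinAt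

/-- For one real root, the product of the real integrals is the integral over the plane. -/
theorem realIntegral_mul_of_one_root (hαβ : α ^ 2 < 4 * β) {g : ℝ → ℝ}
    (hg : ∀ x, g x = (x - e) * ((x - e) ^ 2 + α * (x - e) + β)) :
    realIntegral g {x | 0 < g x} * realIntegral g {x | g x < 0} =
      complexIntegral (fun z => (z - e) * ((z - e) ^ 2 + α * (z - e) + β)) := by
  have hβ : 0 < β := by nlinarith [sq_nonneg α]
  have hs := sqrt_pos.2 hβ
  have hs2 := sq_sqrt hβ.le
  have hq : ∀ x, 0 < (x - e) ^ 2 + α * (x - e) + β := fun x => by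
    nlinarith [sq_nonneg (2 * (x - e) + α)]
  have hpos : {x | 0 < g x} = Ioi e := by
    ext x
    simp only [mem_ofPred_eq, mem_Ioi, hg, mul_pos_iff_of_pos_right (hq x), sub_pos]
  have hneg : {x | g x < 0} = Iio e := by
    ext x
    simp only [mem_ofPred_eq, mem_Iio, hg]
    rw [← neg_pos, ← neg_mul, mul_pos_iff_of_pos_right (hq x), neg_pos, sub_neg]
  obtain ⟨hα1, hα2⟩ : -(2 * √β) < α ∧ α < 2 * √β := by
    rw [← abs_lt]
    refine lt_of_pow_lt_pow_left₀ 2 (by positivity) ?_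
    rw [sq_abs]; nlinarith
  obtain rfl : g = fun x => (x - e) * ((x - e) ^ 2 + α * (x - e) + β) := funext hg
  rw [hpos, hneg, realIntegral_Ioi_eq hβ, realIntegral_Iio_eq hβ]
  have hnorm : ∀ z : ℂ, ‖z - e‖ = √β ↔ z ∈ Metric.sphere (e : ℂ) (√β) := fun z => by
    rw [mem_sphere_iff_norm]
  have hprod : ∀ s t : ℂ, s * t = β → ‖s‖ * ‖t‖ = √β * √β := by
    intro s t h
    rw [← norm_mul, h, Complex.norm_real, norm_of_nonneg hβ.le, mul_self_sqrt hβ.le]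
  have hout := lintegral_isogeny (e := e) (α := α) hβ (T := {z : ℂ | √β < ‖z - e‖})
    (measurableSet_lt measurable_const (by fun_prop))
    (fun z hz h => by simp only [mem_ofPred_eq, h, norm_zero] at hz; linarith)
    (fun z hz w hw h => by
      simp only [mem_ofPred_eq] at hz hw
      have := mul_lt_mul'' hz hw hs.le hs.le
      rw [hprod _ _ h] at this
      exact lt_irrefl _ this)
    (fun s t h hn => by
      simp only [mem_ofPred_eq, add_sub_cancel_left]
      by_contra hcon
      rw [not_or, not_lt, not_lt] at hcon
      have h1 := hprod s t h
      rcases lt_or_eq_of_le hcon.1 with h2 | h2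
      · nlinarith [norm_nonneg s, norm_nonneg t]
      · rw [h2] at h1
        exact hn (h2.trans (mul_left_cancel₀ hs.ne' h1).symm))
  have hin := lintegral_isogeny (e := e) (α := α) hβ (T := {z : ℂ | 0 < ‖z - e‖ ∧ ‖z - e‖ < √β})
    (by
      have h1 : MeasurableSet {z : ℂ | 0 < ‖z - e‖} :=
        measurableSet_lt measurable_const (by fun_prop)
      have h2 : MeasurableSet {z : ℂ | ‖z - e‖ < √β} :=
        measurableSet_lt (by fun_prop) measurable_const
      exact h1.inter h2)
    (fun z hz h => by simp only [mem_ofPred_eq, h, norm_zero] at hz; linarith [hz.1])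
    (fun z hz w hw h => by
      simp only [mem_ofPred_eq] at hz hw
      have := mul_lt_mul'' hz.2 hw.2 (norm_nonneg _) (norm_nonneg _)
      rw [hprod _ _ h] at this
      exact lt_irrefl _ this)
    (fun s t h hn => by
      simp only [mem_ofPred_eq, add_sub_cancel_left]
      have h1 := hprod s t h
      have hs0 : 0 < ‖s‖ := by
        rw [norm_pos_iff]; rintro rfl
        rw [norm_zero, zero_mul] at h1; nlinarith
      have ht0 : 0 < ‖t‖ := by
        rw [norm_pos_iff]; rintro rfl
        rw [norm_zero, mul_zero] at h1; nlinarith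
      by_contra hcon
      rw [not_or, not_and, not_and, not_lt, not_lt] at hcon
      have h3 := hcon.1 hs0
      have h4 := hcon.2 ht0
      rcases lt_or_eq_of_le h3 with h2 | h2
      · nlinarith
      · rw [← h2] at h1
        exact hn (h2.symm.trans (mul_left_cancel₀ hs.ne' h1).symm))
  have hcompl : ∫⁻ z in {z : ℂ | √β < ‖z - e‖}ᶜ,
        ENNReal.ofReal ‖(z - e) * ((z - e) ^ 2 + α * (z - e) + β)‖⁻¹ =
      ∫⁻ z in {z : ℂ | 0 < ‖z - e‖ ∧ ‖z - e‖ < √β},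
        ENNReal.ofReal ‖(z - e) * ((z - e) ^ 2 + α * (z - e) + β)‖⁻¹ := by
    refine setLIntegral_congr ?_
    rw [ae_eq_set]
    constructor
    · have hnull : volume ({(e : ℂ)} ∪ Metric.sphere (e : ℂ) (√β)) = 0 :=
        measure_union_null (measure_singleton _) (Measure.addHaar_sphere _ _ _)
      refine measure_mono_null ?_ hnull
      rintro z ⟨h1, h2⟩
      simp only [mem_compl_iff, mem_ofPred_eq, not_lt, not_and] at h1 h2
      rcases (norm_nonneg (z - e)).eq_or_lt with h3 | h3
      · left; exact sub_eq_zero.1 (norm_eq_zero.1 h3.symm)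
      · right; exact (hnorm z).1 (le_antisymm h1 (h2 h3))
    · rw [sdiff_eq_empty.2]
      · exact measure_empty
      · rintro z ⟨-, h⟩
        simp only [mem_compl_iff, mem_ofPred_eq, not_lt]
        exact h.le
  have htot : complexIntegral (fun z => (z - e) * ((z - e) ^ 2 + α * (z - e) + β)) =
      2 * complexIntegral
        (fun w => (w - (-(2 * √β) : ℝ)) * (w - (-α : ℝ)) * (w - (2 * √β : ℝ))) := by
    rw [two_mul]
    nth_rw 2 [← hout]
    rw [← hin, ← hcompl, add_comm, complexIntegral, lintegral_add_compl]
    exact measurableSet_lt measurable_const (by fun_prop)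
  rw [htot, complexIntegral_eq_two_mul (by linarith) (by linarith)]
  ring

end OneRealRoot

/-! ### Periods in terms of the cubic -/

/-- The cubic `x³ + (b₂/4)x² + (b₄/2)x + b₆/4`, equal to `(y + (a₁x + a₃)/2)²` at a point `(x, y)`
of the curve. -/
noncomputable def squareCubic {F : Type*} [Field F] (W : WeierstrassCurve F) (x : F) : F :=
  x ^ 3 + W.b₂ / 4 * x ^ 2 + W.b₄ / 2 * x + W.b₆ / 4

lemma equation_iff_squareCubic {F : Type*} [Field F] [CharZero F] (W : WeierstrassCurve F)
    (x y : F) :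
    W.toAffine.Equation x y ↔ (2 * y + W.a₁ * x + W.a₃) ^ 2 = 4 * W.squareCubic x := by
  rw [Affine.equation_iff, squareCubic, b₂, b₄, b₆]
  constructor <;> intro h
  · linear_combination 4 * h
  · have h4 : (4 : F) ≠ 0 := by norm_num
    refine mul_left_cancel₀ h4 ?_
    linear_combination h

lemma setOf_equation_eq_pair {F : Type*} [Field F] [CharZero F] (W : WeierstrassCurve F)
    {x r : F} (hr : r ^ 2 = W.squareCubic x) :
    {y : F | W.toAffine.Equation x y} =
      {r - (W.a₁ * x + W.a₃) / 2, -r - (W.a₁ * x + W.a₃) / 2} := by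
  ext y
  simp only [mem_ofPred_eq, mem_insert_iff, mem_singleton_iff, equation_iff_squareCubic, ← hr]
  have h2 : (2 : F) ≠ 0 := two_ne_zero
  constructor
  · intro h
    have : (2 * y + W.a₁ * x + W.a₃) ^ 2 = (2 * r) ^ 2 := by linear_combination h
    rcases sq_eq_sq_iff_eq_or_eq_neg.1 this with h | h
    · left; field_simp; linear_combination h
    · right; field_simp; linear_combination h
  · rintro (rfl | rfl) <;> field_simp <;> ring

lemma finsum_equation_real (W : WeierstrassCurve ℝ) (x : ℝ) :
    ∑ᶠ y ∈ {y : ℝ | W.toAffine.Equation x y}, |2 * y + W.a₁ * x + W.a₃|⁻¹ =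
      {x | 0 < W.squareCubic x}.indicator (fun x => (√|W.squareCubic x|)⁻¹) x := by
  by_cases hx : 0 < W.squareCubic x
  · rw [indicator_of_mem (by exact hx), setOf_equation_eq_pair W (sq_sqrt hx.le), abs_of_pos hx]
    have hr := sqrt_pos.2 hx
    rw [finsum_mem_pair (by intro h; linarith)]
    rw [show 2 * (√(W.squareCubic x) - (W.a₁ * x + W.a₃) / 2) + W.a₁ * x + W.a₃ =
        2 * √(W.squareCubic x) by ring,
      show 2 * (-√(W.squareCubic x) - (W.a₁ * x + W.a₃) / 2) + W.a₁ * x + W.a₃ =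
        -(2 * √(W.squareCubic x)) by ring, abs_neg, abs_of_pos (by positivity)]
    field_simp
    norm_num
  · rw [indicator_of_notMem (by exact hx)]
    refine finsum_mem_eq_zero_of_forall_eq_zero fun y hy => ?_
    rw [mem_ofPred_eq, equation_iff_squareCubic] at hy
    have : 2 * y + W.a₁ * x + W.a₃ = 0 := by
      rw [← sq_eq_zero_iff]
      exact le_antisymm (by linarith [not_lt.1 hx]) (sq_nonneg _)
    rw [this, abs_zero, inv_zero]

lemma finsum_equation_complex (W : WeierstrassCurve ℂ) (x : ℂ) :
    ∑ᶠ y ∈ {y : ℂ | W.toAffine.Equation x y}, (‖2 * y + W.a₁ * x + W.a₃‖ ^ 2)⁻¹ =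
      ‖W.squareCubic x‖⁻¹ / 2 := by
  obtain ⟨r, hr⟩ := IsAlgClosed.exists_pow_nat_eq (W.squareCubic x) two_pos
  rw [setOf_equation_eq_pair W hr]
  have e1 : 2 * (r - (W.a₁ * x + W.a₃) / 2) + W.a₁ * x + W.a₃ = 2 * r := by ring
  have e2 : 2 * (-r - (W.a₁ * x + W.a₃) / 2) + W.a₁ * x + W.a₃ = -(2 * r) := by ring
  rcases eq_or_ne r 0 with rfl | h0
  · rw [neg_zero, Set.pair_eq_singleton, finsum_mem_singleton, e1, ← hr]
    norm_num
  · rw [finsum_mem_pair, e1, e2, norm_neg, ← hr, norm_mul, norm_pow]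
    · have : 0 < ‖r‖ := norm_pos_iff.2 h0
      rw [Complex.norm_ofNat]
      field_simp
      norm_num
    · intro h
      apply h0
      linear_combination h / 2

lemma continuous_squareCubic {F : Type*} [NormedField F] (W : WeierstrassCurve F) :
    Continuous W.squareCubic := by
  unfold squareCubic; fun_prop

lemma realPeriod_eq (W : WeierstrassCurve ℝ) :
    W.realPeriod = (realIntegral W.squareCubic {x | 0 < W.squareCubic x}).toReal := by
  have hc := W.continuous_squareCubic
  have hm : MeasurableSet {x | 0 < W.squareCubic x} :=
    measurableSet_lt measurable_const hc.measurable
  rw [realPeriod]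
  simp only [finsum_equation_real]
  rw [integral_indicator hm, realIntegral, integral_eq_lintegral_of_nonneg_ae]
  · exact Filter.Eventually.of_forall fun x => by positivity
  · exact Measurable.aestronglyMeasurable (by fun_prop)

lemma periodNormSq_eq (W : WeierstrassCurve ℂ) :
    W.periodNormSq = (complexIntegral W.squareCubic).toReal := by
  have hc := W.continuous_squareCubic
  rw [periodNormSq]
  simp only [finsum_equation_complex]
  rw [integral_div, mul_div_cancel₀ _ two_ne_zero, complexIntegral,
    integral_eq_lintegral_of_nonneg_ae]
  · exact Filter.Eventually.of_forall fun x => by positivity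
  · exact Measurable.aestronglyMeasurable (by fun_prop)

/-! ### Real roots of the cubic -/

/-- A real monic cubic of nonzero discriminant has three real roots or exactly one. -/
lemma exists_roots_or_exists_root (A B C : ℝ)
    (h : A ^ 2 * B ^ 2 - 4 * B ^ 3 - 4 * A ^ 3 * C - 27 * C ^ 2 + 18 * A * B * C ≠ 0) :
    (∃ e₁ e₂ e₃ : ℝ, e₁ < e₂ ∧ e₂ < e₃ ∧ A = -(e₁ + e₂ + e₃) ∧
      B = e₁ * e₂ + e₁ * e₃ + e₂ * e₃ ∧ C = -(e₁ * e₂ * e₃)) ∨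
    ∃ e α β : ℝ, α ^ 2 < 4 * β ∧ A = α - 3 * e ∧ B = 3 * e ^ 2 - 2 * α * e + β ∧
      C = -e ^ 3 + α * e ^ 2 - β * e := by
  obtain ⟨e, he⟩ : ∃ e : ℝ, e ^ 3 + A * e ^ 2 + B * e + C = 0 := by
    have hcont : Continuous fun x : ℝ => x ^ 3 + A * x ^ 2 + B * x + C := by fun_prop
    -- the cubic is nonpositive at `-M` and nonnegative at `M`
    set M := 1 + |A| + |B| + |C|
    have hM : 1 ≤ M := by have := abs_nonneg A; have := abs_nonneg B; have := abs_nonneg C; grind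
    have hA := abs_le.1 (le_refl |A|)
    have hB := abs_le.1 (le_refl |B|)
    have hC := abs_le.1 (le_refl |C|)
    have hM2 : M ≤ M ^ 2 := by nlinarith
    have hM1 : 1 ≤ M ^ 2 := hM.trans hM2
    have hkey : |A| * M ^ 2 + |B| * M + |C| ≤ M ^ 3 := by
      have : M ^ 3 = (1 + |A| + |B| + |C|) * M ^ 2 := by ring
      have h1 := mul_le_mul_of_nonneg_left hM2 (abs_nonneg B)
      have h2 := mul_le_mul_of_nonneg_left hM1 (abs_nonneg C)
      nlinarith
    have hA1 := mul_le_mul_of_nonneg_right hA.1 (sq_nonneg M)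
    have hA2 := mul_le_mul_of_nonneg_right hA.2 (sq_nonneg M)
    have hB1 := mul_le_mul_of_nonneg_right hB.1 (by linarith : 0 ≤ M)
    have hB2 := mul_le_mul_of_nonneg_right hB.2 (by linarith : 0 ≤ M)
    have hmem : (0 : ℝ) ∈ Icc ((-M) ^ 3 + A * (-M) ^ 2 + B * (-M) + C)
        (M ^ 3 + A * M ^ 2 + B * M + C) := by
      constructor
      · nlinarith
      · nlinarith
    obtain ⟨e, -, he⟩ := intermediate_value_Icc (by linarith : -M ≤ M) hcont.continuousOn hmem
    exact ⟨e, he⟩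
  obtain ⟨α, hα⟩ : ∃ α, α = A + 3 * e := ⟨_, rfl⟩
  obtain ⟨β, hβ⟩ : ∃ β, β = B - 3 * e ^ 2 + 2 * α * e := ⟨_, rfl⟩
  obtain rfl : A = α - 3 * e := by linarith
  obtain rfl : B = 3 * e ^ 2 - 2 * α * e + β := by linarith
  obtain rfl : C = -e ^ 3 + α * e ^ 2 - β * e := by linear_combination he
  rcases lt_or_ge (α ^ 2) (4 * β) with hlt | hge
  · exact Or.inr ⟨e, α, β, hlt, rfl, rfl, rfl⟩
  left
  have hfac : (α ^ 2 - 4 * β) * β ^ 2 ≠ 0 := by convert h using 1; ring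
  have hβ0 : β ≠ 0 := fun h0 => hfac (by rw [h0]; ring)
  have hpos : 0 < α ^ 2 - 4 * β :=
    lt_of_le_of_ne (by linarith) (left_ne_zero_of_mul hfac).symm
  have hs := sqrt_pos.2 hpos
  have hs2 := sq_sqrt hpos.le
  -- the roots of the quadratic factor are `e + p < e + q`, both different from `e`
  obtain ⟨p, hp⟩ : ∃ p, p = (-α - √(α ^ 2 - 4 * β)) / 2 := ⟨_, rfl⟩
  obtain ⟨q, hq⟩ : ∃ q, q = (-α + √(α ^ 2 - 4 * β)) / 2 := ⟨_, rfl⟩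
  have hpq : p < q := by linarith
  have hsum : α = -(p + q) := by linarith
  have hprod : β = p * q := by rw [hp, hq]; linear_combination hs2 / 4
  have hp0 : p ≠ 0 := by rintro h0; exact hβ0 (by rw [hprod, h0, zero_mul])
  have hq0 : q ≠ 0 := by rintro h0; exact hβ0 (by rw [hprod, h0, mul_zero])
  clear hp hq hs hs2
  subst hsum hprod
  rcases lt_or_gt_of_ne hq0 with hq | hq
  · exact ⟨e + p, e + q, e, by linarith, by linarith, by ring, by ring, by ring⟩
  rcases lt_or_gt_of_ne hp0 with hp | hp
  · exact ⟨e + p, e, e + q, by linarith, by linarith, by ring, by ring, by ring⟩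
  · exact ⟨e, e + p, e + q, by linarith, by linarith, by ring, by ring, by ring⟩

/-- The factorization of the cubic of a real elliptic curve, over the real and the complex
numbers. -/
lemma squareCubic_cases (W : WeierstrassCurve ℝ) (hΔ : W.Δ ≠ 0) :
    (∃ e₁ e₂ e₃ : ℝ, e₁ < e₂ ∧ e₂ < e₃ ∧
      (∀ x, W.squareCubic x = (x - e₁) * (x - e₂) * (x - e₃)) ∧
      ∀ z, (W.map Complex.ofRealHom).squareCubic z = (z - e₁) * (z - e₂) * (z - e₃)) ∨
    ∃ e α β : ℝ, α ^ 2 < 4 * β ∧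
      (∀ x, W.squareCubic x = (x - e) * ((x - e) ^ 2 + α * (x - e) + β)) ∧
      ∀ z, (W.map Complex.ofRealHom).squareCubic z =
        (z - e) * ((z - e) ^ 2 + α * (z - e) + β) := by
  have hC : ∀ z, (W.map Complex.ofRealHom).squareCubic z =
      z ^ 3 + ((W.b₂ / 4 : ℝ) : ℂ) * z ^ 2 + ((W.b₄ / 2 : ℝ) : ℂ) * z + ((W.b₆ / 4 : ℝ) : ℂ) := by
    intro z
    rw [squareCubic, map_b₂, map_b₄, map_b₆]
    simp only [Complex.ofRealHom_eq_coe]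
    push_cast
    rfl
  rcases exists_roots_or_exists_root (W.b₂ / 4) (W.b₄ / 2) (W.b₆ / 4) (by
    intro h
    apply hΔ
    rw [Δ]
    linear_combination 16 * h - W.b₂ ^ 2 / 4 * W.b_relation) with
    ⟨e₁, e₂, e₃, h₁, h₂, hA, hB, hC'⟩ | ⟨e, α, β, h, hA, hB, hC'⟩
  · refine Or.inl ⟨e₁, e₂, e₃, h₁, h₂, fun x => ?_, fun z => ?_⟩
    · rw [squareCubic, hA, hB, hC']; ring
    · rw [hC, hA, hB, hC']; push_cast; ring
  · refine Or.inr ⟨e, α, β, h, fun x => ?_, fun z => ?_⟩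
    · rw [squareCubic, hA, hB, hC']; ring
    · rw [hC, hA, hB, hC']; push_cast; ring

/-! ### The effect of a twist -/

/-- A negative scaling factor exchanges the sets where the cubic is positive and negative. -/
lemma realIntegral_comp_affine {g g' : ℝ → ℝ} {κ τ : ℝ} (hκ : κ < 0) (hg : Continuous g)
    (h : ∀ x, g (κ * x + τ) = κ ^ 3 * g' x) :
    (realIntegral g' {x | 0 < g' x}).toReal =
      √|κ| * (realIntegral g {x | g x < 0}).toReal := by
  have hg' : ∀ x, g' x = g (κ * x + τ) / κ ^ 3 := fun x => by
    rw [h, mul_div_cancel_left₀ _ (pow_ne_zero 3 hκ.ne)]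
  have hκ3 : κ ^ 3 < 0 := Odd.pow_neg (by decide) hκ
  have himg : {x | g x < 0} = (fun x => κ * x + τ) '' {x | 0 < g' x} := by
    ext x
    simp only [mem_ofPred_eq, mem_image]
    constructor
    · intro hx
      have hx' : κ * ((x - τ) / κ) + τ = x := by
        rw [mul_div_cancel₀ _ hκ.ne]; ring
      refine ⟨(x - τ) / κ, ?_, hx'⟩
      rw [hg', hx']
      exact div_pos_of_neg_of_neg hx hκ3
    · rintro ⟨t, ht, rfl⟩
      rw [h]
      exact mul_neg_of_neg_of_pos hκ3 ht
  have hcont : Continuous g' := by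
    rw [funext hg']
    fun_prop
  have hm : MeasurableSet {x | 0 < g' x} := measurableSet_lt measurable_const hcont.measurable
  have hk0 : 0 < √|κ| := sqrt_pos.2 (abs_pos.2 hκ.ne)
  have key : realIntegral g {x | g x < 0} =
      ENNReal.ofReal (√|κ|)⁻¹ * realIntegral g' {x | 0 < g' x} := by
    rw [himg, realIntegral, lintegral_image_eq_lintegral_abs_deriv_mul hm
      (f' := fun _ => κ) (fun x _ => ?_) (fun x _ y _ hxy => ?_), realIntegral,
      ← lintegral_const_mul]
    · refine lintegral_congr fun x => ?_
      rw [← ENNReal.ofReal_mul (abs_nonneg _), ← ENNReal.ofReal_mul (by positivity)]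
      congr 1
      have e1 : √|g (κ * x + τ)| = |κ| * √|κ| * √|g' x| := by
        rw [h, abs_mul, sqrt_mul (abs_nonneg _), abs_pow, pow_succ, sqrt_mul (by positivity),
          sqrt_sq (abs_nonneg _)]
      rw [e1, mul_inv, mul_inv, mul_assoc, mul_inv_cancel_left₀ (abs_pos.2 hκ.ne).ne']
    · exact ENNReal.measurable_ofReal.comp (by fun_prop)
    · exact ((((hasDerivAt_id' x).const_mul κ).add_const τ).congr_deriv
        (mul_one κ)).hasDerivWithinAt
    · simp only [add_left_inj] at hxy
      exact mul_left_cancel₀ hκ.ne hxy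
  rw [key, ENNReal.toReal_mul, ENNReal.toReal_ofReal (by positivity), mul_inv_cancel_left₀ hk0.ne']

/-- The cubic of a model of the twist is that of the curve after an affine change of variable. -/
lemma squareCubic_quadraticTwist {F : Type*} [Field F] [CharZero F] {W W' : WeierstrassCurve ℚ}
    {d : ℚ} (hd : d ≠ 0) {C : VariableChange ℚ} (h : C • W.quadraticTwist d = W')
    (φ : ℚ →+* F) (x : F) :
    (W.map φ).squareCubic (φ (C.u ^ 2 / d) * x + φ (C.r / d)) =
      φ (C.u ^ 2 / d) ^ 3 * (W'.map φ).squareCubic x := by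
  subst h
  have hu : φ (C.u : ℚ) ≠ 0 := by simp
  have hd' : φ d ≠ 0 := by simpa using hd
  have e₂ : (W.quadraticTwist d).b₂ = d * W.b₂ := by
    simp only [quadraticTwist, b₂]; ring
  have e₄ : (W.quadraticTwist d).b₄ = d ^ 2 * W.b₄ := by
    simp only [quadraticTwist, b₄]; ring
  have e₆ : (W.quadraticTwist d).b₆ = d ^ 3 * W.b₆ := by
    simp only [quadraticTwist, b₆]; ring
  simp only [squareCubic, map_b₂, map_b₄, map_b₆, variableChange_b₂, variableChange_b₄,
    variableChange_b₆, e₂, e₄, e₆]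
  simp only [map_add, map_mul, map_div₀, map_pow, map_ofNat, Units.val_inv_eq_inv_val,
    map_inv₀]
  field_simp
  ring

lemma c₄_quadraticTwist (W : WeierstrassCurve ℚ) (d : ℚ) :
    (W.quadraticTwist d).c₄ = d ^ 2 * W.c₄ := by
  simp only [quadraticTwist, c₄, b₂, b₄]; ring

lemma c₆_quadraticTwist (W : WeierstrassCurve ℚ) (d : ℚ) :
    (W.quadraticTwist d).c₆ = d ^ 3 * W.c₆ := by
  simp only [quadraticTwist, c₆, b₂, b₄, b₆]; ring

/-! ### The identity component -/

section Components

open Topology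

/-- For `ε = ±1`, the point above `x` with `Y = ε √(g x)` in the equation `Y² = g x`. It lies on the
real locus only for `g x ≥ 0`. -/
noncomputable def realBranch (W : WeierstrassCurve ℝ) (ε x : ℝ) : ℝ × ℝ :=
  (x, ε * √(W.squareCubic x) - (W.a₁ * x + W.a₃) / 2)

lemma continuous_realBranch (W : WeierstrassCurve ℝ) (ε : ℝ) : Continuous (W.realBranch ε) := by
  have := W.continuous_squareCubic
  unfold realBranch
  fun_prop

lemma equation_iff_realBranch (W : WeierstrassCurve ℝ) {x y : ℝ} (hx : 0 ≤ W.squareCubic x) :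
    W.toAffine.Equation x y ↔ (x, y) = W.realBranch 1 x ∨ (x, y) = W.realBranch (-1) x := by
  have h := W.setOf_equation_eq_pair (sq_sqrt hx)
  rw [Set.ext_iff] at h
  rw [← mem_ofPred_eq (p := fun y => W.toAffine.Equation x y), h]
  simp [realBranch]

/-- The points of the real locus with abscissa at least `e`, together with the origin. -/
def upperPart (W : WeierstrassCurve ℝ) (e : ℝ) : Set W.toAffine.Point :=
  {P | ∀ x y h, P = .some x y h → e ≤ x}

lemma squareCubic_nonneg_of_equation {W : WeierstrassCurve ℝ} {x y : ℝ}
    (h : W.toAffine.Equation x y) : 0 ≤ W.squareCubic x := by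
  rw [equation_iff_squareCubic] at h
  nlinarith [sq_nonneg (2 * y + W.a₁ * x + W.a₃)]

lemma image_pointToOnePoint (W : WeierstrassCurve ℝ) [W.IsElliptic] (A : Set ℝ)
    (hA : ∀ x ∈ A, 0 ≤ W.squareCubic x) :
    W.pointToOnePoint '' {P | ∃ x y h, P = .some x y h ∧ x ∈ A} =
      (↑) '' (W.realBranch 1 '' A ∪ W.realBranch (-1) '' A) := by
  ext z
  constructor
  · rintro ⟨P, ⟨x, y, h, rfl, hx⟩, rfl⟩
    refine ⟨(x, y), ?_, rfl⟩
    rcases (W.equation_iff_realBranch (hA x hx)).1 h.1 with h | h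
    · exact Or.inl ⟨x, hx, h.symm⟩
    · exact Or.inr ⟨x, hx, h.symm⟩
  · have key : ∀ ε : ℝ, ε = 1 ∨ ε = -1 → ∀ x ∈ A, ∃ P : W.toAffine.Point,
        (∃ x y h, P = .some x y h ∧ x ∈ A) ∧ W.pointToOnePoint P = W.realBranch ε x := by
      intro ε hε x hx
      have h : W.toAffine.Equation x (W.realBranch ε x).2 := by
        rw [W.equation_iff_realBranch (hA x hx)]
        rcases hε with rfl | rfl
        · exact Or.inl rfl
        · exact Or.inr rfl
      exact ⟨.some x _ ((Affine.equation_iff_nonsingular).1 h), ⟨x, _, _, rfl, hx⟩, rfl⟩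
    rintro ⟨_, ⟨x, hx, rfl⟩ | ⟨x, hx, rfl⟩, rfl⟩
    · exact key 1 (Or.inl rfl) x hx
    · exact key (-1) (Or.inr rfl) x hx

lemma upperPart_eq (W : WeierstrassCurve ℝ) (e : ℝ) :
    W.upperPart e = insert 0 {P | ∃ x y h, P = .some x y h ∧ x ∈ Ici e} := by
  ext P
  rcases P with _ | ⟨x, y, h⟩
  · simp [upperPart, ← Affine.Point.zero_def]
  · simp only [upperPart, mem_ofPred_eq, mem_insert_iff, Affine.Point.some_ne_zero, false_or,
      Affine.Point.some.injEq, mem_Ici]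
    exact ⟨fun h' => ⟨x, y, h, ⟨rfl, rfl⟩, h' x y h ⟨rfl, rfl⟩⟩,
      by rintro ⟨_, _, _, ⟨rfl, rfl⟩, h'⟩ _ _ _ ⟨rfl, rfl⟩; exact h'⟩

/-- The unbounded branch of the real locus, closed up by the origin, is connected. -/
lemma isPreconnected_upperPart (W : WeierstrassCurve ℝ) [W.IsElliptic] {e : ℝ}
    (he : W.squareCubic e = 0) (hpos : ∀ x, e ≤ x → 0 ≤ W.squareCubic x) :
    @IsPreconnected _ W.realPointTopology (W.upperPart e) := by
  let := W.realPointTopology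
  have hind : IsInducing W.pointToOnePoint := ⟨rfl⟩
  rw [← hind.isPreconnected_image, upperPart_eq, image_insert_eq,
    W.image_pointToOnePoint (Ici e) hpos]
  have hbr : ∀ ε, IsPreconnected (W.realBranch ε '' Ici e) := fun ε =>
    isPreconnected_Ici.image _ (W.continuous_realBranch ε).continuousOn
  have hmem : ∀ ε, W.realBranch 1 e = W.realBranch ε e := by
    intro ε; simp [realBranch, he]
  have hpre := (IsPreconnected.union (s := W.realBranch 1 '' Ici e)
    (t := W.realBranch (-1) '' Ici e) (W.realBranch 1 e) ⟨e, self_mem_Ici, rfl⟩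
    ⟨e, self_mem_Ici, (hmem (-1)).symm⟩ (hbr 1) (hbr (-1))).image _
      (OnePoint.continuous_coe (X := ℝ × ℝ)).continuousOn
  -- the origin lies in the closure of the two branches
  refine hpre.subset_closure (subset_insert _ _) (insert_subset ?_ subset_closure)
  have htend : Filter.Tendsto (W.realBranch 1) Filter.atTop (Filter.coclosedCompact (ℝ × ℝ)) := by
    rw [Filter.coclosedCompact_eq_cocompact, ← Metric.cobounded_eq_cocompact,
      ← tendsto_norm_atTop_iff_cobounded]
    refine Filter.tendsto_atTop_mono (fun x => ?_) Filter.tendsto_id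
    exact (le_abs_self x).trans (norm_fst_le (W.realBranch 1 x))
  refine mem_closure_of_tendsto (OnePoint.tendsto_coe_infty.comp htend) ?_
  filter_upwards [Filter.eventually_ge_atTop e] with x hx
  exact ⟨_, Or.inl ⟨x, hx, rfl⟩, rfl⟩

/-- If the remaining real points lie over a compact interval to the left of `e`, they form a compact
set in the plane, so that their complement is open also at the origin. The interval may be
empty. -/
lemma isClopen_upperPart (W : WeierstrassCurve ℝ) [W.IsElliptic] {e a b : ℝ} (hb : b < e)
    (hab : ∀ x, x < e → (0 ≤ W.squareCubic x ↔ x ∈ Icc a b)) :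
    @IsClopen _ W.realPointTopology (W.upperPart e) := by
  let := W.realPointTopology
  have hind : IsInducing W.pointToOnePoint := ⟨rfl⟩
  have hcompl : (W.upperPart e)ᶜ = {P | ∃ x y h, P = .some x y h ∧ x ∈ Icc a b} := by
    ext P
    simp only [upperPart, mem_compl_iff, mem_ofPred_eq, not_forall, not_le]
    constructor
    · rintro ⟨x, y, h, rfl, hx⟩
      exact ⟨x, y, h, rfl, (hab x hx).1 (squareCubic_nonneg_of_equation h.1)⟩
    · rintro ⟨x, y, h, rfl, hx⟩
      exact ⟨x, y, h, rfl, hx.2.trans_lt hb⟩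
  have hA : ∀ x ∈ Icc a b, 0 ≤ W.squareCubic x := fun x hx => (hab x (hx.2.trans_lt hb)).2 hx
  rw [← isClopen_compl_iff]
  constructor
  · have hK : IsCompact (W.realBranch 1 '' Icc a b ∪ W.realBranch (-1) '' Icc a b) :=
      (isCompact_Icc.image (W.continuous_realBranch 1)).union
        (isCompact_Icc.image (W.continuous_realBranch (-1)))
    have : (W.upperPart e)ᶜ = W.pointToOnePoint ⁻¹'
        ((↑) '' (W.realBranch 1 '' Icc a b ∪ W.realBranch (-1) '' Icc a b)) := by
      rw [hcompl, ← W.image_pointToOnePoint _ hA, preimage_image_eq]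
      intro P Q hPQ
      rcases P with _ | ⟨x, y, h⟩ <;> rcases Q with _ | ⟨x', y', h'⟩
      · rfl
      · exact absurd hPQ (OnePoint.infty_ne_coe _)
      · exact absurd hPQ (OnePoint.coe_ne_infty _)
      · have := OnePoint.coe_injective hPQ
        simp only [Prod.mk.injEq] at this
        obtain ⟨rfl, rfl⟩ := this
        rfl
    rw [this]
    exact (OnePoint.isClosed_image_coe.2 ⟨hK.isClosed, hK⟩).preimage hind.continuous
  · have : (W.upperPart e)ᶜ = W.pointToOnePoint ⁻¹' ((↑) '' {q : ℝ × ℝ | q.1 < e}) := by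
      ext P
      rcases P with _ | ⟨x, y, h⟩
      · simp [upperPart, pointToOnePoint]
      · simp [upperPart, pointToOnePoint, h]
    rw [this]
    exact (OnePoint.isOpen_image_coe.2 (isOpen_lt continuous_fst continuous_const)).preimage
      hind.continuous

lemma connectedComponent_zero_eq (W : WeierstrassCurve ℝ) [W.IsElliptic] {e a b : ℝ} (hb : b < e)
    (he : W.squareCubic e = 0) (hpos : ∀ x, e ≤ x → 0 ≤ W.squareCubic x)
    (hab : ∀ x, x < e → (0 ≤ W.squareCubic x ↔ x ∈ Icc a b)) :
    @connectedComponent _ W.realPointTopology 0 = W.upperPart e := by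
  let := W.realPointTopology
  have h0 : (0 : W.toAffine.Point) ∈ W.upperPart e := by
    rw [upperPart_eq]; exact mem_insert _ _
  exact subset_antisymm ((W.isClopen_upperPart hb hab).connectedComponent_subset h0)
    ((W.isPreconnected_upperPart he hpos).subset_connectedComponent h0)

/-- If the curve has no real point above `c`, then an even number of three collinear points lie to
the left of `c`: the line through them meets the vertical line at `c` in a point where the
equation of the curve does not vanish and has a known sign. -/
lemma mul_addX_sub_pos (W : WeierstrassCurve ℝ) {c x₁ x₂ y₁ y₂ : ℝ} (hc : W.squareCubic c < 0)
    (h₁ : W.toAffine.Equation x₁ y₁) (h₂ : W.toAffine.Equation x₂ y₂)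
    (hxy : ¬(x₁ = x₂ ∧ y₁ = W.toAffine.negY x₂ y₂)) :
    0 < (x₁ - c) * (x₂ - c) *
      (W.toAffine.addX x₁ x₂ (W.toAffine.slope x₁ x₂ y₁ y₂) - c) := by
  have h := congrArg (Polynomial.eval c) (Affine.addPolynomial_slope h₁ h₂ hxy)
  rw [Affine.addPolynomial_eq] at h
  simp only [Cubic.toPoly, Polynomial.eval_neg, Polynomial.eval_add, Polynomial.eval_mul,
    Polynomial.eval_C, Polynomial.eval_pow, Polynomial.eval_X, Polynomial.eval_sub] at h
  generalize W.toAffine.slope x₁ x₂ y₁ y₂ = ℓ at h ⊢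
  have hsq := sq_nonneg (ℓ * (c - x₁) + y₁ + (W.a₁ * c + W.a₃) / 2)
  rw [squareCubic, b₂, b₄, b₆] at hc
  nlinarith

/-- Two points on the same side of a gap in the real locus have their sum on the right of it. -/
lemma add_mem_upperPart (W : WeierstrassCurve ℝ) {e c : ℝ} (hce : c < e)
    (hc : ∀ x, c ≤ x → x < e → W.squareCubic x < 0) {P Q : W.toAffine.Point}
    (hPQ : P ∈ W.upperPart e ↔ Q ∈ W.upperPart e) : P + Q ∈ W.upperPart e := by
  have key : ∀ x y (h : W.toAffine.Nonsingular x y),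
      Affine.Point.some x y h ∈ W.upperPart e ↔ 0 < x - c := by
    intro x y h
    simp only [upperPart, mem_ofPred_eq, Affine.Point.some.injEq, sub_pos]
    constructor
    · intro h'
      exact hce.trans_le (h' x y h ⟨rfl, rfl⟩)
    · rintro hx _ _ _ ⟨rfl, rfl⟩
      by_contra! hlt
      exact absurd (hc _ hx.le hlt) (not_lt.2 (squareCubic_nonneg_of_equation h.1))
  have h0 : (0 : W.toAffine.Point) ∈ W.upperPart e := by
    rw [upperPart_eq]; exact mem_insert _ _
  rcases P with _ | ⟨x₁, y₁, h₁⟩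
  · rw [← Affine.Point.zero_def] at hPQ ⊢
    rw [zero_add]
    exact hPQ.1 h0
  rcases Q with _ | ⟨x₂, y₂, h₂⟩
  · rw [← Affine.Point.zero_def] at hPQ ⊢
    rw [add_zero]
    exact hPQ.2 h0
  by_cases hxy : x₁ = x₂ ∧ y₁ = W.toAffine.negY x₂ y₂
  · rw [Affine.Point.add_of_Y_eq hxy.1 hxy.2]
    exact h0
  rw [key, key] at hPQ
  rw [Affine.Point.add_some hxy, key]
  have hprod := W.mul_addX_sub_pos (hc c le_rfl hce) h₁.1 h₂.1 hxy
  have hne : ∀ x y, W.toAffine.Nonsingular x y → x - c ≠ 0 := by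
    intro x y h hx
    rw [sub_eq_zero] at hx
    subst hx
    exact absurd (hc x le_rfl hce) (not_lt.2 (squareCubic_nonneg_of_equation h.1))
  refine (mul_pos_iff_of_pos_left ?_).1 hprod
  rcases lt_or_gt_of_ne (hne x₁ y₁ h₁) with hx | hx
  · have : x₂ - c < 0 := lt_of_le_of_ne (not_lt.1 fun h => by linarith [hPQ.2 h]) (hne x₂ y₂ h₂)
    exact mul_pos_of_neg_of_neg hx this
  · exact mul_pos hx (hPQ.1 hx)

/-- With three real roots the real locus has two components. -/
theorem index_realIdentityComponent_of_three_roots (W : WeierstrassCurve ℝ) [W.IsElliptic]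
    {e₁ e₂ e₃ : ℝ} (h₁₂ : e₁ < e₂) (h₂₃ : e₂ < e₃)
    (hg : ∀ x, W.squareCubic x = (x - e₁) * (x - e₂) * (x - e₃)) :
    W.realIdentityComponent.index = 2 := by
  have hneg : ∀ x, e₂ < x → x < e₃ → W.squareCubic x < 0 := fun x h h' => by
    rw [hg]
    exact mul_neg_of_pos_of_neg (mul_pos (by linarith) (by linarith)) (by linarith)
  have hadd : ∀ {P Q : W.toAffine.Point}, (P ∈ W.upperPart e₃ ↔ Q ∈ W.upperPart e₃) →
      P + Q ∈ W.upperPart e₃ := W.add_mem_upperPart (c := (e₂ + e₃) / 2) (by linarith)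
    (fun x hx hx' => hneg x (by linarith) hx')
  let H : AddSubgroup W.toAffine.Point :=
    { carrier := W.upperPart e₃
      add_mem' := fun hP hQ => hadd (iff_of_true hP hQ)
      zero_mem' := by rw [upperPart_eq]; exact mem_insert _ _
      neg_mem' := by
        intro P hP
        rcases P with _ | ⟨x, y, h⟩
        · exact hP
        · intro x' y' h' heq
          rw [Affine.Point.neg_some, Affine.Point.some.injEq] at heq
          exact heq.1 ▸ hP x y h rfl }
  have hcomp : W.realIdentityComponent = H := by
    rw [realIdentityComponent, W.connectedComponent_zero_eq (e := e₃) (a := e₁) (b := e₂) h₂₃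
      (by rw [hg]; ring) (fun x hx => by
        rw [hg]
        exact mul_nonneg (mul_nonneg (by linarith) (by linarith)) (by linarith)) (fun x hx => ?_)]
    · exact AddSubgroup.closure_eq H
    · rw [hg]
      constructor
      · intro h
        have h' : (x - e₁) * (x - e₂) ≤ 0 := by
          by_contra! hcon
          exact absurd h (not_le.2 (mul_neg_of_pos_of_neg hcon (by linarith)))
        constructor
        · by_contra! hlt; nlinarith
        · by_contra! hlt; nlinarith
      · rintro ⟨h, h'⟩
        exact mul_nonneg_of_nonpos_of_nonpos
          (mul_nonpos_of_nonneg_of_nonpos (by linarith) (by linarith)) (by linarith)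
  rw [hcomp, AddSubgroup.index_eq_two_iff_exists_notMem_and]
  have heq : W.toAffine.Equation e₁ (W.realBranch 1 e₁).2 :=
    (W.equation_iff_realBranch (by rw [hg]; simp)).2 (Or.inl rfl)
  have hnot : Affine.Point.some e₁ _ ((Affine.equation_iff_nonsingular).1 heq) ∉
      W.upperPart e₃ := fun h => by linarith [h _ _ _ rfl]
  -- the point of order two above `e₁` represents the other coset
  refine ⟨_, hnot, fun P => ?_⟩
  by_cases hP : P ∈ W.upperPart e₃
  · exact Or.inr hP
  · exact Or.inl (hadd (iff_of_false hP hnot))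

/-- With one real root the real locus is connected. -/
theorem index_realIdentityComponent_of_one_root (W : WeierstrassCurve ℝ) [W.IsElliptic]
    {e α β : ℝ} (hαβ : α ^ 2 < 4 * β)
    (hg : ∀ x, W.squareCubic x = (x - e) * ((x - e) ^ 2 + α * (x - e) + β)) :
    W.realIdentityComponent.index = 1 := by
  have hq : ∀ x, 0 < (x - e) ^ 2 + α * (x - e) + β := fun x => by
    nlinarith [sq_nonneg (2 * (x - e) + α)]
  -- there are no points to the left of `e`, which is expressed by the empty interval `[e, e - 1]`
  rw [realIdentityComponent, W.connectedComponent_zero_eq (e := e) (a := e) (b := e - 1)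
    (by linarith) (by rw [hg]; ring) (fun x hx => by
      rw [hg]; exact mul_nonneg (by linarith) (hq x).le) (fun x hx => ?_)]
  · have : W.upperPart e = univ := by
      rw [eq_univ_iff_forall]
      rintro P x y h rfl
      have h0 := squareCubic_nonneg_of_equation h.1
      rw [hg, mul_nonneg_iff_of_pos_right (hq x)] at h0
      linarith
    rw [this, AddSubgroup.closure_univ, AddSubgroup.index_top]
  · rw [hg, mul_nonneg_iff_of_pos_right (hq x)]
    constructor
    · intro h; linarith
    · rintro ⟨h, -⟩; linarith

end Components

/-! ### The product of the periods -/

/-- Up to the scaling of the differential, the second factor is the real period of a twist by a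
negative number. -/
theorem realIntegral_mul_realIntegral (W : WeierstrassCurve ℝ) [W.IsElliptic] :
    (realIntegral W.squareCubic {x | 0 < W.squareCubic x}).toReal *
        (realIntegral W.squareCubic {x | W.squareCubic x < 0}).toReal =
      W.realIdentityComponent.index * (W.map Complex.ofRealHom).periodNormSq := by
  rw [periodNormSq_eq, ← ENNReal.toReal_mul]
  rcases W.squareCubic_cases W.isUnit_Δ.ne_zero with
    ⟨e₁, e₂, e₃, h₁₂, h₂₃, hg, hg'⟩ | ⟨e, α, β, hαβ, hg, hg'⟩
  · rw [W.index_realIdentityComponent_of_three_roots h₁₂ h₂₃ hg,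
      realIntegral_mul_of_three_roots h₁₂ h₂₃ hg, ENNReal.toReal_mul, funext hg']
    norm_num
  · rw [W.index_realIdentityComponent_of_one_root hαβ hg, realIntegral_mul_of_one_root hαβ hg,
      funext hg']
    norm_num

end Periods

end WeierstrassCurve

open WeierstrassCurve in
theorem mainTheorem12 (W W' : WeierstrassCurve ℤ) (d : ℤ)
    (hW : W.IsGlobalMinimal) (hW' : W'.IsGlobalMinimal)
    (hd : d < 0) (hsq : Squarefree d)
    (htwist : ∃ C : WeierstrassCurve.VariableChange ℚ,
      C • (W.baseChange ℚ).quadraticTwist (d : ℚ) = W'.baseChange ℚ) :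
    (W.baseChange ℝ).realPeriod * (W'.baseChange ℝ).realPeriod * Real.sqrt (W.twistDelta d) =
      ((W.baseChange ℝ).realIdentityComponent.index : ℝ) * (W.baseChange ℂ).periodNormSq := by
  obtain ⟨C, hC⟩ := htwist
  have hdq : (d : ℚ) ≠ 0 := by exact_mod_cast hd.ne
  have hu : (C.u : ℚ) ≠ 0 := C.u.ne_zero
  have hell := hW.isElliptic
  have hbR : W.baseChange ℝ = (W.baseChange ℚ).map (algebraMap ℚ ℝ) := by
    rw [baseChange, baseChange, map_map, ← IsScalarTower.algebraMap_eq]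
  have hbR' : W'.baseChange ℝ = (W'.baseChange ℚ).map (algebraMap ℚ ℝ) := by
    rw [baseChange, baseChange, map_map, ← IsScalarTower.algebraMap_eq]
  have hbC : W.baseChange ℂ = (W.baseChange ℝ).map Complex.ofRealHom := by
    rw [baseChange, baseChange, map_map]
    congr 1
  have hellR : (W.baseChange ℝ).IsElliptic := by rw [hbR]; infer_instance
  have h₄ : (W.c₄ : ℚ) = ((C.u : ℚ) ^ 2 / d) ^ 2 * W'.c₄ := by
    have h := congrArg c₄ hC
    rw [variableChange_c₄, c₄_quadraticTwist, baseChange, baseChange, map_c₄, map_c₄,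
      Units.val_inv_eq_inv_val] at h
    simp only [eq_intCast] at h
    rw [← h]
    field_simp
  have h₆ : (W.c₆ : ℚ) = ((C.u : ℚ) ^ 2 / d) ^ 3 * W'.c₆ := by
    have h := congrArg c₆ hC
    rw [variableChange_c₆, c₆_quadraticTwist, baseChange, baseChange, map_c₆, map_c₆,
      Units.val_inv_eq_inv_val] at h
    simp only [eq_intCast] at h
    rw [← h]
    field_simp
  have hδ := abs_scaling_mul_twistDelta hW hW' hsq hu h₄ h₆
  have hκ : algebraMap ℚ ℝ ((C.u : ℚ) ^ 2 / d) < 0 := by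
    rw [eq_ratCast, Rat.cast_lt_zero]
    exact div_neg_of_pos_of_neg (by positivity) (by exact_mod_cast hd)
  have hΩ' := realIntegral_comp_affine hκ (W.baseChange ℝ).continuous_squareCubic (fun x => by
    rw [hbR]; exact squareCubic_quadraticTwist hdq hC (algebraMap ℚ ℝ) x)
  rw [← hbR', ← realPeriod_eq] at hΩ'
  rw [hbC, ← realIntegral_mul_realIntegral, hΩ', realPeriod_eq]
  have hone : √|algebraMap ℚ ℝ ((C.u : ℚ) ^ 2 / d)| * √(W.twistDelta d) = 1 := by
    rw [← Real.sqrt_mul (abs_nonneg _), eq_ratCast, ← Rat.cast_abs, hδ, Real.sqrt_one]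
  linear_combination (realIntegral (W.baseChange ℝ).squareCubic
    {x | 0 < (W.baseChange ℝ).squareCubic x}).toReal * (realIntegral (W.baseChange ℝ).squareCubic
    {x | (W.baseChange ℝ).squareCubic x < 0}).toReal * hone
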